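/- Corollary 1.3. Let $X$ be a smooth Riemannian manifold of dimension $n$ with Levi-Civita connection $\nabla^{TX}$ and curvature $R^{TX}$, and let $W$ be a real Euclidean vector bundle of rank $2l$ over $X$ with a Euclidean connection $\nabla^W$ and curvature $R^W$. Put $$\widehat A(TX)={\det}^{1/2}\!\left(\frac{\frac{\sqrt{-1}}{4\pi}R^{TX}}{\sinh\left(\frac{\sqrt{-1}}{4\pi}R^{TX}\right)}\right),\qquad p_1(E)=-\frac1{8\pi^2}\operatorname{tr}\big((R^E)^2\big),\qquad \mathrm{ch}(F)=\operatorname{tr}\exp\left(\frac{\sqrt{-1}}{2\pi}R^F\right),$$ extended by $\mathrm{ch}(F-G)=\mathrm{ch}(F)-\mathrm{ch}(G)$ to virtual bundles with connection, where ${\det}^{1/2}(f(R))=\exp(\tfrac12\operatorname{tr}\log f(R))$ for power series $f$ with $f(0)=1$, and ${\det}^{1/2}\big(2\cosh(\tfrac{\sqrt{-1}}{4\pi}R^W)\big)=2^l{\det}^{1/2}\big(\cosh(\tfrac{\sqrt{-1}}{4\pi}R^W)\big)$. Write $x=p_1(TX)-p_1(W)$, write $\omega^{(j)}$ for the degree $j$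 component of a form $\omega$ (zero for $j<0$), and read $\frac{e^{cx}-1}{x}$ as $\sum_{k\ge 1}c^kx^{k-1}/k!$. Let $\xi=(\mathbf R^2,d)$ be the trivial bundle of rank $2$ with the trivial connection, $\xi_{\mathbf C}=\mathbf C^2$, let $\widetilde E=E-\operatorname{rank}E$, $\Lambda_t(F)=\sum_k t^k\Lambda^k(F)$, $S_t(F)=\sum_k t^kS^k(F)$, $\Lambda_t(F-G)=\Lambda_t(F)/\Lambda_t(G)$, $S_t(F-G)=S_t(F)/S_t(G)$, and $$\Theta_2=\bigotimes_{u\ge1}S_{q^u}(\widetilde{T_{\mathbf C}X})\otimes\bigotimes_{v\ge1}\Lambda_{-q^{v-1/2}}(\widetilde{W_{\mathbf C}}-2\widetilde{\xi_{\mathbf C}})\otimes\bigotimes_{r\ge1}\Lambda_{q^{r-1/2}}(\widetilde{\xi_{\mathbf C}})\otimes\bigotimes_{s\ge1}\Lambda_{q^{s}}(\widetilde{\xi_{\mathbf C}}),$$ a power series in $q^{1/2}$ whose coefficients are integral combinations of tensor products of symmetric and exterior powers of $T_{\mathbf C}X$, $W_{\mathbf C}$ and $\xi_{\mathbf C}$,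 with the induced connections. Let $$\delta_2=-\tfrac18-3\sum_{k\ge1}\sum_{d\mid k,\ d\text{ odd}}d\,q^{k/2},\qquad \varepsilon_2=\sum_{k\ge1}\sum_{d\mid k,\ k/d\text{ odd}}d^3q^{k/2},\qquad E_2=1-24\sum_{k\ge1}\sum_{d\mid k}d\,q^k.$$ (1) Let $n=8m+4$, $m\ge0$. Define virtual bundles $b_r=b_r(T_{\mathbf C}X,W_{\mathbf C},\mathbf C^2)$ and forms $\beta_r$ of degree $8m$, $0\le r\le m$, by the congruences modulo $q^{(m+1)/2}$ $$\Theta_2\equiv\sum_{r=0}^m b_r(8\delta_2)^{2m+1-2r}\varepsilon_2^r,\qquad \left\{\frac{e^{\frac1{24}E_2x}-1}{x}\,\widehat A(TX)\,\mathrm{ch}(\Theta_2)\right\}^{(8m)}\equiv\sum_{r=0}^m\beta_r(8\delta_2)^{2m+1-2r}\varepsilon_2^r .$$ These determine the $b_r$ and $\beta_r$ uniquely, and $$\left\{\widehat A(TX){\det}^{1/2}\!\left(2\cosh\left(\tfrac{\sqrt{-1}}{4\pi}R^W\right)\right)\right\}^{(8m+4)}-\sum_{r=0}^m2^{l+2m+1-6r}\left\{\widehat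 A(TX)\,\mathrm{ch}(b_r)\right\}^{(8m+4)}=\big(p_1(TX)-p_1(W)\big)\cdot\mathfrak B(\nabla^{TX},\nabla^W,d),$$ $$\mathfrak B(\nabla^{TX},\nabla^W,d)=\sum_{r=0}^m2^{l+2m+1-6r}\beta_r-\left\{\frac{e^{\frac1{24}x}-1}{x}\,\widehat A(TX){\det}^{1/2}\!\left(2\cosh\left(\tfrac{\sqrt{-1}}{4\pi}R^W\right)\right)\right\}^{(8m)}.$$ (2) Let $n=8m$, $m\ge0$. Define virtual bundles $z_r=z_r(T_{\mathbf C}X,W_{\mathbf C},\mathbf C^2)$ and forms $\zeta_r$ of degree $8m-4$, $0\le r\le m$, by the congruences modulo $q^{(m+1)/2}$ $$\Theta_2\equiv\sum_{r=0}^m z_r(8\delta_2)^{2m-2r}\varepsilon_2^r,\qquad \left\{\frac{e^{\frac1{24}E_2x}-1}{x}\,\widehat A(TX)\,\mathrm{ch}(\Theta_2)\right\}^{(8m-4)}\equiv\sum_{r=0}^m\zeta_r(8\delta_2)^{2m-2r}\varepsilon_2^r .$$ These determine the $z_r$ and $\zeta_r$ uniquely, and $$\left\{\widehat A(TX){\det}^{1/2}\!\left(2\cosh\left(\tfrac{\sqrt{-1}}{4\pi}R^W\right)\right)\right\}^{(8m)}-\sum_{r=0}^m2^{l+2m-6r}\left\{\widehat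 A(TX)\,\mathrm{ch}(z_r)\right\}^{(8m)}=\big(p_1(TX)-p_1(W)\big)\cdot\mathfrak Z(\nabla^{TX},\nabla^W,d),$$ $$\mathfrak Z(\nabla^{TX},\nabla^W,d)=\sum_{r=0}^m2^{l+2m-6r}\zeta_r-\left\{\frac{e^{\frac1{24}x}-1}{x}\,\widehat A(TX){\det}^{1/2}\!\left(2\cosh\left(\tfrac{\sqrt{-1}}{4\pi}R^W\right)\right)\right\}^{(8m-4)}.$$ -/

import Mathlib

open Bundle Manifold ContDiff
open scoped Matrix

noncomputable section

namespace AnomalyCancellation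

/-! ### Complex differential forms at a point

Everything below is an identity of differential forms, i.e. an identity at every point `x`, in
the algebra `Λ^*(T_x^*X) ⊗ ℂ`.  It is written in the coordinates `x^1, …, x^n` of the chart at
`x`, in which `Λ^*(T_x^*X) ⊗ ℂ` is the exterior algebra on the basis `dx^1, …, dx^n`. -/

/-- The model space `ℝⁿ` of the manifold. -/
abbrev Coord (n : ℕ) : Type := EuclideanSpace ℝ (Fin n)

/-- `Λ^*(T_x^*X) ⊗ ℂ`, where `T_x^*X` has the basis `dx^1, …, dx^n`. -/
abbrev Form (n : ℕ) : Type := ExteriorAlgebra ℂ (Fin n → ℂ)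

/-- The coordinate one-form `dx^a`. -/
def dx {n : ℕ} (a : Fin n) : Form n := ExteriorAlgebra.ι ℂ (Pi.single a 1)

/-- The degree `j` component `ω^{(j)}` of a form `ω`; it is zero for negative `j`. -/
def degPart {n : ℕ} (j : ℤ) (w : Form n) : Form n :=
  if 0 ≤ j then GradedRing.proj (fun i : ℕ => ⋀[ℂ]^i (Fin n → ℂ)) j.toNat w else 0

/-- The value `∑ f_k y^k` of a power series `f` at a form, or matrix of forms, `y` without
component in degree zero.  On an `n`-dimensional manifold `y^k = 0` for `k > n`, so the sum stops
at `k = n`. -/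
def psEval (n : ℕ) {A : Type*} [Semiring A] [Algebra ℂ A] (f : PowerSeries ℂ) (y : A) : A :=
  ∑ k ∈ Finset.range (n + 1), PowerSeries.coeff k f • y ^ k

/-! ### Vector bundles with connection in a chart -/

/-- A complex vector bundle with connection on a coordinate patch, trivialised by a frame
`(e_i)` indexed by `idx`: for each coordinate direction `a`, the matrix `conn a` of functions such
that `∇_{∂/∂x^a} e_j = ∑ i, (conn a)_{i j} e_i`. -/
structure LocalBundle (n : ℕ) where
  /-- the index set of the frame -/
  idx : Type
  [fin : Fintype idx]
  [dec : DecidableEq idx]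
  /-- the components of the connection form -/
  conn : Fin n → Coord n → Matrix idx idx ℂ

attribute [instance] LocalBundle.fin LocalBundle.dec

namespace LocalBundle

variable {n : ℕ}

/-- The curvature `R = ∇² = dω + ω ∧ ω` at the point with coordinates `p`, a matrix of two-forms
`∑_{a < b} (∂_a ω_b - ∂_b ω_a + [ω_a, ω_b]) dx^a ∧ dx^b`. -/
def curvature (E : LocalBundle n) (p : Coord n) : Matrix E.idx E.idx (Form n) :=
  fun i j => ∑ a : Fin n, ∑ b : Fin n, if a < b then
    (fderiv ℝ (fun y => E.conn b y i j) p (EuclideanSpace.single a 1)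
      - fderiv ℝ (fun y => E.conn a y i j) p (EuclideanSpace.single b 1)
      + (E.conn a p * E.conn b p - E.conn b p * E.conn a p) i j) • (dx a * dx b)
    else 0

/-- The Chern character form `ch(E, ∇) = tr exp (√-1/(2π) R)`. -/
def ch (E : LocalBundle n) (p : Coord n) : Form n :=
  Matrix.trace (psEval n (PowerSeries.exp ℂ)
    ((Complex.I / (2 * Real.pi)) • E.curvature p))

/-- The first Pontryagin form `p_1(E, ∇) = -1/(8π²) tr R²`, for the complexification of a real
bundle. -/
def p1 (E : LocalBundle n) (p : Coord n) : Form n :=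
  (-1 / (8 * (Real.pi : ℂ) ^ 2)) • Matrix.trace (E.curvature p ^ 2)

/-- `det^{1/2} (f (√-1/(4π) R)) = exp (1/2 tr log f (√-1/(4π) R))`, for an even power
series `f` with constant term `1`. -/
def detHalf (f : PowerSeries ℂ) (E : LocalBundle n) (p : Coord n) : Form n :=
  psEval n (PowerSeries.exp ℂ) ((1 / 2 : ℂ) • Matrix.trace (psEval n (PowerSeries.log ℂ)
    (psEval n f ((Complex.I / (4 * Real.pi)) • E.curvature p) - 1)))

/-- The `\hat A`-form `det^{1/2} ((√-1/(4π) R) / sinh (√-1/(4π) R))`.  The inner series is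
`sinh(z) / z`. -/
def aHat (E : LocalBundle n) (p : Coord n) : Form n :=
  E.detHalf (PowerSeries.mk fun k => if Even k then 1 / ((k + 1).factorial : ℂ) else 0)⁻¹ p

/-- `det^{1/2} (2 cosh (√-1/(4π) R))` for a bundle of rank `2 l`; the factor `2` contributes
`det^{1/2} (2) = 2^l`. -/
def detHalfTwoCosh (l : ℕ) (E : LocalBundle n) (p : Coord n) : Form n :=
  (2 : ℂ) ^ l •
    E.detHalf (PowerSeries.mk fun k => if Even k then 1 / (k.factorial : ℂ) else 0) p

/-- The tensor product `⨂_j E_j` with its induced connection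
`∑_j 1 ⊗ ⋯ ⊗ ∇^{E_j} ⊗ ⋯ ⊗ 1`. -/
def tensor {J : Type} [Fintype J] [DecidableEq J] (E : J → LocalBundle n) : LocalBundle n where
  idx := ∀ j, (E j).idx
  conn a y := fun s t => ∑ j, if ∀ j', j' ≠ j → s j' = t j' then (E j).conn a y (s j) (t j) else 0

/-- The exterior power `Λ^k E` with its induced connection, in the frame
`e_{s_1} ∧ ⋯ ∧ e_{s_k}`, `s_1 < ⋯ < s_k`.  In this frame `Λ^k` of a matrix `g` has the
entries `det g[s, t]`, and a connection matrix `A` of `E` induces the derivative at `t = 0` of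
`Λ^k(1 + t A)`. -/
def extPow {N : ℕ} (A : Fin n → Coord n → Matrix (Fin N) (Fin N) ℂ) (k : ℕ) : LocalBundle n where
  idx := {s : Finset (Fin N) // s.card = k}
  conn a y := fun s t =>
    (((1 + (Polynomial.X : Polynomial ℂ) • (A a y).map Polynomial.C).submatrix
      (s.1.orderEmbOfFin s.2) (t.1.orderEmbOfFin t.2)).det).coeff 1

/-- The symmetric power `S^k E` with its induced connection, in the frame of the monomials of
degree `k` in the `e_i`: a connection matrix `A` of `E` acts on them as the derivation with
`e_j ↦ ∑ i, A_{i j} e_i`. -/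
def symPow {N : ℕ} (A : Fin n → Coord n → Matrix (Fin N) (Fin N) ℂ) (k : ℕ) : LocalBundle n where
  idx := Sym (Fin N) k
  conn a y := fun s t =>
    MvPolynomial.coeff (Multiset.toFinsupp (s : Multiset (Fin N)))
      (MvPolynomial.mkDerivation ℂ
        (fun j => ∑ i, MvPolynomial.C (A a y i j) * (MvPolynomial.X i : MvPolynomial (Fin N) ℂ))
        (MvPolynomial.monomial (Multiset.toFinsupp (t : Multiset (Fin N))) 1))

end LocalBundle

/-- `∇` is the Levi-Civita connection of the Riemannian metric: it is compatible with the metric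
and torsion-free. -/
def IsLeviCivita {n : ℕ} {X : Type*} [TopologicalSpace X] [ChartedSpace (Coord n) X]
    [IsManifold (𝓡 n) ∞ X] [RiemannianBundle (fun x : X => TangentSpace (𝓡 n) x)]
    [IsContMDiffRiemannianBundle (𝓡 n) ∞ (Coord n) (fun x : X => TangentSpace (𝓡 n) x)]
    (cov : CovariantDerivative (𝓡 n) (Coord n) (fun x : X => TangentSpace (𝓡 n) x)) : Prop :=
  haveI : IsContMDiffRiemannianBundle (𝓡 n) 1 (Coord n) (fun x : X => TangentSpace (𝓡 n) x) :=
    .of_le (n := ∞) (by simp)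
  CovariantDerivative.IsMetricCompatible (V := fun x : X => TangentSpace (𝓡 n) x) cov ∧
    cov.torsion = 0

/-- The complexified components of the connection form of `∇` in the chart of the manifold and
the trivialisation of the bundle at `x₀`: the coefficient along the frame section `e_i` of
`∇_{∂/∂x^a} e_j`, complexified, as a function of the coordinates. -/
def connForm {n N : ℕ} {X : Type*} [TopologicalSpace X] [ChartedSpace (Coord n) X]
    [IsManifold (𝓡 n) ∞ X] {V : X → Type*} [TopologicalSpace (TotalSpace (Coord N) V)]
    [∀ x, AddCommGroup (V x)] [∀ x, Module ℝ (V x)] [∀ x, TopologicalSpace (V x)]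
    [FiberBundle (Coord N) V] [VectorBundle ℝ (Coord N) V]
    [ContMDiffVectorBundle ∞ (Coord N) V (𝓡 n)]
    [∀ x, IsTopologicalAddGroup (V x)] [∀ x, ContinuousSMul ℝ (V x)]
    (cov : CovariantDerivative (𝓡 n) (Coord N) V) (x₀ : X) :
    Fin n → Coord n → Matrix (Fin N) (Fin N) ℂ :=
  fun a p i j =>
    let y : X := (extChartAt (𝓡 n) x₀).symm p
    let e := trivializationAt (Coord N) V x₀
    let b := (EuclideanSpace.basisFun (Fin N) ℝ).toBasis
    let v : TangentSpace (𝓡 n) y :=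
      (trivializationAt (Coord n) (TangentSpace (𝓡 n)) x₀).localFrame
        (EuclideanSpace.basisFun (Fin n) ℝ).toBasis a y
    ((e.localFrameCoeff (𝓡 n) b i y (cov (e.localFrame b j) y v) : ℝ) : ℂ)

/-! ### Virtual bundles -/

/-- The bundles from which the virtual bundles below are built (`k ≥ 1`): `S^k(T_ℂ X)`,
`Λ^k(W_ℂ)` and `Λ^k(ξ_ℂ)`. -/
inductive Gen : Type
  | symT (k : ℕ)
  | extW (k : ℕ)
  | extXi (k : ℕ)

/-- Formal integral combinations of tensor products of the bundles in `Gen`, with the tensor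
product as multiplication; `1` is the trivial line bundle `ℂ` (the empty tensor product).  Each
element is a virtual bundle with a canonically induced connection. -/
abbrev VirtualBundle : Type := MvPolynomial Gen ℤ

/-- Three bundles with connections in a chart: `TX`, `W`, `ξ` of ranks `n`, `N`, `M`, complexified. -/
structure BundleTriple (n N M : ℕ) where
  /-- the connection form of `T_ℂ X` -/
  T : Fin n → Coord n → Matrix (Fin n) (Fin n) ℂ
  /-- the connection form of `W_ℂ` -/
  W : Fin n → Coord n → Matrix (Fin N) (Fin N) ℂ
  /-- the connection form of `ξ_ℂ` -/
  xi : Fin n → Coord n → Matrix (Fin M) (Fin M) ℂ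

namespace BundleTriple

variable {n N M : ℕ}

/-- `T_ℂ X` with its connection. -/
def tangent (D : BundleTriple n N M) : LocalBundle n := ⟨Fin n, D.T⟩

/-- `W_ℂ` with its connection. -/
def aux (D : BundleTriple n N M) : LocalBundle n := ⟨Fin N, D.W⟩

/-- The actual bundle with induced connection denoted by a generator. -/
def gen (D : BundleTriple n N M) : Gen → LocalBundle n
  | .symT k => LocalBundle.symPow D.T k
  | .extW k => LocalBundle.extPow D.W k
  | .extXi k => LocalBundle.extPow D.xi k

open Classical in
/-- The tensor product `⨂_g g^{⊗ s(g)}` with its induced connection. -/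
def monomialBundle (D : BundleTriple n N M) (s : Gen →₀ ℕ) : LocalBundle n :=
  LocalBundle.tensor (J := Σ g : s.support, Fin (s g)) fun j => D.gen j.1

/-- The Chern character form of a virtual bundle: `ch(F - G) = ch(F) - ch(G)`. -/
def ch (D : BundleTriple n N M) (p : Coord n) (F : VirtualBundle) : Form n :=
  ∑ s ∈ F.support, F.coeff s • (D.monomialBundle s).ch p

end BundleTriple

/-- The power series `∑_k a_k t^k` at `t = ± s^d`, `d ≥ 1`, where `s = q^{1/2}`; here `c = ±1`
is the sign. -/
def totalPower {R : Type*} [CommRing R] (a : ℕ → R) (c : ℤ) (d : ℕ) : PowerSeries R :=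
  PowerSeries.mk fun j => if d ∣ j then ((c ^ (j / d) : ℤ) : R) * a (j / d) else 0

/-- `S_t(T_ℂ X - rank) = S_t(T_ℂ X) / S_t(ℂ^n)` at `t = s^d`. -/
def symReduced (n d : ℕ) : PowerSeries VirtualBundle :=
  totalPower (fun k => if k = 0 then 1 else MvPolynomial.X (Gen.symT k)) 1 d *
    PowerSeries.invOfUnit (totalPower (fun k => (Nat.multichoose n k : VirtualBundle)) 1 d) 1

/-- `Λ_t(W_ℂ - rank) = Λ_t(W_ℂ) / Λ_t(ℂ^N)` at `t = c s^d`. -/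
def extWReduced (N : ℕ) (c : ℤ) (d : ℕ) : PowerSeries VirtualBundle :=
  totalPower (fun k => if k = 0 then 1 else MvPolynomial.X (Gen.extW k)) c d *
    PowerSeries.invOfUnit (totalPower (fun k => (Nat.choose N k : VirtualBundle)) c d) 1

/-- `Λ_t(ξ_ℂ - rank) = Λ_t(ξ_ℂ) / Λ_t(ℂ^M)` at `t = c s^d`. -/
def extXiReduced (M : ℕ) (c : ℤ) (d : ℕ) : PowerSeries VirtualBundle :=
  totalPower (fun k => if k = 0 then 1 else MvPolynomial.X (Gen.extXi k)) c d *
    PowerSeries.invOfUnit (totalPower (fun k => (Nat.choose M k : VirtualBundle)) c d) 1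

/-- `Θ_2(T_ℂ X, W_ℂ, ξ_ℂ)` as a power series in `s = q^{1/2}`, for bundles of ranks `n`, `N`, `M`:
the product over `u = 1, 2, …` of `S_{q^u}(T̃)`, `Λ_{-q^{u-1/2}}(W̃ - 2 ξ̃)`,
`Λ_{q^{u-1/2}}(ξ̃)` and `Λ_{q^u}(ξ̃)`, where a tilde denotes a bundle minus its rank.  The factors
with index `u > j` are `1` modulo `s^{j+1}`, so the coefficient of `s^j` is that of the product over
`1 ≤ u ≤ j + 1`. -/
def theta2 (n N M : ℕ) : PowerSeries VirtualBundle :=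
  PowerSeries.mk fun j => PowerSeries.coeff j (∏ u ∈ Finset.Icc 1 (j + 1),
    (symReduced n (2 * u) *
      (extWReduced N (-1) (2 * u - 1) *
        PowerSeries.invOfUnit (extXiReduced M (-1) (2 * u - 1)) 1 ^ 2) *
      extXiReduced M 1 (2 * u - 1) * extXiReduced M 1 (2 * u)))

/-! ### Modular forms, as power series in `s = q^{1/2}` -/

/-- `8 δ_2 = -1 - 24 ∑_{n ≥ 1} ∑_{d ∣ n, d odd} d q^{n/2}`. -/
def eightDelta2 : PowerSeries ℤ :=
  PowerSeries.mk fun j => if j = 0 then -1 else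
    -24 * ∑ d ∈ j.divisors.filter (fun d => Odd d), (d : ℤ)

/-- `ε_2 = ∑_{n ≥ 1} ∑_{d ∣ n, n/d odd} d³ q^{n/2}`. -/
def eps2 : PowerSeries ℤ :=
  PowerSeries.mk fun j => ∑ d ∈ j.divisors.filter (fun d => Odd (j / d)), (d : ℤ) ^ 3

/-- `E_2 = 1 - 24 ∑_{n ≥ 1} ∑_{d ∣ n} d q^n`. -/
def eisenstein2 : PowerSeries ℤ :=
  PowerSeries.mk fun j => if j = 0 then 1 else
    if 2 ∣ j then -24 * ∑ d ∈ (j / 2).divisors, (d : ℤ) else 0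

/-- `F ≡ ∑_{r=0}^m b_r (8 δ_2)^{w - 2 r} ε_2^r` modulo `q^{(m+1)/2}`, for `w ≥ 2 m`. -/
def IsExpansion {R : Type*} [Ring R] (m w : ℕ) (F : PowerSeries R) (b : Fin (m + 1) → R) : Prop :=
  ∀ j ≤ m, PowerSeries.coeff j F = PowerSeries.coeff j (∑ r : Fin (m + 1),
    PowerSeries.C (b r) * PowerSeries.map (Int.castRingHom R)
      (eightDelta2 ^ (w - 2 * (r : ℕ)) * eps2 ^ (r : ℕ)))

theorem coeff_eightDelta2_eps2 (k r j : ℕ) (hj : j ≤ r) :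
    PowerSeries.coeff j (eightDelta2 ^ k * eps2 ^ r) = if j = r then (-1) ^ k else 0 := by
  obtain ⟨u, hu⟩ : (PowerSeries.X : PowerSeries ℤ) ∣ eps2 := by
    rw [PowerSeries.X_dvd_iff]; simp [eps2]
  have hu1 : PowerSeries.constantCoeff u = 1 := by
    have h := congrArg (PowerSeries.coeff 1) hu
    rw [mul_comm, PowerSeries.coeff_succ_mul_X] at h
    rw [← PowerSeries.coeff_zero_eq_constantCoeff_apply, ← h]
    simp [eps2, Finset.filter_singleton]
  have hd : PowerSeries.constantCoeff eightDelta2 = -1 := by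
    rw [← PowerSeries.coeff_zero_eq_constantCoeff_apply]; simp [eightDelta2]
  have he : eightDelta2 ^ k * eps2 ^ r = (eightDelta2 ^ k * u ^ r) * PowerSeries.X ^ r := by
    rw [hu, mul_pow]; ring
  rw [he, PowerSeries.coeff_mul_X_pow']
  by_cases h : j = r
  · subst h
    simp [hu1, hd]
  · rw [if_neg (by omega), if_neg h]

theorem existsUnique_expansion {R : Type*} [Ring R] (m w : ℕ) (F : PowerSeries R) :
    ∃! b : Fin (m + 1) → R, IsExpansion m w F b := by
  set g : ℕ → PowerSeries R := fun r => PowerSeries.map (Int.castRingHom R)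
    (eightDelta2 ^ (w - 2 * r) * eps2 ^ r) with hg
  have hlt : ∀ r j, j < r → PowerSeries.coeff j (g r) = 0 := by
    intro r j h
    simp only [hg, PowerSeries.coeff_map]
    rw [coeff_eightDelta2_eps2 _ _ _ h.le, if_neg h.ne, map_zero]
  have hdiag : ∀ r, PowerSeries.coeff r (g r) * PowerSeries.coeff r (g r) = 1 := by
    intro r
    simp only [hg, PowerSeries.coeff_map]
    rw [coeff_eightDelta2_eps2 _ _ _ le_rfl, if_pos rfl, ← map_mul, ← mul_pow]
    simp
  have key : ∀ k : ℕ, ∃! b : Fin k → R, ∀ j < k,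
      PowerSeries.coeff j F = ∑ r : Fin k, b r * PowerSeries.coeff j (g r) := by
    intro k
    induction k with
    | zero => exact ⟨fun i => i.elim0, by simp, fun b _ => funext fun i => i.elim0⟩
    | succ k ih =>
      obtain ⟨b, hb, huniq⟩ := ih
      refine ⟨Fin.snoc (α := fun _ => R) b ((PowerSeries.coeff k F -
        ∑ r : Fin k, b r * PowerSeries.coeff k (g r)) * PowerSeries.coeff k (g k)), ?_, ?_⟩
      · intro j hj
        simp only [Fin.sum_univ_castSucc, Fin.snoc_castSucc, Fin.snoc_last, Fin.val_castSucc,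
          Fin.val_last]
        rcases Nat.lt_succ_iff_lt_or_eq.mp hj with h | rfl
        · rw [hlt k j h, mul_zero, add_zero]; exact hb j h
        · rw [mul_assoc, hdiag, mul_one]; abel
      · intro c hc
        have h1 : (fun r : Fin k => c r.castSucc) = b := by
          apply huniq
          intro j hj
          have := hc j (by omega)
          simp only [Fin.sum_univ_castSucc, Fin.val_castSucc, Fin.val_last] at this
          rw [hlt k j hj, mul_zero, add_zero] at this
          exact this
        have h2 := hc k (by omega)
        simp only [Fin.sum_univ_castSucc, Fin.val_castSucc, Fin.val_last] at h2
        have h3 : ∀ r : Fin k, c r.castSucc = b r := fun r => congrFun h1 r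
        simp only [h3] at h2
        funext i
        refine Fin.lastCases ?_ (fun i => ?_) i
        · rw [Fin.snoc_last, h2, add_sub_cancel_left, mul_assoc, hdiag, mul_one]
        · rw [Fin.snoc_castSucc, h3]
  have hiff : ∀ b : Fin (m + 1) → R, IsExpansion m w F b ↔ ∀ j < m + 1,
      PowerSeries.coeff j F = ∑ r : Fin (m + 1), b r * PowerSeries.coeff j (g r) := by
    intro b
    simp only [IsExpansion, map_sum, PowerSeries.coeff_C_mul, Nat.lt_succ_iff, hg]
  simp only [hiff]
  exact key (m + 1)

/-- The coefficients `b_0, …, b_m` determined by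
`F ≡ ∑_{r=0}^m b_r (8 δ_2)^{w - 2 r} ε_2^r` modulo `q^{(m+1)/2}`. -/
def expansion {R : Type*} [Ring R] (m w : ℕ) (F : PowerSeries R) : Fin (m + 1) → R :=
  (existsUnique_expansion m w F).exists.choose

theorem isExpansion_expansion {R : Type*} [Ring R] (m w : ℕ) (F : PowerSeries R) :
    IsExpansion m w F (expansion m w F) :=
  (existsUnique_expansion m w F).exists.choose_spec

namespace BundleTriple

variable {n N M : ℕ}

/-- `p_1(TX) - p_1(W)`. -/
def p1Diff (D : BundleTriple n N M) (p : Coord n) : Form n := D.tangent.p1 p - D.aux.p1 p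

/-- `(exp (x/24) - 1) / x = ∑_{k ≥ 0} x^k / (24^{k+1} (k+1)!)` at `x = p_1(TX) - p_1(W)`. -/
def expQuot (D : BundleTriple n N M) (p : Coord n) : Form n :=
  psEval n (PowerSeries.mk fun k => 1 / ((24 : ℂ) ^ (k + 1) * ((k + 1).factorial : ℂ)))
    (D.p1Diff p)

/-- `(exp (E_2 x/24) - 1) / x = ∑_{k ≥ 0} E_2^{k+1} x^k / (24^{k+1} (k+1)!)` at
`x = p_1(TX) - p_1(W)`, a power series in `s = q^{1/2}`; the terms with `k > n` vanish. -/
def expQuotE2 (D : BundleTriple n N M) (p : Coord n) : PowerSeries (Form n) :=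
  ∑ k ∈ Finset.range (n + 1),
    PowerSeries.map (Int.castRingHom (Form n)) (eisenstein2 ^ (k + 1)) *
      PowerSeries.C ((1 / ((24 : ℂ) ^ (k + 1) * ((k + 1).factorial : ℂ))) • D.p1Diff p ^ k)

/-- `ch(Θ_2(T_ℂ X, W_ℂ, ξ_ℂ))`, coefficient by coefficient. -/
def chTheta2 (D : BundleTriple n N M) (p : Coord n) : PowerSeries (Form n) :=
  PowerSeries.mk fun j => D.ch p (PowerSeries.coeff j (theta2 n N M))

/-- The series `{(exp (E_2 x/24) - 1)/x · \hat A(TX) ch(Θ_2(T_ℂ X, W_ℂ, ξ_ℂ))}^{(j)}` with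
`x = p_1(TX) - p_1(W)`, for a flat `ξ`, where the factor `cosh (e(ξ)/2)` is `1`. -/
def quotSeries (D : BundleTriple n N M) (j : ℤ) (p : Coord n) : PowerSeries (Form n) :=
  PowerSeries.mk fun i => degPart j (PowerSeries.coeff i
    (D.expQuotE2 p * PowerSeries.C (D.tangent.aHat p) * D.chTheta2 p))

end BundleTriple

/-- The virtual bundles `b_r(T_ℂ X, W_ℂ, ξ_ℂ)`, `0 ≤ r ≤ m`, with
`Θ_2 ≡ ∑ b_r (8 δ_2)^{2m+1-2r} ε_2^r` modulo `q^{(m+1)/2}`. -/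
def bundleB (m n N M : ℕ) : Fin (m + 1) → VirtualBundle := expansion m (2 * m + 1) (theta2 n N M)

/-- The virtual bundles `z_r(T_ℂ X, W_ℂ, ξ_ℂ)`, `0 ≤ r ≤ m`, with
`Θ_2 ≡ ∑ z_r (8 δ_2)^{2m-2r} ε_2^r` modulo `q^{(m+1)/2}`. -/
def bundleZ (m n N M : ℕ) : Fin (m + 1) → VirtualBundle := expansion m (2 * m) (theta2 n N M)

namespace BundleTriple

variable {n N M : ℕ}

/-- The forms `β_r` of degree `8 m`, for a flat `ξ`. -/
def beta (D : BundleTriple n N M) (m : ℕ) (p : Coord n) : Fin (m + 1) → Form n :=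
  expansion m (2 * m + 1) (D.quotSeries (8 * m) p)

/-- The forms `ζ_r` of degree `8 m - 4`, for a flat `ξ`. -/
def zeta (D : BundleTriple n N M) (m : ℕ) (p : Coord n) : Fin (m + 1) → Form n :=
  expansion m (2 * m) (D.quotSeries (8 * m - 4) p)

/-- The form `𝔅` for `W` of rank `2 l` and a flat `ξ`. -/
def formB (D : BundleTriple n N M) (m l : ℕ) (p : Coord n) : Form n :=
  ∑ r : Fin (m + 1), (2 : ℂ) ^ ((l : ℤ) + 2 * m + 1 - 6 * (r : ℕ)) • D.beta m p r
    - degPart (8 * m) (D.expQuot p * (D.tangent.aHat p * D.aux.detHalfTwoCosh l p))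

/-- The form `ℨ` for `W` of rank `2 l` and a flat `ξ`. -/
def formZ (D : BundleTriple n N M) (m l : ℕ) (p : Coord n) : Form n :=
  ∑ r : Fin (m + 1), (2 : ℂ) ^ ((l : ℤ) + 2 * m - 6 * (r : ℕ)) • D.zeta m p r
    - degPart (8 * m - 4) (D.expQuot p * (D.tangent.aHat p * D.aux.detHalfTwoCosh l p))

end BundleTriple

/-- `TX`, `W` with the given connections, and the trivial `ξ = (ℝ², d)`, in the chart of the
manifold and the trivialisations of the bundles at `x₀`. -/
def localTriple {n N : ℕ} {X : Type*} [TopologicalSpace X] [ChartedSpace (Coord n) X]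
    [IsManifold (𝓡 n) ∞ X] {V : X → Type*} [TopologicalSpace (TotalSpace (Coord N) V)]
    [∀ x, AddCommGroup (V x)] [∀ x, Module ℝ (V x)] [∀ x, TopologicalSpace (V x)]
    [FiberBundle (Coord N) V] [VectorBundle ℝ (Coord N) V]
    [ContMDiffVectorBundle ∞ (Coord N) V (𝓡 n)]
    [∀ x, IsTopologicalAddGroup (V x)] [∀ x, ContinuousSMul ℝ (V x)]
    (covT : CovariantDerivative (𝓡 n) (Coord n) (TangentSpace (𝓡 n) : X → Type))
    (covW : CovariantDerivative (𝓡 n) (Coord N) V) (x₀ : X) : BundleTriple n N 2 where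
  T := connForm covT x₀
  W := connForm covW x₀
  xi := fun _ _ => 0

end AnomalyCancellation

end

/-!
# An anomaly cancellation formula

Fix a point, and let `x = p_1(TX) - p_1(W)`. The identity holds because the forms
`P_2 = e^{E_2 x/24} Â(TX) ch(Θ_2)` and `P_1 = e^{x/24} Â(TX) det^{1/2} cosh` come from the same
modular form for `Γ⁰(2)`, expanded at one cusp and evaluated at the other one.

*The exponents.* All forms in question are polynomials in the entries of the curvatures, so they lie
in the commutative algebra `evenForms n` generated by the `dx^a ∧ dx^b`, in which forms of positive
degree are nilpotent and exponentials make sense. Let `T_k`, `W_k` be the components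
`tr ((√-1/2π) R)^k / k!` of the Chern characters (`charTrace`). They vanish for odd `k`, as the
curvature of a metric connection is skew (`curvatureCoeff_connForm_skew`,
`trace_chernMatrix_pow_of_odd`). With the Eisenstein series
`G_k(τ) = -B_k/2k + ∑ σ_{k-1}(m) q^m` one finds

* `Â(TX) = exp ∑ G_k(i∞) T_k` and `det^{1/2} cosh = exp ∑ (1 - 2^k) G_k(i∞) W_k`
  (`LocalBundle.aHat_eq`, `LocalBundle.detHalfTwoCosh_eq`), from the logarithms of `sinh z / z` and
  `cosh z`;
* `ch(Θ_2) = exp ∑ ((G_k(τ) - G_k(i∞)) T_k - (G_k(τ/2) - G_k(τ)) W_k)` (`map_chernHom_theta2`).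
  This uses that `ch` is a ring homomorphism on virtual bundles with connection
  (`ch_eq_chernHom`) and that the generating functions of the `ch(S^k)` and `ch(Λ^k)` are
  exponentials (`SecondQuantization.mk_trExp`). The latter follow from Newton's identities
  (`SecondQuantization.newton_trExp`), which are proved for the symmetric and the exterior powers at
  once, by moving the exponential of the curvature around a trace with the help of the commutation
  relations of creation and annihilation operators.

The exponent of `P_2` is then a combination of `G_k(τ)` and `G_k(τ/2)`, in which `G_2 = -E_2/24` occurs
only in the modular combination `2 G_2(τ) - G_2(τ/2) = 8 δ_2 / 24`.

*Modular forms at two cusps.* No transformation law is needed. `cuspPairs w` is spanned by the pairs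
of the monomials `(8 δ_2)^a ε_2^b` of weight `2 w` and of their values `2^a 16^{-b}` at the other cusp;
these pairs multiply. It is enough to see that it contains, for even `k = 2 w ≥ 4`, the pair of `G_k(τ)`
and `G_k(i∞)` and that of `G_k(τ/2)` and `2^k G_k(i∞)` (`expand_eisensteinG_mem_cuspPairs`,
`eisensteinG_mem_cuspPairs`). As `E_4` and `E_6` generate the modular forms of level one
(`qExpansion_mem_eisensteinMonomialSpan`), this reduces to formulas for `E_4` and `E_6`, at `τ` and at
`τ/2`, in terms of `δ_2` and `ε_2`. These are the Taylor expansion of `℘` at the half period `τ/2`: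
there `℘ = (π²/3) · 8 δ_2` (`PeriodPair.sumInvPow_half`, `weierstrassP_half`,
`eisenstein_half_relations`).

*Conclusion.* The pair of exponents, hence `(P_2, P_1)`, is a modular form with values in even forms
(`exponent_mem_formPairs`, `exp_mem_formPairs`). In degree `4 w` it is a combination
`∑ h_r (8 δ_2)^{w-2r} ε_2^r` at the first cusp and `∑ h_r 2^{w-2r} 16^{-r}` at the second one.
Splitting off `x` in `e^{E_2 x/24} = 1 + x · (e^{E_2 x/24} - 1)/x`, the uniqueness of expansions gives
`h_r = {Â(TX) ch(b_r)} + x β_r`, and the value at the second cusp is the formula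
(`anomaly_cancellation`).
-/

/-! ### Modular forms of level one -/

section LevelOne

open ModularForm MatrixGroups EisensteinSeries UpperHalfPlane PowerSeries

/-- The span of the `q`-expansions of the monomials `E₄ᵃ E₆ᵇ` of weight `k`. -/
noncomputable def eisensteinMonomialSpan (k : ℕ) : Submodule ℂ (PowerSeries ℂ) :=
  Submodule.span ℂ {f | ∃ a b : ℕ, 4 * a + 6 * b = k ∧
    f = qExpansion 1 E₄ ^ a * qExpansion 1 E₆ ^ b}

theorem mul_mem_eisensteinMonomialSpan {k l : ℕ} {f g : PowerSeries ℂ}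
    (hf : f ∈ eisensteinMonomialSpan k) (hg : g ∈ eisensteinMonomialSpan l) :
    f * g ∈ eisensteinMonomialSpan (k + l) := by
  have h := Submodule.mul_mem_mul hf hg
  rw [eisensteinMonomialSpan, eisensteinMonomialSpan, Submodule.span_mul_span] at h
  refine Submodule.span_mono ?_ h
  rintro _ ⟨_, ⟨a, b, hab, rfl⟩, _, ⟨c, d, hcd, rfl⟩, rfl⟩
  exact ⟨a + c, b + d, by omega, by ring⟩

theorem monomial_mem_eisensteinMonomialSpan (a b : ℕ) :
    qExpansion 1 E₄ ^ a * qExpansion 1 E₆ ^ b ∈ eisensteinMonomialSpan (4 * a + 6 * b) :=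
  Submodule.subset_span ⟨a, b, rfl, rfl⟩

theorem qExpansion_discriminant_mem :
    qExpansion 1 discriminant ∈ eisensteinMonomialSpan 12 := by
  have h : (discriminant : ℍ → ℂ) =
      (1 / 1728 : ℂ) • (⇑(E₄.pow 3) - ⇑(E₆.pow 2)) := by
    ext z
    simp only [discriminant_eq_E₄_cube_sub_E₆_sq z, Pi.smul_apply, Pi.sub_apply, ModularForm.coe_pow,
      Pi.pow_apply, smul_eq_mul]
    ring
  have a1 := ModularFormClass.analyticAt_cuspFunction_zero (E₄.pow 3) one_pos
    one_mem_strictPeriods_SL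
  have a2 := ModularFormClass.analyticAt_cuspFunction_zero (E₆.pow 2) one_pos
    one_mem_strictPeriods_SL
  rw [h, UpperHalfPlane.qExpansion_smul, UpperHalfPlane.qExpansion_sub a1 a2,
    ModularForm.qExpansion_pow one_pos one_mem_strictPeriods_SL,
    ModularForm.qExpansion_pow one_pos one_mem_strictPeriods_SL]
  · refine Submodule.smul_mem _ _ (Submodule.sub_mem _ ?_ ?_)
    · simpa using monomial_mem_eisensteinMonomialSpan 3 0
    · simpa using monomial_mem_eisensteinMonomialSpan 0 2
  · rw [UpperHalfPlane.cuspFunction_sub a1.continuousAt a2.continuousAt]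
    exact a1.sub a2

/-- The ring of modular forms of level one is generated by `E₄` and `E₆`. -/
theorem qExpansion_mem_eisensteinMonomialSpan (k : ℕ) (f : ModularForm 𝒮ℒ (k : ℤ)) :
    qExpansion 1 f ∈ eisensteinMonomialSpan k := by
  induction k using Nat.strong_induction_on with
  | _ k ih =>
  by_cases hodd : Odd k
  · rw [levelOne_odd_weight_eq_zero (by exact_mod_cast hodd) f]
    simp [UpperHalfPlane.qExpansion_zero]
  by_cases h2 : k = 2
  · subst h2
    rw [(rank_zero_iff_forall_zero.mp levelOne_weight_two_rank_zero) f]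
    simp [UpperHalfPlane.qExpansion_zero]
  obtain ⟨a, b, hab⟩ : ∃ a b : ℕ, 4 * a + 6 * b = k := by
    rw [Nat.not_odd_iff_even] at hodd
    obtain ⟨j, hj⟩ := hodd
    rcases Nat.even_or_odd j with ⟨i, hi⟩ | ⟨i, hi⟩
    · exact ⟨i, 0, by omega⟩
    · exact ⟨i - 1, 1, by omega⟩
  -- Subtract a multiple of `E₄ᵃ E₆ᵇ` to get a cusp form, which is divisible by `Δ`.
  let m : ModularForm 𝒮ℒ (k : ℤ) :=
    ModularForm.mcast (by push_cast [← hab]; ring) ((E₄.pow a).mul (E₆.pow b))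
  have hm : qExpansion 1 m = qExpansion 1 E₄ ^ a * qExpansion 1 E₆ ^ b := by
    simp only [m, ModularForm.qExpansion_mcast]
    rw [ModularForm.qExpansion_mul one_pos one_mem_strictPeriods_SL,
      ModularForm.qExpansion_pow one_pos one_mem_strictPeriods_SL,
      ModularForm.qExpansion_pow one_pos one_mem_strictPeriods_SL]
  set c := (qExpansion 1 f).coeff 0 with hc
  let g : ModularForm 𝒮ℒ (k : ℤ) := f - c • m
  have hsub : qExpansion 1 g = qExpansion 1 f - c • qExpansion 1 m := by
    have h : (g : ℍ → ℂ) = ⇑f - ⇑(c • m) := rfl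
    rw [h, ModularForm.qExpansion_sub one_pos one_mem_strictPeriods_SL f (c • m),
      FunLike.coe_smul, ModularForm.qExpansion_smul one_pos one_mem_strictPeriods_SL]
  have h0 : (qExpansion 1 g).coeff 0 = 0 := by
    have h4 := E_qExpansion_coeff_zero (k := 4) (by norm_num) ⟨2, rfl⟩
    have h6 := E_qExpansion_coeff_zero (k := 6) (by norm_num) ⟨3, rfl⟩
    simp only [PowerSeries.coeff_zero_eq_constantCoeff] at h4 h6 hc
    rw [hsub, hm]
    simp [h4, h6, hc]
  have hmem : qExpansion 1 g ∈ eisensteinMonomialSpan k := by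
    rw [qExpansion_eq_qExpansion_discriminant_mul _ h0]
    rcases lt_or_ge k 12 with hk | hk
    · have : CuspForm.discriminantEquiv (toCuspForm g h0) = 0 :=
        rank_zero_iff_forall_zero.mp (levelOne_neg_weight_rank_zero (by omega)) _
      rw [this]
      simp [UpperHalfPlane.qExpansion_zero]
    · have h12 : ((k : ℤ) - 12) = ((k - 12 : ℕ) : ℤ) := by omega
      have := ih (k - 12) (by omega)
        (ModularForm.mcast h12 (CuspForm.discriminantEquiv (toCuspForm g h0)))
      rw [ModularForm.qExpansion_mcast] at this
      have := mul_mem_eisensteinMonomialSpan qExpansion_discriminant_mem this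
      rwa [show 12 + (k - 12) = k by omega] at this
  rw [hsub] at hmem
  have : qExpansion 1 f = (qExpansion 1 f - c • qExpansion 1 m) + c • qExpansion 1 m := by ring
  rw [this]
  refine Submodule.add_mem _ hmem (Submodule.smul_mem _ _ ?_)
  rw [hm, ← hab]
  exact monomial_mem_eisensteinMonomialSpan a b

end LevelOne

/-! ### The Weierstrass function at a half period -/

section HalfPeriod

open PeriodPair Filter Topology

namespace PeriodPair

variable (L : PeriodPair)

theorem derivWeierstrassP_half (l : L.lattice) : derivWeierstrassP L (l / 2) = 0 := by
  have h1 : derivWeierstrassP L (-(l / 2 : ℂ) + l) = derivWeierstrassP L (-(l / 2 : ℂ)) :=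
    L.derivWeierstrassP_add_coe _ l
  rw [show (-(l / 2 : ℂ) + l) = l / 2 by ring, L.derivWeierstrassP_neg] at h1
  exact CharZero.eq_neg_self_iff.mp h1

theorem iteratedDeriv_weierstrassP {x : ℂ} (hx : x ∉ L.lattice) {n : ℕ} (hn : n ≠ 0) :
    iteratedDeriv n (weierstrassP L) x = (n + 1).factorial * L.sumInvPow x (n + 2) := by
  have h := L.iteratedDeriv_weierstrassPExcept_self x (n := n)
  rwa [L.weierstrassPExcept_of_notMem x hx, if_neg hn] at h

/-- At a half period the differential equation of `℘` has a vanishing left hand side. -/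
theorem four_mul_weierstrassP_half_cube (l : L.lattice) (hl : (l / 2 : ℂ) ∉ L.lattice) :
    4 * weierstrassP L (l / 2) ^ 3 = L.g₂ * weierstrassP L (l / 2) + L.g₃ := by
  have h := L.derivWeierstrassP_sq _ hl
  rw [L.derivWeierstrassP_half] at h
  linear_combination -h

/-- The lowest Taylor coefficients of `℘` at a half period, obtained from `℘'' = 6 ℘² - g₂ / 2`.
The differential equation of `℘` only gives this after multiplication by `℘'`, so that a locally
constant `℘` has to be admitted; the first relation is therefore multiplied by the coefficient. -/
theorem sumInvPow_half (l : L.lattice) (hl : (l / 2 : ℂ) ∉ L.lattice) :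
    L.sumInvPow (l / 2) 4 * (12 * L.sumInvPow (l / 2) 4 -
      (12 * weierstrassP L (l / 2) ^ 2 - L.g₂)) = 0 ∧
    5 * L.sumInvPow (l / 2) 6 = 3 * (weierstrassP L (l / 2) * L.sumInvPow (l / 2) 4) := by
  set w : ℂ := l / 2 with hw
  set f := weierstrassP L with hf
  set g := derivWeierstrassP L with hg
  have hfa : AnalyticAt ℂ f w := L.analyticOnNhd_weierstrassP w hl
  have hga : AnalyticAt ℂ g w := L.analyticOnNhd_derivWeierstrassP w hl
  have hfg : deriv f = g := L.deriv_weierstrassP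
  have hg0 : g w = 0 := L.derivWeierstrassP_half l
  have hnhds : ∀ᶠ z in 𝓝 w, z ∉ L.lattice := L.isClosed_lattice.isOpen_compl.mem_nhds hl
  have hode : (fun z => g z ^ 2) =ᶠ[𝓝 w] fun z => 4 * f z ^ 3 - L.g₂ * f z - L.g₃ := by
    filter_upwards [hnhds] with z hz using L.derivWeierstrassP_sq z hz
  have hd2 : iteratedDeriv 2 f w = 6 * L.sumInvPow w 4 := by
    rw [L.iteratedDeriv_weierstrassP hl two_ne_zero]; norm_num [Nat.factorial]
  have hd4 : iteratedDeriv 4 f w = 120 * L.sumInvPow w 6 := by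
    rw [L.iteratedDeriv_weierstrassP hl four_ne_zero]; norm_num [Nat.factorial]
  have e2 : iteratedDeriv 2 f = deriv g := by
    rw [iteratedDeriv_succ, iteratedDeriv_one, hfg]
  have e4 : iteratedDeriv 4 f = deriv (deriv (deriv g)) := by
    rw [iteratedDeriv_succ, iteratedDeriv_succ, e2]
  have hode' : ∀ᶠ z in 𝓝 w, g z * (2 * deriv g z - (12 * f z ^ 2 - L.g₂)) = 0 := by
    filter_upwards [hode.eventuallyEq_nhds, hfa.eventually_analyticAt, hga.eventually_analyticAt]
      with z h1 h2 h3
    have hf' : HasDerivAt f (g z) z := hfg ▸ h2.differentiableAt.hasDerivAt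
    have a := (h3.differentiableAt.hasDerivAt.fun_pow 2).deriv
    have b := ((((hf'.fun_pow 3).const_mul 4).sub (hf'.const_mul L.g₂)).sub_const L.g₃).deriv
    have c := h1.deriv_eq
    rw [a] at c
    have c := c.trans b
    simp only [Nat.cast_ofNat, Nat.add_one_sub_one, pow_one] at c
    linear_combination c
  rcases hga.eventually_eq_zero_or_eventually_ne_zero with hz | hz
  · -- a constant solution has vanishing higher derivatives
    have h1 : g =ᶠ[𝓝 w] fun _ => 0 := hz
    have h2 : deriv g =ᶠ[𝓝 w] fun _ => 0 := by simpa using h1.deriv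
    have h3 : deriv (deriv g) =ᶠ[𝓝 w] fun _ => 0 := by simpa using h2.deriv
    have h4 : deriv (deriv (deriv g)) =ᶠ[𝓝 w] fun _ => 0 := by simpa using h3.deriv
    have s4 : L.sumInvPow w 4 = 0 := by
      have := h2.self_of_nhds
      rw [← e2, hd2] at this; simpa using this
    have s6 : L.sumInvPow w 6 = 0 := by
      have := h4.self_of_nhds
      rw [← e4, hd4] at this; simpa using this
    rw [s4, s6]; simp
  · have h1 : ∀ᶠ z in 𝓝[≠] w, 2 * deriv g z - (12 * f z ^ 2 - L.g₂) = 0 := by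
      filter_upwards [hz, hode'.filter_mono nhdsWithin_le_nhds] with z h1 h2
      exact (mul_eq_zero.mp h2).resolve_left h1
    have hH : AnalyticAt ℂ (fun z => 2 * deriv g z - (12 * f z ^ 2 - L.g₂)) w := by
      have := hga.deriv
      fun_prop
    have h2 : ∀ᶠ z in 𝓝 w, 2 * deriv g z - (12 * f z ^ 2 - L.g₂) = 0 :=
      hH.frequently_zero_iff_eventually_zero.mp h1.frequently
    have h3 : deriv g =ᶠ[𝓝 w] fun z => 6 * f z ^ 2 - L.g₂ / 2 := by
      filter_upwards [h2] with z hz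
      linear_combination hz / 2
    have h4 : deriv (deriv g) =ᶠ[𝓝 w] fun z => 12 * (f z * g z) := by
      filter_upwards [h3.eventuallyEq_nhds, hfa.eventually_analyticAt] with z h1 h2
      have hf' : HasDerivAt f (g z) z := hfg ▸ h2.differentiableAt.hasDerivAt
      rw [h1.deriv_eq, (((hf'.fun_pow 2).const_mul 6).sub_const (L.g₂ / 2)).deriv]
      norm_num
      ring
    have hf' : HasDerivAt f (g w) w := hfg ▸ hfa.differentiableAt.hasDerivAt
    have h5 : deriv (deriv (deriv g)) w = 12 * (f w * deriv g w) := by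
      rw [h4.deriv_eq, ((hf'.fun_mul hga.differentiableAt.hasDerivAt).const_mul 12).deriv, hg0]
      simp
    have h6 : deriv g w = 6 * L.sumInvPow w 4 := by rw [← hd2, e2]
    have h7 := h3.self_of_nhds
    rw [h6] at h7
    rw [← e4, hd4, h6] at h5
    constructor
    · linear_combination 2 * L.sumInvPow w 4 * h7
    · linear_combination h5 / 24

end PeriodPair
end HalfPeriod

/-! ### Lattice sums over `ℤ τ + ℤ` -/

section LatticeSums

open PeriodPair Filter Topology UpperHalfPlane EisensteinSeries ModularForm SummationFilter Finset

/-- The period pair `(τ, 1)`. -/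
noncomputable def periodPairOf (τ : ℍ) : PeriodPair where
  ω₁ := τ
  ω₂ := 1
  indep := by
    rw [LinearIndependent.pair_iff]
    intro s t h
    have h1 := congrArg Complex.im h
    have h2 := congrArg Complex.re h
    have hτ := τ.im_ne_zero
    simp at h1 h2
    rcases h1 with h1 | h1
    · simp [h1] at h2; exact ⟨h1, h2⟩
    · exact absurd h1 hτ

/-- The point `τ / 2` of the upper half plane. -/
noncomputable def halfPoint (τ : ℍ) : ℍ := ⟨(τ : ℂ) / 2, by simpa using τ.im_pos⟩

@[simp] theorem coe_halfPoint (τ : ℍ) : (halfPoint τ : ℂ) = (τ : ℂ) / 2 := rfl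

theorem tsum_lattice_periodPairOf (τ : ℍ) (F : ℂ → ℂ) :
    ∑' l : (periodPairOf τ).lattice, F l = ∑' x : ℤ × ℤ, F (x.1 * τ + x.2) := by
  rw [← (periodPairOf τ).latticeEquivProd.symm.toEquiv.tsum_eq]
  refine tsum_congr fun x => ?_
  congr 1
  refine ((periodPairOf τ).latticeEquiv_symm_apply x).trans ?_
  simp [periodPairOf]

theorem hasSum_lattice_periodPairOf {τ : ℍ} {F : ℂ → ℂ} {a : ℂ}
    (h : HasSum (fun l : (periodPairOf τ).lattice => F l) a) :
    HasSum (fun x : ℤ × ℤ => F (x.1 * τ + x.2)) a := by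
  rw [← (periodPairOf τ).latticeEquivProd.symm.toEquiv.hasSum_iff] at h
  refine h.congr_fun ?_
  intro x
  refine congrArg F ?_
  refine Eq.trans ?_ ((periodPairOf τ).latticeEquiv_symm_apply x).symm
  simp [periodPairOf]

theorem tsum_prod_eisSummand {k : ℕ} (hk : 3 ≤ k) (τ : ℍ) :
    ∑' x : ℤ × ℤ, eisSummand k ![x.1, x.2] τ = 2 * riemannZeta k * E hk τ := by
  rw [← (finTwoArrowEquiv ℤ).tsum_eq]
  have h1 := tsum_eisSummand_eq_riemannZeta_mul_eisensteinSeries hk τ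
  have h2 : E hk τ = (1 / 2 : ℂ) * eisensteinSeries (N := 1) 0 k τ := by
    rw [show E hk τ = (1 / 2 : ℂ) • eisensteinSeriesSIF (N := 1) 0 k τ from rfl,
      eisensteinSeriesSIF_apply 0 k τ, smul_eq_mul]
  rw [h2]
  refine Eq.trans (tsum_congr fun v => ?_) (h1.trans (by ring))
  simp [show ![v 0, v 1] = v from List.ofFn_inj.mp rfl]

theorem G_periodPairOf {k : ℕ} (hk : 3 ≤ k) (τ : ℍ) :
    (periodPairOf τ).G k = 2 * riemannZeta k * E hk τ := by
  rw [PeriodPair.G, tsum_lattice_periodPairOf τ (fun z => (z ^ k)⁻¹), ← tsum_prod_eisSummand hk]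
  exact tsum_congr fun x => by simp [eisSummand]

/-- The sum over `L + τ / 2` is the sum over `ℤ τ / 2 + ℤ` minus the sum over `L`. -/
theorem sumInvPow_periodPairOf {k : ℕ} (hk : 3 ≤ k) (τ : ℍ) :
    (periodPairOf τ).sumInvPow ((τ : ℂ) / 2) k =
      2 * riemannZeta k * (E hk (halfPoint τ) - E hk τ) := by
  have hs := summable_prod_eisSummand hk (halfPoint τ)
  rw [mul_sub, ← tsum_prod_eisSummand hk, ← tsum_prod_eisSummand hk, PeriodPair.sumInvPow,
    tsum_lattice_periodPairOf τ (fun z => ((z - τ / 2) ^ k)⁻¹), eq_sub_iff_add_eq]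
  have hr (x : ℤ × ℤ) : eisSummand k ![2 * x.1, x.2] (halfPoint τ) = eisSummand k ![x.1, x.2] τ := by
    simp [eisSummand]; ring_nf
  have hl (x : ℤ × ℤ) : eisSummand k ![2 * x.1 - 1, x.2] (halfPoint τ) =
      ((x.1 * (τ : ℂ) + x.2 - τ / 2) ^ k)⁻¹ := by
    simp [eisSummand]; ring_nf
  have inj1 : Function.Injective fun x : ℤ × ℤ => (2 * x.1, x.2) := fun x y h => by
    simp at h; exact Prod.ext h.1 h.2
  have inj2 : Function.Injective fun x : ℤ × ℤ => (2 * x.1 - 1, x.2) := fun x y h => by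
    simp at h; exact Prod.ext h.1 h.2
  let e : (ℤ × ℤ) ⊕ (ℤ × ℤ) ≃ ℤ × ℤ := Equiv.ofBijective
    (Sum.elim (fun x => (2 * x.1 - 1, x.2)) (fun x => (2 * x.1, x.2))) <| by
      constructor
      · refine Function.Injective.sumElim inj2 inj1 fun x y h => ?_
        simp at h; omega
      · rintro ⟨a, b⟩
        rcases Int.even_or_odd' a with ⟨c, rfl | rfl⟩
        · exact ⟨.inr (c, b), rfl⟩
        · exact ⟨.inl (c + 1, b), by simp; ring⟩
  rw [← e.tsum_eq (fun x : ℤ × ℤ => eisSummand k ![x.1, x.2] (halfPoint τ)), Summable.tsum_sum]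
  · congr 1
    · exact tsum_congr fun x => (hl x).symm
    · exact tsum_congr fun x => (hr x).symm
  · exact hs.comp_injective inj2
  · exact hs.comp_injective inj1

theorem sum_Icc_odd_add_sum_Icc_even (f : ℤ → ℂ) (N : ℕ) :
    ∑ m ∈ Icc (-N : ℤ) N, f (1 - 2 * m) + ∑ m ∈ Icc (-N : ℤ) N, f (2 * m) =
      ∑ k ∈ Icc (-(2 * N : ℕ) : ℤ) (2 * N : ℕ), f k + f (2 * N + 1) := by
  have hIcc (N : ℕ) (f : ℤ → ℂ) : ∑ m ∈ Icc (-(N + 1 : ℕ) : ℤ) (N + 1 : ℕ), f m =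
      ∑ m ∈ Icc (-N : ℤ) N, f m + f (N + 1) + f (-(N + 1)) := by
    have : Icc (-(N + 1 : ℕ) : ℤ) (N + 1 : ℕ) =
        insert (N + 1 : ℤ) (insert (-(N + 1) : ℤ) (Icc (-N : ℤ) N)) := by
      ext x; simp; omega
    rw [this, sum_insert (by simp; omega), sum_insert (by simp)]
    ring
  induction N with
  | zero => simp; ring
  | succ N ih =>
    have h2 := hIcc (2 * N + 1) f
    have h3 := hIcc (2 * N) f
    rw [hIcc N (fun m => f (1 - 2 * m)), hIcc N (fun m => f (2 * m)),
      show 2 * (N + 1) = 2 * N + 1 + 1 by ring, h2, h3]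
    push_cast at ih h2 h3 ⊢
    have a1 : (1 - 2 * ((N : ℤ) + 1)) = -(2 * N + 1) := by ring
    have a2 : (1 - 2 * (-((N : ℤ) + 1))) = 2 * (N + 1) + 1 := by ring
    have a3 : (2 * (N : ℤ) + 1 + 1) = 2 * (N + 1) := by ring
    have a4 : (2 * (-((N : ℤ) + 1))) = -(2 * (N + 1)) := by ring
    rw [a1, a2, a3, a4]
    linear_combination ih

/-- The value of `℘` at the half period `τ / 2`, summed row by row: the rows `m` of `L - τ / 2` are
the odd rows of `ℤ τ / 2 + ℤ`, whose even rows are those of `L`. -/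
theorem weierstrassP_half (τ : ℍ) : weierstrassP (periodPairOf τ) ((τ : ℂ) / 2) =
    Real.pi ^ 2 / 3 * (E2 (halfPoint τ) - 2 * E2 τ) := by
  have h := hasSum_lattice_periodPairOf (F := fun l => 1 / ((τ : ℂ) / 2 - l) ^ 2 - 1 / l ^ 2)
    ((periodPairOf τ).hasSum_weierstrassP ((τ : ℂ) / 2))
  have hrow (m : ℤ) : HasSum (fun n : ℤ => 1 / ((τ : ℂ) / 2 - (m * τ + n)) ^ 2 -
      1 / (m * (τ : ℂ) + n) ^ 2) (e2Summand (1 - 2 * m) (halfPoint τ) - e2Summand m τ) := by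
    refine HasSum.sub ?_ ?_
    · have := (e2Summand_summable (1 - 2 * m) (halfPoint τ)).hasSum
      rw [← (Equiv.neg ℤ).hasSum_iff] at this
      refine this.congr_fun fun n => ?_
      simp [eisSummand]
      ring_nf
    · refine (e2Summand_summable m τ).hasSum.congr_fun fun n => ?_
      simp [eisSummand]
  have h1 := h.prod_fiberwise hrow
  have h2 : Tendsto (fun N : ℕ => ∑ m ∈ Icc (-N : ℤ) N,
      (e2Summand (1 - 2 * m) (halfPoint τ) - e2Summand m τ)) atTop
      (𝓝 (weierstrassP (periodPairOf τ) ((τ : ℂ) / 2))) := by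
    have := hasSum_symmetricIcc_iff.mp (Filter.Tendsto.mono_left h1 (LeAtTop.le_atTop (L := symmetricIcc ℤ)))
    exact this
  have hG (z : ℍ) : Tendsto (fun N : ℕ => ∑ m ∈ Icc (-N : ℤ) N, e2Summand m z) atTop (𝓝 (G2 z)) := by
    have := hasSum_e2Summand_symmetricIcc z
    rw [← G2_eq_tsum_cexp] at this
    exact hasSum_symmetricIcc_iff.mp this
  have h3 : Tendsto (fun N : ℕ => ∑ m ∈ Icc (-N : ℤ) N,
      (e2Summand (1 - 2 * m) (halfPoint τ) - e2Summand m τ)) atTop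
      (𝓝 (G2 (halfPoint τ) + 0 - G2 τ - G2 τ)) := by
    have t1 := (hG (halfPoint τ)).comp (tendsto_id.const_mul_atTop' (two_pos : (0 : ℕ) < 2))
    have t2 : Tendsto (fun N : ℕ => e2Summand (2 * N + 1) (halfPoint τ)) atTop (𝓝 0) := by
      refine (tendsto_e2Summand_atTop_nhds_zero (halfPoint τ)).comp ?_
      refine tendsto_atTop_mono (fun n => ?_) tendsto_natCast_atTop_atTop
      show (n : ℤ) ≤ 2 * n + 1
      omega
    refine (((t1.add t2).sub (hG τ)).sub (hG τ)).congr fun N => ?_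
    have := sum_Icc_odd_add_sum_Icc_even (fun m => e2Summand m (halfPoint τ)) N
    have he (m : ℤ) : e2Summand (2 * m) (halfPoint τ) = e2Summand m τ := by
      refine tsum_congr fun n => ?_
      simp [eisSummand]
      ring_nf
    simp only [he] at this
    rw [sum_sub_distrib]
    simp only [Function.comp_apply, id]
    linear_combination -this
  rw [tendsto_nhds_unique h2 h3]
  simp only [E2, Pi.smul_apply, smul_eq_mul, riemannZeta_two]
  have := Real.pi_ne_zero
  field_simp
  ring

end LatticeSums

/-! ### Convergent expansions in `q^{1/2}` -/

section QSums

open Filter Topology UpperHalfPlane EisensteinSeries ModularForm Function ArithmeticFunction AnomalyCancellation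
open scoped ArithmeticFunction.sigma MatrixGroups

/-- The power series `a` in `s = q^{1/2}` converges to `f` on the upper half plane. -/
def HasQSum (a : PowerSeries ℂ) (f : ℍ → ℂ) : Prop :=
  ∀ τ : ℍ, HasSum (fun m => a.coeff m * Periodic.qParam 2 τ ^ m) (f τ)

namespace HasQSum

variable {a b : PowerSeries ℂ} {f g : ℍ → ℂ}

theorem add (ha : HasQSum a f) (hb : HasQSum b g) : HasQSum (a + b) (f + g) := fun τ =>
  ((ha τ).add (hb τ)).congr_fun fun m => by simp [add_mul]

theorem smul (c : ℂ) (ha : HasQSum a f) : HasQSum (c • a) (c • f) := fun τ =>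
  ((ha τ).mul_left c).congr_fun fun m => by simp [mul_assoc]

theorem sub (ha : HasQSum a f) (hb : HasQSum b g) : HasQSum (a - b) (f - g) := fun τ =>
  ((ha τ).sub (hb τ)).congr_fun fun m => by simp [sub_mul]

theorem mul (ha : HasQSum a f) (hb : HasQSum b g) : HasQSum (a * b) (f * g) := fun τ => by
  have h1 := summable_norm_iff.mpr (ha τ).summable
  have h2 := summable_norm_iff.mpr (hb τ).summable
  have h3 := (summable_norm_sum_mul_antidiagonal_of_summable_norm h1 h2).of_norm.hasSum
  rw [← tsum_mul_tsum_eq_tsum_sum_antidiagonal_of_summable_norm h1 h2, (ha τ).tsum_eq,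
    (hb τ).tsum_eq] at h3
  refine h3.congr_fun fun m => ?_
  rw [PowerSeries.coeff_mul, Finset.sum_mul]
  refine Finset.sum_congr rfl fun x hx => ?_
  rw [← Finset.HasAntidiagonal.mem_antidiagonal.mp hx, pow_add]
  ring

theorem eq_zero (ha : HasQSum a 0) : a = 0 := by
  have h2 : (2 : ℝ) ∈ (𝒮ℒ : Subgroup (GL (Fin 2) ℝ)).strictPeriods := by
    have := add_mem one_mem_strictPeriods_SL one_mem_strictPeriods_SL
    rwa [one_add_one_eq_two] at this
  ext m
  rw [ModularFormClass.qExpansion_coeff_unique (f := (0 : ModularForm 𝒮ℒ 0)) two_pos h2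
    (c := fun m => a.coeff m) (fun τ => by simpa using ha τ) m]
  simp [UpperHalfPlane.qExpansion_zero]

theorem unique (ha : HasQSum a f) (hb : HasQSum b f) : a = b :=
  sub_eq_zero.mp (eq_zero (by simpa using ha.sub hb))

theorem half (h : ∀ τ : ℍ, HasSum (fun m => a.coeff m * Periodic.qParam 1 τ ^ m) (f τ)) :
    HasQSum a (fun τ => f (halfPoint τ)) := fun τ =>
  (h (halfPoint τ)).congr_fun fun m => by
    simp only [Periodic.qParam, coe_halfPoint]
    congr 3
    push_cast; ring

theorem expand_two (h : ∀ τ : ℍ, HasSum (fun m => a.coeff m * Periodic.qParam 1 τ ^ m) (f τ)) :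
    HasQSum (PowerSeries.expand 2 two_ne_zero a) f := fun τ => by
  have h1 := h τ
  have hq : Periodic.qParam 1 τ = Periodic.qParam 2 τ ^ 2 := by
    simp only [Periodic.qParam]
    rw [← Complex.exp_nat_mul]
    congr 1
    push_cast; ring
  have hinj : Function.Injective (fun m : ℕ => 2 * m) := fun x y h => by simpa using h
  rw [← hinj.hasSum_iff]
  · refine h1.congr_fun fun m => ?_
    rw [hq, ← pow_mul]
    simp [PowerSeries.coeff_expand_mul]
  · intro x hx
    have : ¬ 2 ∣ x := fun ⟨y, hy⟩ => hx ⟨y, hy.symm⟩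
    simp [PowerSeries.coeff_expand, this]

end HasQSum

/-- `8 δ₂` with complex coefficients. -/
noncomputable def deltaC : PowerSeries ℂ := PowerSeries.map (Int.castRingHom ℂ) eightDelta2

/-- `ε₂` with complex coefficients. -/
noncomputable def epsC : PowerSeries ℂ := PowerSeries.map (Int.castRingHom ℂ) eps2

/-- The series `-B_k / 2k + ∑ σ_{k-1}(m) t^m`. -/
noncomputable def eisensteinG (k : ℕ) : PowerSeries ℂ :=
  PowerSeries.mk fun m => if m = 0 then -(bernoulli k : ℂ) / (2 * k) else (σ (k - 1) m : ℂ)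

theorem bernoulli_ne_zero_of_even {k : ℕ} (hk : Even k) : bernoulli k ≠ 0 := by
  obtain ⟨j, rfl⟩ := hk
  rcases eq_or_ne j 0 with rfl | hj
  · simp
  have h := riemannZeta_two_mul_nat hj
  intro h0
  rw [two_mul j, h0] at h
  refine riemannZeta_ne_zero_of_one_le_re (s := 2 * j) ?_ ?_
  · have : (1 : ℝ) ≤ j := by exact_mod_cast Nat.one_le_iff_ne_zero.mpr hj
    simp; linarith
  · rw [h]; simp

theorem eisensteinG_eq {k : ℕ} (hk : 3 ≤ k) (hk2 : Even k) :
    eisensteinG k = (-(bernoulli k : ℂ) / (2 * k)) • qExpansion 1 (E hk) := by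
  have h0 : (bernoulli k : ℂ) ≠ 0 := by exact_mod_cast bernoulli_ne_zero_of_even hk2
  have h1 : (k : ℂ) ≠ 0 := by norm_cast; omega
  ext m
  rw [PowerSeries.coeff_smul, E_qExpansion_coeff hk hk2, eisensteinG, PowerSeries.coeff_mk]
  split_ifs with h
  · simp
  · rw [smul_eq_mul]; field_simp

theorem sum_divisors_odd_quotient {M : Type*} [AddCommGroup M] (f : ℕ → M) (n : ℕ) :
    ∑ d ∈ n.divisors with Odd (n / d), f d =
      ∑ d ∈ n.divisors, f d - if 2 ∣ n then ∑ d ∈ (n / 2).divisors, f d else 0 := by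
  rw [eq_sub_iff_add_eq, ← Finset.sum_filter_add_sum_filter_not n.divisors (fun d => Odd (n / d))]
  congr 1
  rcases eq_or_ne n 0 with rfl | hn
  · simp
  split_ifs with h
  · obtain ⟨m, rfl⟩ := h
    refine Finset.sum_congr ?_ fun _ _ => rfl
    ext d
    simp only [Nat.mul_div_cancel_left m two_pos, Nat.mem_divisors, Finset.mem_filter,
      Nat.not_odd_iff_even]
    constructor
    · rintro ⟨⟨c, rfl⟩, h2⟩
      have hd : 0 < d := Nat.pos_of_ne_zero (by rintro rfl; simp at h2)
      refine ⟨⟨⟨2 * c, by ring⟩, hn⟩, ?_⟩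
      rw [show 2 * (d * c) = d * (2 * c) by ring, Nat.mul_div_cancel_left _ hd]
      simp
    · rintro ⟨⟨⟨c, hc⟩, _⟩, h2⟩
      have hd : 0 < d := Nat.pos_of_ne_zero (by rintro rfl; simp at hc; omega)
      rw [hc, Nat.mul_div_cancel_left _ hd] at h2
      obtain ⟨e, rfl⟩ := h2
      exact ⟨⟨e, by linarith⟩, by omega⟩
  · symm
    refine Finset.sum_eq_zero fun d hd => ?_
    simp only [Nat.mem_divisors, Finset.mem_filter, Nat.not_odd_iff_even] at hd
    exact absurd (hd.2.two_dvd.trans (Nat.div_dvd_of_dvd hd.1.1)) h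

theorem sum_divisors_odd (n : ℕ) :
    ∑ d ∈ n.divisors with Odd d, (d : ℤ) =
      σ 1 n - 2 * if 2 ∣ n then (σ 1 (n / 2) : ℤ) else 0 := by
  have h1 : ∑ d ∈ n.divisors with Odd d, (d : ℤ) =
      ∑ d ∈ n.divisors with Odd (n / d), ((n / d : ℕ) : ℤ) := by
    refine Finset.sum_nbij' (fun d => n / d) (fun d => n / d) ?_ ?_ ?_ ?_ ?_ <;>
    simp +contextual [Nat.div_div_self, Nat.div_dvd_of_dvd]
  rw [h1, sum_divisors_odd_quotient, Nat.sum_div_divisors n (fun d => (d : ℤ))]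
  simp only [sigma_one_apply]
  push_cast
  congr 1
  split_ifs with h
  · obtain ⟨m, rfl⟩ := h
    rw [Nat.mul_div_cancel_left m two_pos, ← Nat.sum_div_divisors m (fun d => (d : ℤ)),
      Finset.mul_sum]
    refine Finset.sum_congr rfl fun d hd => ?_
    push_cast
    exact Int.mul_ediv_assoc 2 (Int.natCast_dvd_natCast.mpr (Nat.dvd_of_mem_divisors hd))
  · simp

theorem epsC_eq : epsC = eisensteinG 4 - PowerSeries.expand 2 two_ne_zero (eisensteinG 4) := by
  ext m
  rw [map_sub, PowerSeries.coeff_expand, epsC, PowerSeries.coeff_map, eps2, PowerSeries.coeff_mk,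
    sum_divisors_odd_quotient (fun d => (d : ℤ) ^ 3) m]
  rcases eq_or_ne m 0 with rfl | hm
  · simp
  · have : m / 2 = 0 → ¬ 2 ∣ m := by omega
    by_cases h : 2 ∣ m
    · have h2 : m / 2 ≠ 0 := by omega
      simp [h, eisensteinG, hm, h2, sigma_apply]
    · simp [h, eisensteinG, hm, sigma_apply]

theorem deltaC_eq : deltaC =
    (-24 : ℂ) • (eisensteinG 2 - (2 : ℂ) • PowerSeries.expand 2 two_ne_zero (eisensteinG 2)) := by
  ext m
  rw [PowerSeries.coeff_smul, map_sub, PowerSeries.coeff_smul, PowerSeries.coeff_expand, deltaC,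
    PowerSeries.coeff_map, eightDelta2, PowerSeries.coeff_mk]
  rcases eq_or_ne m 0 with rfl | hm
  · simp [eisensteinG, bernoulli_two]; norm_num
  · rw [if_neg hm, sum_divisors_odd]
    by_cases h : 2 ∣ m
    · have h2 : m / 2 ≠ 0 := by omega
      simp [h, eisensteinG, hm, h2]
    · simp [h, eisensteinG, hm]

theorem hasSum_eisensteinG_two (τ : ℍ) :
    HasSum (fun m => ((-24 : ℂ) • eisensteinG 2).coeff m * Periodic.qParam 1 τ ^ m) (E2 τ) := by
  refine (hasSum_qExpansion_E2 (z := τ)).congr_fun fun m => ?_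
  rw [PowerSeries.coeff_smul, eisensteinG, PowerSeries.coeff_mk]
  split_ifs <;> simp [bernoulli_two, Periodic.qParam]
  norm_num

theorem hasQSum_deltaC : HasQSum deltaC (fun τ => E2 (halfPoint τ) - 2 * E2 τ) := by
  have h := (HasQSum.half hasSum_eisensteinG_two).sub
    ((HasQSum.expand_two hasSum_eisensteinG_two).smul 2)
  rw [deltaC_eq]
  convert! h using 1
  rw [map_smul, smul_sub, smul_comm]

end QSums

/-! ### Eisenstein series as polynomials in `8 δ_2` and `ε_2` -/

section HalfPeriodIdentities

open UpperHalfPlane EisensteinSeries ModularForm Function AnomalyCancellation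
open scoped MatrixGroups

theorem hasSum_qExpansion_E {k : ℕ} (hk : 3 ≤ k) (τ : ℍ) :
    HasSum (fun m => (qExpansion 1 (E hk)).coeff m * Periodic.qParam 1 τ ^ m) (E hk τ) :=
  ModularForm.hasSum_qExpansion _ one_pos one_mem_strictPeriods_SL τ

theorem riemannZeta_six : riemannZeta 6 = (Real.pi : ℂ) ^ 6 / 945 := by
  have h := riemannZeta_two_mul_nat (k := 3) (by norm_num)
  have hb : bernoulli (2 * 3) = 1 / 42 := by decide +kernel
  rw [hb] at h
  norm_num [Nat.factorial] at h
  rw [h]; ring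

/-- The relations between the values of `E₂`, `E₄`, `E₆` at `τ` and at `τ / 2` coming from the
expansion of `℘` at the half period `τ / 2`. -/
theorem eisenstein_half_relations (τ : ℍ) :
    let A := E (k := 4) (by norm_num) (halfPoint τ)
    let a := E (k := 4) (by norm_num) τ
    let B := E (k := 6) (by norm_num) (halfPoint τ)
    let b := E (k := 6) (by norm_num) τ
    let P := E2 (halfPoint τ) - 2 * E2 τ
    (A - a) * (5 * P ^ 2 - (A + 4 * a)) = 0 ∧ 10 * (B - b) = 21 * (P * (A - a)) ∧
      P ^ 3 = 3 * (a * P) + 2 * b := by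
  intro A a B b P
  set L := periodPairOf τ
  have hw := L.ω₁_div_two_notMem_lattice
  let l : L.lattice := ⟨L.ω₁, L.ω₁_mem_lattice⟩
  obtain ⟨h1, h2⟩ := L.sumInvPow_half l hw
  have h3 := L.four_mul_weierstrassP_half_cube l hw
  have hl : ((l : ℂ) / 2) = (τ : ℂ) / 2 := rfl
  have s4 := sumInvPow_periodPairOf (k := 4) (by norm_num) τ
  have s6 := sumInvPow_periodPairOf (k := 6) (by norm_num) τ
  have g4 := G_periodPairOf (k := 4) (by norm_num) τ
  have g6 := G_periodPairOf (k := 6) (by norm_num) τ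
  rw [hl, PeriodPair.g₂, weierstrassP_half, s4, g4] at h1
  rw [hl, weierstrassP_half, s4, s6] at h2
  rw [hl, PeriodPair.g₂, PeriodPair.g₃, weierstrassP_half, g4, g6] at h3
  have z4 : riemannZeta ((4 : ℕ) : ℂ) = (Real.pi : ℂ) ^ 4 / 90 := by exact_mod_cast riemannZeta_four
  have z6 : riemannZeta ((6 : ℕ) : ℂ) = (Real.pi : ℂ) ^ 6 / 945 := by exact_mod_cast riemannZeta_six
  rw [z4] at h1
  rw [z4, z6] at h2
  rw [z4, z6] at h3
  have hpi : (Real.pi : ℂ) ≠ 0 := by exact_mod_cast Real.pi_ne_zero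
  refine ⟨?_, ?_, ?_⟩
  · refine (mul_right_inj' (pow_ne_zero 8 hpi)).mp ?_
    linear_combination (-675 / 4) * h1
  · refine (mul_right_inj' (pow_ne_zero 6 hpi)).mp ?_
    linear_combination 945 * h2
  · refine (mul_right_inj' (pow_ne_zero 6 hpi)).mp ?_
    linear_combination 27 / 4 * h3

theorem qExpansion_E₄_sub : qExpansion 1 E₄ - PowerSeries.expand 2 two_ne_zero (qExpansion 1 E₄) =
    (240 : ℂ) • epsC := by
  have h := eisensteinG_eq (k := 4) (by norm_num) ⟨2, rfl⟩
  have hb : bernoulli 4 = -1 / 30 := by decide +kernel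
  rw [epsC_eq, h, map_smul, ← smul_sub, smul_smul, hb]
  norm_num

theorem epsC_ne_zero : epsC ≠ 0 := fun h => by
  have := congrArg (PowerSeries.coeff 1) h
  simp [epsC, eps2, Finset.filter_singleton] at this

/-- By the half period relations `5 (8 δ_2)² - E_4(τ/2) - 4 E_4(τ)` is annihilated by
`E_4(τ/2) - E_4(τ) = 240 ε_2`, which is not zero. -/
theorem five_mul_deltaC_sq : 5 * deltaC ^ 2 =
    qExpansion 1 E₄ + 4 * PowerSeries.expand 2 two_ne_zero (qExpansion 1 E₄) := by
  have hA := HasQSum.half (hasSum_qExpansion_E (k := 4) (by norm_num))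
  have ha := HasQSum.expand_two (hasSum_qExpansion_E (k := 4) (by norm_num))
  have hd := hasQSum_deltaC
  have h := (hA.sub ha).mul (((hd.mul hd).smul 5).sub (hA.add (ha.smul 4)))
  have h0 : (_ : PowerSeries ℂ) = 0 := HasQSum.eq_zero <| by
    convert! h using 1
    funext τ
    have := (eisenstein_half_relations τ).1
    simp only [Pi.mul_apply, Pi.sub_apply, Pi.add_apply, Pi.smul_apply, smul_eq_mul, Pi.zero_apply]
    linear_combination -this
  rw [qExpansion_E₄_sub] at h0
  have h1 := (mul_eq_zero.mp h0).resolve_left (smul_ne_zero (by norm_num) epsC_ne_zero)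
  simp only [Algebra.smul_def, map_ofNat] at h1
  linear_combination h1

theorem qExpansion_E₄ : qExpansion 1 E₄ = deltaC ^ 2 + (192 : ℂ) • epsC := by
  have h1 := qExpansion_E₄_sub
  have h2 := five_mul_deltaC_sq
  refine smul_right_injective _ (show (5 : ℂ) ≠ 0 by norm_num) ?_
  simp only [Algebra.smul_def, map_ofNat] at h1 ⊢
  linear_combination 4 * h1 - h2

theorem expand_qExpansion_E₄ : PowerSeries.expand 2 two_ne_zero (qExpansion 1 E₄) =
    deltaC ^ 2 - (48 : ℂ) • epsC := by
  have h1 := qExpansion_E₄_sub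
  have h2 := qExpansion_E₄
  simp only [Algebra.smul_def, map_ofNat] at h1 h2 ⊢
  linear_combination h2 - h1

theorem expand_qExpansion_E₆ : PowerSeries.expand 2 two_ne_zero (qExpansion 1 E₆) =
    -deltaC ^ 3 + (72 : ℂ) • (deltaC * epsC) := by
  have ha := HasQSum.expand_two (hasSum_qExpansion_E (k := 4) (by norm_num))
  have hb := HasQSum.expand_two (hasSum_qExpansion_E (k := 6) (by norm_num))
  have hd := hasQSum_deltaC
  have h := ((ha.mul hd).smul 3).add (hb.smul 2)
  have h0 := HasQSum.unique ((hd.mul hd).mul hd) <| by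
    convert! h using 1
    funext τ
    have := (eisenstein_half_relations τ).2.2
    simp only [Pi.mul_apply, Pi.add_apply, Pi.smul_apply, smul_eq_mul]
    linear_combination this
  rw [expand_qExpansion_E₄] at h0
  refine smul_right_injective _ (show (2 : ℂ) ≠ 0 by norm_num) ?_
  simp only [Algebra.smul_def, map_ofNat] at h0 ⊢
  linear_combination -h0

theorem qExpansion_E₆ : qExpansion 1 E₆ = -deltaC ^ 3 + (576 : ℂ) • (deltaC * epsC) := by
  have hA := HasQSum.half (hasSum_qExpansion_E (k := 4) (by norm_num))
  have ha := HasQSum.expand_two (hasSum_qExpansion_E (k := 4) (by norm_num))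
  have hB := HasQSum.half (hasSum_qExpansion_E (k := 6) (by norm_num))
  have hb := HasQSum.expand_two (hasSum_qExpansion_E (k := 6) (by norm_num))
  have hd := hasQSum_deltaC
  have h := (hd.mul (hA.sub ha)).smul 21
  have h0 := HasQSum.unique ((hB.sub hb).smul 10) <| by
    convert! h using 1
    funext τ
    have := (eisenstein_half_relations τ).2.1
    simp only [Pi.mul_apply, Pi.sub_apply, Pi.smul_apply, smul_eq_mul]
    linear_combination this
  rw [expand_qExpansion_E₆, qExpansion_E₄_sub] at h0
  refine smul_right_injective _ (show (10 : ℂ) ≠ 0 by norm_num) ?_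
  simp only [Algebra.smul_def, map_ofNat] at h0 ⊢
  linear_combination h0

/-- The modular forms of weight `2 w` for `Γ⁰(2)`, spanned by the monomials `(8 δ₂)ᵃ ε₂ᵇ`,
`a + 2 b = w`: the pairs of the expansion in `s = q^{1/2}` at one cusp and the constant term at
the other cusp, where `8 δ₂` becomes `2` and `ε₂` becomes `1/16`. -/
def cuspPairs (w : ℕ) : Submodule ℂ (PowerSeries ℂ × ℂ) :=
  Submodule.span ℂ {x | ∃ a b : ℕ, a + 2 * b = w ∧
    x = (deltaC ^ a * epsC ^ b, 2 ^ a * (1 / 16) ^ b)}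

theorem monomial_mem_cuspPairs (a b : ℕ) :
    ((deltaC ^ a * epsC ^ b, 2 ^ a * (1 / 16) ^ b) : PowerSeries ℂ × ℂ) ∈ cuspPairs (a + 2 * b) :=
  Submodule.subset_span ⟨a, b, rfl, rfl⟩

theorem mul_mem_cuspPairs {v w : ℕ} {f g : PowerSeries ℂ × ℂ}
    (hf : f ∈ cuspPairs v) (hg : g ∈ cuspPairs w) : f * g ∈ cuspPairs (v + w) := by
  have h := Submodule.mul_mem_mul hf hg
  rw [cuspPairs, cuspPairs, Submodule.span_mul_span] at h
  refine Submodule.span_mono ?_ h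
  rintro _ ⟨_, ⟨a, b, hab, rfl⟩, _, ⟨c, d, hcd, rfl⟩, rfl⟩
  exact ⟨a + c, b + d, by omega, by simp only [Prod.mk_mul_mk]; congr 1 <;> ring⟩

theorem one_mem_cuspPairs : (1 : PowerSeries ℂ × ℂ) ∈ cuspPairs 0 := by
  simpa [← Prod.one_eq_mk] using monomial_mem_cuspPairs 0 0

theorem pow_mem_cuspPairs {w : ℕ} {f : PowerSeries ℂ × ℂ} (hf : f ∈ cuspPairs w) (a : ℕ) :
    f ^ a ∈ cuspPairs (a * w) := by
  induction a with
  | zero => simpa using one_mem_cuspPairs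
  | succ a ih => rw [pow_succ, add_mul, one_mul]; exact mul_mem_cuspPairs ih hf

theorem deltaC_mem_cuspPairs : ((deltaC, 2) : PowerSeries ℂ × ℂ) ∈ cuspPairs 1 := by
  simpa using monomial_mem_cuspPairs 1 0

/-- A substitution `φ` taking `E₄` and `E₆` to forms for `Γ⁰(2)` with the values `v²` and `v³` at the
other cusp takes a form `f` of level one and weight `2 w` to a form with the value `v ^ w f(i∞)`. -/
theorem eisenstein_mem_cuspPairs_of_values {f₄ f₆ : PowerSeries ℂ} {v : ℂ} {w : ℕ}
    (h4 : ((f₄, v ^ 2) : PowerSeries ℂ × ℂ) ∈ cuspPairs 2)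
    (h6 : ((f₆, v ^ 3) : PowerSeries ℂ × ℂ) ∈ cuspPairs 3)
    (φ : PowerSeries ℂ →ₐ[ℂ] PowerSeries ℂ) (hφ4 : φ (qExpansion 1 E₄) = f₄)
    (hφ6 : φ (qExpansion 1 E₆) = f₆) {f : PowerSeries ℂ} (hf : f ∈ eisensteinMonomialSpan (2 * w)) :
    ((φ f, v ^ w * f.constantCoeff) : PowerSeries ℂ × ℂ) ∈ cuspPairs w := by
  have h40 := E_qExpansion_coeff_zero (k := 4) (by norm_num) ⟨2, rfl⟩
  have h60 := E_qExpansion_coeff_zero (k := 6) (by norm_num) ⟨3, rfl⟩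
  rw [PowerSeries.coeff_zero_eq_constantCoeff_apply] at h40 h60
  induction hf using Submodule.span_induction with
  | mem x hx =>
    obtain ⟨a, b, hab, rfl⟩ := hx
    have h := mul_mem_cuspPairs (pow_mem_cuspPairs h4 a) (pow_mem_cuspPairs h6 b)
    have hw : w = a * 2 + b * 3 := by omega
    rw [hw]
    convert! h using 1
    simp only [map_mul, map_pow, hφ4, hφ6, h40, h60, Prod.pow_mk, Prod.mk_mul_mk]
    congr 1
    ring
  | zero =>
    rw [map_zero, map_zero, mul_zero]
    exact Submodule.zero_mem _
  | add x y _ _ hx hy =>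
    have := Submodule.add_mem _ hx hy
    rwa [Prod.mk_add_mk, ← map_add, ← mul_add, ← map_add] at this
  | smul c x _ hx =>
    have := Submodule.smul_mem _ c hx
    rw [Prod.smul_mk, ← map_smul] at this
    convert! this using 2
    simp [mul_left_comm]

theorem eisensteinG_mem_eisensteinMonomialSpan {w : ℕ} (hw : 2 ≤ w) :
    eisensteinG (2 * w) ∈ eisensteinMonomialSpan (2 * w) := by
  rw [eisensteinG_eq (by omega) ⟨w, by ring⟩]
  exact Submodule.smul_mem _ _ (qExpansion_mem_eisensteinMonomialSpan _ _)

theorem constantCoeff_eisensteinG (k : ℕ) :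
    (eisensteinG k).constantCoeff = -(bernoulli k : ℂ) / (2 * k) := by
  rw [← PowerSeries.coeff_zero_eq_constantCoeff_apply, eisensteinG, PowerSeries.coeff_mk, if_pos rfl]

/-- The Eisenstein series `G_k(τ)`, of level one, has the same constant term at both cusps. -/
theorem expand_eisensteinG_mem_cuspPairs {w : ℕ} (hw : 2 ≤ w) :
    ((PowerSeries.expand 2 two_ne_zero (eisensteinG (2 * w)),
      -(bernoulli (2 * w) : ℂ) / (2 * (2 * w : ℕ))) : PowerSeries ℂ × ℂ) ∈ cuspPairs w := by
  have h := eisenstein_mem_cuspPairs_of_values (v := 1) (w := w) ?_ ?_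
    (PowerSeries.expand 2 two_ne_zero) expand_qExpansion_E₄ expand_qExpansion_E₆
    (eisensteinG_mem_eisensteinMonomialSpan hw)
  · rwa [constantCoeff_eisensteinG, one_pow, one_mul] at h
  · have h := Submodule.sub_mem _ (monomial_mem_cuspPairs 2 0)
      (Submodule.smul_mem _ (48 : ℂ) (monomial_mem_cuspPairs 0 1))
    convert! h using 1
    simp; norm_num
  · have h := Submodule.add_mem _ (Submodule.smul_mem _ (-1 : ℂ) (monomial_mem_cuspPairs 3 0))
      (Submodule.smul_mem _ (72 : ℂ) (monomial_mem_cuspPairs 1 1))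
    convert! h using 1
    simp; norm_num

/-- The Eisenstein series `G_k(τ/2)` becomes `2ᵏ G_k(2τ)` at the other cusp. -/
theorem eisensteinG_mem_cuspPairs {w : ℕ} (hw : 2 ≤ w) :
    ((eisensteinG (2 * w), 2 ^ (2 * w) * (-(bernoulli (2 * w) : ℂ) / (2 * (2 * w : ℕ)))) :
      PowerSeries ℂ × ℂ) ∈ cuspPairs w := by
  have h := eisenstein_mem_cuspPairs_of_values (v := 4) (w := w) ?_ ?_
    (AlgHom.id ℂ _) qExpansion_E₄ qExpansion_E₆ (eisensteinG_mem_eisensteinMonomialSpan hw)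
  · rw [pow_mul, show (2 : ℂ) ^ 2 = 4 by norm_num]
    rwa [constantCoeff_eisensteinG] at h
  · have h := Submodule.add_mem _ (monomial_mem_cuspPairs 2 0)
      (Submodule.smul_mem _ (192 : ℂ) (monomial_mem_cuspPairs 0 1))
    convert! h using 1
    simp; norm_num
  · have h := Submodule.add_mem _ (Submodule.smul_mem _ (-1 : ℂ) (monomial_mem_cuspPairs 3 0))
      (Submodule.smul_mem _ (576 : ℂ) (monomial_mem_cuspPairs 1 1))
    convert! h using 1
    simp; norm_num

end HalfPeriodIdentities

/-! ### Exponentials of nilpotent matrices -/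

section NilpotentExp

open scoped Kronecker

theorem Matrix.pow_apply_mem {R ι : Type*} [CommRing R] [Fintype ι] [DecidableEq ι] {I : Ideal R}
    {M : Matrix ι ι R} (hM : ∀ i j, M i j ∈ I) (m : ℕ) (i j : ι) : (M ^ m) i j ∈ I ^ m := by
  induction m generalizing i j with
  | zero => simp
  | succ m ih =>
    rw [pow_succ, pow_succ, Matrix.mul_apply]
    exact Ideal.sum_mem _ fun k _ => Ideal.mul_mem_mul (ih i k) (hM k j)

theorem Matrix.pow_eq_zero_of_mem {R ι : Type*} [CommRing R] [Fintype ι] [DecidableEq ι]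
    {I : Ideal R} {m : ℕ} (hI : I ^ m = ⊥) {M : Matrix ι ι R} (hM : ∀ i j, M i j ∈ I) :
    M ^ m = 0 := by
  ext i j
  simpa [hI] using Matrix.pow_apply_mem hM m i j

variable {R : Type*} [CommRing R] [Algebra ℚ R] {ι κ : Type*} [Fintype ι] [DecidableEq ι]
  [Fintype κ] [DecidableEq κ]

theorem Matrix.exp_mul_of_intertwining {X : Matrix ι ι R} {Y : Matrix κ κ R} {C : Matrix ι κ R}
    (hX : IsNilpotent X) (hY : IsNilpotent Y) (h : X * C = C * Y) :
    IsNilpotent.exp X * C = C * IsNilpotent.exp Y := by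
  obtain ⟨k, hk⟩ := hX
  obtain ⟨l, hl⟩ := hY
  have hp (i : ℕ) : X ^ i * C = C * Y ^ i := by
    induction i with
    | zero => simp
    | succ i ih => rw [pow_succ', pow_succ, Matrix.mul_assoc, ih, ← Matrix.mul_assoc, h,
        Matrix.mul_assoc, ← pow_succ', pow_succ]
  rw [IsNilpotent.exp_eq_sum (pow_eq_zero_of_le (le_max_left k l) hk),
    IsNilpotent.exp_eq_sum (pow_eq_zero_of_le (le_max_right k l) hl), Matrix.sum_mul,
    Matrix.mul_sum]
  simp [hp]

omit [Algebra ℚ R] in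
theorem Matrix.kronecker_one_pow (X : Matrix ι ι R) (i : ℕ) :
    (X ⊗ₖ (1 : Matrix κ κ R)) ^ i = (X ^ i) ⊗ₖ (1 : Matrix κ κ R) := by
  induction i with
  | zero => simp
  | succ i ih => rw [pow_succ, ih, ← Matrix.mul_kronecker_mul, ← pow_succ, one_mul]

omit [Algebra ℚ R] in
theorem Matrix.one_kronecker_pow (Y : Matrix κ κ R) (i : ℕ) :
    ((1 : Matrix ι ι R) ⊗ₖ Y) ^ i = (1 : Matrix ι ι R) ⊗ₖ (Y ^ i) := by
  induction i with
  | zero => simp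
  | succ i ih => rw [pow_succ, ih, ← Matrix.mul_kronecker_mul, ← pow_succ, one_mul]

omit [Algebra ℚ R] in
theorem Matrix.isNilpotent_kronecker_one {X : Matrix ι ι R} (hX : IsNilpotent X) :
    IsNilpotent (X ⊗ₖ (1 : Matrix κ κ R)) := by
  obtain ⟨k, hk⟩ := hX
  exact ⟨k, by rw [kronecker_one_pow, hk, zero_kronecker]⟩

omit [Algebra ℚ R] in
theorem Matrix.isNilpotent_one_kronecker {Y : Matrix κ κ R} (hY : IsNilpotent Y) :
    IsNilpotent ((1 : Matrix ι ι R) ⊗ₖ Y) := by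
  obtain ⟨k, hk⟩ := hY
  exact ⟨k, by rw [one_kronecker_pow, hk, kronecker_zero]⟩

omit [Algebra ℚ R] in
theorem Matrix.commute_kronecker_one (X : Matrix ι ι R) (Y : Matrix κ κ R) :
    Commute (X ⊗ₖ (1 : Matrix κ κ R)) ((1 : Matrix ι ι R) ⊗ₖ Y) := by
  rw [Commute, SemiconjBy, ← mul_kronecker_mul, ← mul_kronecker_mul]
  simp

theorem Matrix.exp_kronecker_sum {X : Matrix ι ι R} {Y : Matrix κ κ R}
    (hX : IsNilpotent X) (hY : IsNilpotent Y) :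
    IsNilpotent.exp (X ⊗ₖ (1 : Matrix κ κ R) + (1 : Matrix ι ι R) ⊗ₖ Y) =
      IsNilpotent.exp X ⊗ₖ IsNilpotent.exp Y := by
  rw [IsNilpotent.exp_add_of_commute (commute_kronecker_one X Y) (isNilpotent_kronecker_one hX)
    (isNilpotent_one_kronecker hY)]
  have h1 : IsNilpotent.exp (X ⊗ₖ (1 : Matrix κ κ R)) = IsNilpotent.exp X ⊗ₖ 1 := by
    obtain ⟨k, hk⟩ := hX
    rw [IsNilpotent.exp_eq_sum hk, IsNilpotent.exp_eq_sum (k := k)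
      (by rw [kronecker_one_pow, hk, zero_kronecker])]
    simp only [kronecker_one_pow, ← smul_kronecker]
    ext ⟨i, j⟩ ⟨i', j'⟩
    simp [Matrix.sum_apply, Finset.sum_mul]
  have h2 : IsNilpotent.exp ((1 : Matrix ι ι R) ⊗ₖ Y) = 1 ⊗ₖ IsNilpotent.exp Y := by
    obtain ⟨k, hk⟩ := hY
    rw [IsNilpotent.exp_eq_sum hk, IsNilpotent.exp_eq_sum (k := k)
      (by rw [one_kronecker_pow, hk, kronecker_zero])]
    simp only [one_kronecker_pow, ← kronecker_smul]
    ext ⟨i, j⟩ ⟨i', j'⟩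
    simp [Matrix.sum_apply, Finset.mul_sum]
  rw [h1, h2, ← mul_kronecker_mul, mul_one, one_mul]

end NilpotentExp

/-! ### Newton's identities for families of representations -/

section SecondQuantization

open scoped Kronecker
open Matrix

/-- A family of representations `rho k` of the Lie algebra `𝔤𝔩_N`, such as `S^k` and `Λ^k` of the
standard representation, with creation maps `C k : V_k ⊗ ℂ^N → V_{k+1}` and annihilation maps
`A k : V_{k+1} → V_k ⊗ ℂ^N` satisfying the (anti)commutation relations `a_i c_j - σ c_j a_i = δ_{ij}`
and `∑ c_i a_i = k + 1` on `V_{k+1}`. -/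
structure SecondQuantization (N : ℕ) (σ : ℂ) where
  /-- the basis of the `k`-th representation -/
  idx : ℕ → Type
  [fin : ∀ k, Fintype (idx k)]
  [dec : ∀ k, DecidableEq (idx k)]
  [uniq : Unique (idx 0)]
  /-- creation -/
  C : ∀ k, Matrix (idx (k + 1)) (idx k × Fin N) ℂ
  /-- annihilation -/
  A : ∀ k, Matrix (idx k × Fin N) (idx (k + 1)) ℂ
  /-- the representation -/
  rho : ∀ k, Matrix (Fin N) (Fin N) ℂ → Matrix (idx k) (idx k) ℂ
  rho_zero : ∀ M, rho 0 M = 0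
  C_mul_A : ∀ k, C k * A k = ((k : ℂ) + 1) • 1
  rho_mul_C : ∀ k M, rho (k + 1) M * C k = C k * (rho k M ⊗ₖ 1 + 1 ⊗ₖ M)
  A_mul_C_zero : A 0 * C 0 = 1
  A_mul_C : ∀ k t t' i j, (A (k + 1) * C (k + 1)) (t, i) (t', j) =
    (1 : Matrix (idx (k + 1)) (idx (k + 1)) ℂ) t t' * (1 : Matrix (Fin N) (Fin N) ℂ) i j +
      σ * ∑ u, C k t (u, j) * A k (u, i) t'

namespace SecondQuantization

attribute [instance] SecondQuantization.fin SecondQuantization.dec SecondQuantization.uniq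

variable {N : ℕ} {σ : ℂ} (F : SecondQuantization N σ)

theorem eq_of_mul_C {k : ℕ} {X Y : Matrix (F.idx (k + 1)) (F.idx (k + 1)) ℂ}
    (h : X * F.C k = Y * F.C k) : X = Y := by
  have h1 := congrArg (· * F.A k) h
  simp only [Matrix.mul_assoc, F.C_mul_A, Matrix.mul_smul, Matrix.mul_one] at h1
  exact smul_right_injective _ (Nat.cast_add_one_ne_zero k) h1

theorem rho_add (k : ℕ) (M M' : Matrix (Fin N) (Fin N) ℂ) :
    F.rho k (M + M') = F.rho k M + F.rho k M' := by
  induction k with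
  | zero => simp [F.rho_zero]
  | succ k ih =>
    refine F.eq_of_mul_C ?_
    rw [Matrix.add_mul]
    simp only [F.rho_mul_C, ih, ← Matrix.mul_add, add_kronecker, kronecker_add]
    congr 1
    abel

theorem rho_smul (k : ℕ) (c : ℂ) (M : Matrix (Fin N) (Fin N) ℂ) :
    F.rho k (c • M) = c • F.rho k M := by
  induction k with
  | zero => simp [F.rho_zero]
  | succ k ih =>
    refine F.eq_of_mul_C ?_
    rw [Matrix.smul_mul]
    simp only [F.rho_mul_C, ih, ← Matrix.mul_smul, smul_kronecker, kronecker_smul, smul_add]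

/-- The representation as a linear map. -/
def rhoLin (k : ℕ) : Matrix (Fin N) (Fin N) ℂ →ₗ[ℂ] Matrix (F.idx k) (F.idx k) ℂ where
  toFun := F.rho k
  map_add' := F.rho_add k
  map_smul' := F.rho_smul k

theorem rho_commutator (k : ℕ) (M M' : Matrix (Fin N) (Fin N) ℂ) :
    F.rho k (M * M' - M' * M) = F.rho k M * F.rho k M' - F.rho k M' * F.rho k M := by
  induction k with
  | zero => simp [F.rho_zero]
  | succ k ih =>
    refine F.eq_of_mul_C ?_
    rw [Matrix.sub_mul, Matrix.mul_assoc, Matrix.mul_assoc]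
    simp only [F.rho_mul_C, ← Matrix.mul_assoc]
    simp only [Matrix.mul_assoc, ← Matrix.mul_sub, ih]
    congr 1
    simp only [Matrix.add_mul, Matrix.mul_add, ← mul_kronecker_mul, one_mul, mul_one]
    rw [sub_eq_add_neg (_ * _), sub_eq_add_neg (_ * _), add_kronecker, kronecker_add,
      ← neg_one_smul ℂ (_ * _), ← neg_one_smul ℂ (M' * M), smul_kronecker, kronecker_smul]
    simp only [neg_smul, one_smul]
    abel

section BaseChange

variable {R : Type*} [CommRing R] [Algebra ℂ R]

/-- The representation on matrices with entries in a `ℂ`-algebra. -/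
def rhoR (k : ℕ) (B : Matrix (Fin N) (Fin N) R) : Matrix (F.idx k) (F.idx k) R :=
  ∑ p, ∑ q, B p q • (F.rho k (single p q 1)).map (algebraMap ℂ R)

theorem rhoR_apply_mem {I : Ideal R} {B : Matrix (Fin N) (Fin N) R} (hB : ∀ i j, B i j ∈ I) (k : ℕ)
    (s t : F.idx k) : F.rhoR k B s t ∈ I := by
  simp only [rhoR, Matrix.sum_apply, Matrix.smul_apply, smul_eq_mul]
  exact Ideal.sum_mem _ fun p _ => Ideal.sum_mem _ fun q _ => I.mul_mem_right _ (hB p q)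

theorem rhoR_zero (B : Matrix (Fin N) (Fin N) R) : F.rhoR 0 B = 0 := by
  simp [rhoR, F.rho_zero]

theorem rhoR_map (k : ℕ) (M : Matrix (Fin N) (Fin N) ℂ) (x : R) :
    F.rhoR k (x • M.map (algebraMap ℂ R)) = x • (F.rho k M).map (algebraMap ℂ R) := by
  have h : F.rho k M = ∑ p, ∑ q, M p q • F.rho k (single p q 1) := by
    conv_lhs => rw [matrix_eq_sum_single M]
    change F.rhoLin k _ = _
    simp only [map_sum]
    refine Finset.sum_congr rfl fun p _ => Finset.sum_congr rfl fun q _ => ?_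
    change _ = M p q • F.rhoLin k _
    rw [← map_smul, smul_single, smul_eq_mul, mul_one]
  rw [h]
  ext s t
  simp only [rhoR, Matrix.sum_apply, Matrix.smul_apply, Matrix.map_apply, smul_eq_mul, map_sum,
    map_mul, Finset.mul_sum, mul_assoc]

theorem rhoR_add (k : ℕ) (B B' : Matrix (Fin N) (Fin N) R) :
    F.rhoR k (B + B') = F.rhoR k B + F.rhoR k B' := by
  simp only [rhoR, Matrix.add_apply, add_smul, Finset.sum_add_distrib]

/-- The base change of the representation as an additive map. -/
def rhoRHom (k : ℕ) : Matrix (Fin N) (Fin N) R →+ Matrix (F.idx k) (F.idx k) R :=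
  AddMonoidHom.mk' (F.rhoR k) (F.rhoR_add k)

theorem rhoR_mul_C (k : ℕ) (B : Matrix (Fin N) (Fin N) R) :
    F.rhoR (k + 1) B * (F.C k).map (algebraMap ℂ R) =
      (F.C k).map (algebraMap ℂ R) * (F.rhoR k B ⊗ₖ 1 + 1 ⊗ₖ B) := by
  let K : (Matrix (Fin N) (Fin N) R) →+ Matrix (F.idx k × Fin N) (F.idx k × Fin N) R :=
    AddMonoidHom.mk' (fun B => F.rhoR k B ⊗ₖ 1 + 1 ⊗ₖ B) fun B B' => by
      simp only [rhoR_add, add_kronecker, kronecker_add]; abel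
  have hB : B = ∑ p, ∑ q, B p q • (single p q (1 : ℂ)).map (algebraMap ℂ R) := by
    conv_lhs => rw [matrix_eq_sum_single B]
    simp
  change F.rhoRHom (k + 1) B * _ = _ * K B
  rw [hB]
  simp only [map_sum, Matrix.sum_mul, Matrix.mul_sum]
  refine Finset.sum_congr rfl fun p _ => Finset.sum_congr rfl fun q _ => ?_
  generalize B p q = x
  have h := congrArg (fun X => X.map (algebraMap ℂ R)) (F.rho_mul_C k (single p q 1))
  simp only [Matrix.map_mul] at h
  change F.rhoR (k + 1) (x • (single p q (1 : ℂ)).map (algebraMap ℂ R)) * _ =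
    _ * (F.rhoR k (x • (single p q (1 : ℂ)).map (algebraMap ℂ R)) ⊗ₖ
      (1 : Matrix (Fin N) (Fin N) R) + (1 : Matrix (F.idx k) (F.idx k) R) ⊗ₖ
        (x • (single p q (1 : ℂ)).map (algebraMap ℂ R)))
  rw [rhoR_map, rhoR_map, Matrix.smul_mul, h, smul_kronecker, kronecker_smul, ← smul_add,
    Matrix.mul_smul]
  congr 2
  ext ⟨s, i⟩ ⟨t, j⟩
  simp only [Matrix.map_apply, Matrix.add_apply, kroneckerMap_apply, map_add, map_mul,
    Matrix.one_apply]
  congr 2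
  · split_ifs <;> simp
  · split_ifs <;> simp

theorem C_mul_A_map (k : ℕ) : (F.C k).map (algebraMap ℂ R) * (F.A k).map (algebraMap ℂ R) =
    ((k : R) + 1) • 1 := by
  rw [← Matrix.map_mul, F.C_mul_A]
  ext s t
  simp only [Matrix.map_apply, Matrix.smul_apply, Matrix.one_apply]
  split_ifs <;> simp

theorem trace_kronecker_mul_A_mul_C (k : ℕ) (E : Matrix (F.idx (k + 1)) (F.idx (k + 1)) R)
    (M : Matrix (Fin N) (Fin N) R) :
    trace ((E ⊗ₖ M) * ((F.A (k + 1)).map (algebraMap ℂ R) * (F.C (k + 1)).map (algebraMap ℂ R))) =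
      trace E * trace M + algebraMap ℂ R σ *
        trace (E * ((F.C k).map (algebraMap ℂ R) *
          ((1 : Matrix (F.idx k) (F.idx k) R) ⊗ₖ M) * (F.A k).map (algebraMap ℂ R))) := by
  have h1 : (F.A (k + 1)).map (algebraMap ℂ R) * (F.C (k + 1)).map (algebraMap ℂ R) =
      1 + algebraMap ℂ R σ • Matrix.of (fun x y : F.idx (k + 1) × Fin N =>
        ∑ u, algebraMap ℂ R (F.C k x.1 (u, y.2)) * algebraMap ℂ R (F.A k (u, x.2) y.1)) := by
    rw [← Matrix.map_mul]
    ext ⟨t, i⟩ ⟨t', j⟩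
    rw [Matrix.map_apply, F.A_mul_C]
    simp only [Matrix.one_apply, Matrix.add_apply, Matrix.smul_apply, Matrix.of_apply, map_add,
      map_mul, map_sum, smul_eq_mul, Prod.mk.injEq]
    congr 1
    split_ifs <;> simp_all
  rw [h1, mul_add, mul_one, trace_add, trace_kronecker, Matrix.mul_smul, trace_smul, smul_eq_mul]
  congr 2
  have h2 (s : F.idx (k + 1)) (u : F.idx k) (i : Fin N) : ((F.C k).map (algebraMap ℂ R) *
      ((1 : Matrix (F.idx k) (F.idx k) R) ⊗ₖ M)) s (u, i) =
      ∑ j, algebraMap ℂ R (F.C k s (u, j)) * M j i := by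
    simp [Matrix.mul_apply, Fintype.sum_prod_type, Matrix.one_apply]
  generalize (F.C k).map (algebraMap ℂ R) * ((1 : Matrix (F.idx k) (F.idx k) R) ⊗ₖ M) = D at h2 ⊢
  simp only [trace, diag_apply]
  rw [Fintype.sum_prod_type]
  refine Finset.sum_congr rfl fun t' _ => ?_
  simp only [Matrix.mul_apply, h2, Fintype.sum_prod_type, kroneckerMap_apply, Matrix.map_apply, Matrix.of_apply]
  rw [Finset.sum_comm]
  refine Finset.sum_congr rfl fun t _ => ?_
  simp only [Finset.mul_sum, Finset.sum_mul]
  rw [Finset.sum_comm]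
  refine Eq.trans ?_ Finset.sum_comm
  refine Finset.sum_congr rfl fun i _ => ?_
  rw [Finset.sum_comm]
  refine Finset.sum_congr rfl fun u _ => Finset.sum_congr rfl fun j _ => by ring

/-- The trace of the exponential of the action of `B` on the `k`-th representation. -/
noncomputable def trExp [Algebra ℚ R] (k : ℕ) (B : Matrix (Fin N) (Fin N) R) : R :=
  trace (IsNilpotent.exp (F.rhoR k B))

variable [Algebra ℚ R]

theorem trExp_zero (B : Matrix (Fin N) (Fin N) R) : F.trExp 0 B = 1 := by
  simp [trExp, rhoR_zero, IsNilpotent.exp_zero, trace]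

section Nilpotent

variable {I : Ideal R} {m : ℕ} {B : Matrix (Fin N) (Fin N) R}

omit [Algebra ℚ R] in
theorem isNilpotent_rhoR (hI : I ^ m = ⊥) (hB : ∀ i j, B i j ∈ I) (k : ℕ) : IsNilpotent (F.rhoR k B) :=
  ⟨m, Matrix.pow_eq_zero_of_mem hI (F.rhoR_apply_mem hB k)⟩

/-- Creation intertwines `e^B` on `V_{k+1}` with `e^B ⊗ e^B` on `V_k ⊗ R^N`. -/
theorem exp_rhoR_mul_C (hI : I ^ m = ⊥) (hB : ∀ i j, B i j ∈ I) (k : ℕ) :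
    IsNilpotent.exp (F.rhoR (k + 1) B) * (F.C k).map (algebraMap ℂ R) =
      (F.C k).map (algebraMap ℂ R) * (IsNilpotent.exp (F.rhoR k B) ⊗ₖ IsNilpotent.exp B) := by
  have h1 := F.isNilpotent_rhoR hI hB k
  have h2 : IsNilpotent B := ⟨m, Matrix.pow_eq_zero_of_mem hI hB⟩
  rw [← Matrix.exp_kronecker_sum h1 h2]
  refine Matrix.exp_mul_of_intertwining (F.isNilpotent_rhoR hI hB _) ?_ (F.rhoR_mul_C k B)
  exact (Matrix.commute_kronecker_one _ _).isNilpotent_add (Matrix.isNilpotent_kronecker_one h1)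
    (Matrix.isNilpotent_one_kronecker h2)

/-- Moving `e^B` around the trace with the (anti)commutation relations. -/
theorem trace_exp_kronecker (hI : I ^ m = ⊥) (hB : ∀ i j, B i j ∈ I) (k : ℕ) (M : Matrix (Fin N) (Fin N) R) :
    trace ((IsNilpotent.exp (F.rhoR k B) ⊗ₖ M) *
      ((F.A k).map (algebraMap ℂ R) * (F.C k).map (algebraMap ℂ R))) =
      ∑ j ∈ Finset.range (k + 1), algebraMap ℂ R σ ^ j * trace (IsNilpotent.exp B ^ j * M) *
        F.trExp (k - j) B := by
  induction k generalizing M with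
  | zero =>
    rw [← Matrix.map_mul, F.A_mul_C_zero, Matrix.map_one _ (map_zero _) (map_one _), mul_one,
      trace_kronecker, mul_comm]
    simp [trExp]
  | succ k ih =>
    rw [F.trace_kronecker_mul_A_mul_C, Finset.sum_range_succ', ← Matrix.mul_assoc,
      ← Matrix.mul_assoc, F.exp_rhoR_mul_C hI hB, Matrix.mul_assoc _ _ (_ ⊗ₖ M),
      ← mul_kronecker_mul, mul_one, Matrix.mul_assoc, trace_mul_comm, Matrix.mul_assoc, ih,
      Finset.mul_sum, add_comm]
    congr 1
    · refine Finset.sum_congr rfl fun j _ => ?_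
      rw [Nat.add_sub_add_right, pow_succ, pow_succ, ← Matrix.mul_assoc]
      ring
    · simp [trExp, mul_comm]

/-- Newton's identities for the characters of `S^k` and `Λ^k`. -/
theorem newton_trExp (hI : I ^ m = ⊥) (hB : ∀ i j, B i j ∈ I) (k : ℕ) :
    ((k : R) + 1) * F.trExp (k + 1) B = ∑ j ∈ Finset.range (k + 1),
      algebraMap ℂ R σ ^ j * trace (IsNilpotent.exp B ^ (j + 1)) * F.trExp (k - j) B := by
  have h := F.trace_exp_kronecker hI hB k (IsNilpotent.exp B)
  simp only [← pow_succ] at h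
  rw [← h, trExp, ← smul_eq_mul, ← trace_smul, ← Matrix.mul_one (IsNilpotent.exp (F.rhoR (k + 1) B)),
    ← Matrix.mul_smul, ← F.C_mul_A_map, ← Matrix.mul_assoc, F.exp_rhoR_mul_C hI hB,
    Matrix.mul_assoc, trace_mul_comm, Matrix.mul_assoc]

end Nilpotent

end BaseChange

end SecondQuantization
end SecondQuantization

/-! ### Symmetric powers -/

section Bosons

open Matrix
open scoped Kronecker

theorem Sym.toFinsupp_cons {N k : ℕ} (j : Fin N) (t : Sym (Fin N) k) :
    Multiset.toFinsupp ((j ::ₛ t : Sym (Fin N) (k + 1)) : Multiset (Fin N)) =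
      Finsupp.single j 1 + Multiset.toFinsupp (t : Multiset (Fin N)) := by
  rw [Sym.coe_cons, ← Multiset.singleton_add, map_add, Multiset.toFinsupp_singleton]

theorem Sym.sum_eq_cons {N k : ℕ} {M : Type*} [AddCommMonoid M] (s : Sym (Fin N) (k + 1)) (j : Fin N)
    (f : Sym (Fin N) k → M) :
    ∑ u, (if s = j ::ₛ u then f u else 0) = if h : j ∈ s then f (s.erase j h) else 0 := by
  split_ifs with h
  · rw [Finset.sum_eq_single (s.erase j h)]
    · simp
    · intro u _ hu
      rw [if_neg]
      rintro rfl
      simp at hu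
    · simp
  · refine Finset.sum_eq_zero fun u _ => if_neg ?_
    rintro rfl
    simp at h

theorem MvPolynomial.coeff_X_mul_sym {N k : ℕ} (s : Sym (Fin N) (k + 1)) (j : Fin N)
    (p : MvPolynomial (Fin N) ℂ) :
    coeff (Multiset.toFinsupp (s : Multiset (Fin N))) (X j * p) =
      ∑ u : Sym (Fin N) k, if s = j ::ₛ u then
        coeff (Multiset.toFinsupp (u : Multiset (Fin N))) p else 0 := by
  rw [Sym.sum_eq_cons]
  split_ifs with h
  · conv_lhs => rw [← Sym.cons_erase h, Sym.toFinsupp_cons, coeff_X_mul]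
  · rw [coeff_X_mul', if_neg]
    simpa using h

namespace SymmetricPower

/-- Multiplication by `X j` on homogeneous polynomials of degree `k`. -/
def create (N k : ℕ) : Matrix (Sym (Fin N) (k + 1)) (Sym (Fin N) k × Fin N) ℂ :=
  Matrix.of fun s x => if s = x.2 ::ₛ x.1 then 1 else 0

/-- The derivative `∂ / ∂ X j` on homogeneous polynomials of degree `k + 1`. -/
def annihilate (N k : ℕ) : Matrix (Sym (Fin N) k × Fin N) (Sym (Fin N) (k + 1)) ℂ :=
  Matrix.of fun x s => if s = x.2 ::ₛ x.1 then ((s : Multiset (Fin N)).count x.2 : ℂ) else 0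

/-- The action of a matrix on homogeneous polynomials of degree `k` as a derivation. -/
noncomputable def rho {N : ℕ} (k : ℕ) (M : Matrix (Fin N) (Fin N) ℂ) :
    Matrix (Sym (Fin N) k) (Sym (Fin N) k) ℂ :=
  Matrix.of fun s t => MvPolynomial.coeff (Multiset.toFinsupp (s : Multiset (Fin N)))
    (MvPolynomial.mkDerivation ℂ
      (fun j => ∑ i, MvPolynomial.C (M i j) * (MvPolynomial.X i : MvPolynomial (Fin N) ℂ))
      (MvPolynomial.monomial (Multiset.toFinsupp (t : Multiset (Fin N))) 1))

theorem create_mul_annihilate (N k : ℕ) :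
    create N k * annihilate N k = ((k : ℂ) + 1) • 1 := by
  ext s s'
  rw [Matrix.mul_apply, Fintype.sum_prod_type, Finset.sum_comm]
  simp only [create, annihilate, Matrix.of_apply, ite_mul, one_mul, zero_mul]
  refine (Finset.sum_congr rfl fun j _ => Sym.sum_eq_cons s j _).trans ?_
  rcases eq_or_ne s s' with rfl | h
  · refine (Finset.sum_congr rfl (g := fun j => ((s : Multiset (Fin N)).count j : ℂ))
      fun j _ => ?_).trans ?_
    · split_ifs with h1 h2
      · rfl
      · exact absurd (Sym.cons_erase h1).symm h2
      · rw [Multiset.count_eq_zero_of_notMem (Sym.mem_coe.not.mpr h1), Nat.cast_zero]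
    rw [← Nat.cast_sum, Multiset.sum_count_eq_card (fun _ _ => Finset.mem_univ _)]
    simp
  · rw [Finset.sum_eq_zero]
    · simp [h]
    · intro j _
      split_ifs with h1 h2
      · simp at h2; exact absurd h2.symm h
      · rfl
      · rfl

theorem rho_mul_create {N : ℕ} (k : ℕ) (M : Matrix (Fin N) (Fin N) ℂ) :
    rho (k + 1) M * create N k = create N k * (rho k M ⊗ₖ 1 + 1 ⊗ₖ M) := by
  ext s ⟨t, j⟩
  rw [Matrix.mul_apply, Matrix.mul_apply, Fintype.sum_prod_type]
  simp only [create, rho, Matrix.of_apply, mul_ite, mul_one, mul_zero, Finset.sum_ite_eq',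
    Finset.mem_univ, if_true, Matrix.add_apply, kroneckerMap_apply, Matrix.one_apply, ite_mul,
    zero_mul, one_mul, mul_add, Finset.sum_add_distrib]
  rw [Sym.toFinsupp_cons, ← one_mul (1 : ℂ), ← MvPolynomial.monomial_mul, one_mul,
    show MvPolynomial.monomial (Finsupp.single j 1) (1 : ℂ) = MvPolynomial.X j from rfl,
    Derivation.leibniz, MvPolynomial.coeff_add, MvPolynomial.mkDerivation_X]
  congr 1
  · rw [smul_eq_mul]
    rw [MvPolynomial.coeff_X_mul_sym]
  · rw [smul_eq_mul, Finset.mul_sum, MvPolynomial.coeff_sum,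
      Finset.sum_comm]
    refine Finset.sum_congr rfl fun i _ => ?_
    rw [mul_left_comm, MvPolynomial.coeff_C_mul, mul_comm (MvPolynomial.monomial _ _),
      MvPolynomial.coeff_X_mul_sym, Finset.mul_sum]
    refine Finset.sum_congr rfl fun u _ => ?_
    rw [MvPolynomial.coeff_monomial]
    have : Multiset.toFinsupp (t : Multiset (Fin N)) = Multiset.toFinsupp (u : Multiset (Fin N)) ↔
        u = t := by
      rw [Multiset.toFinsupp.injective.eq_iff, Sym.coe_inj, eq_comm]
    simp only [this]
    split_ifs <;> simp

theorem annihilate_mul_create_apply {N : ℕ} (k : ℕ) (t t' : Sym (Fin N) k) (i j : Fin N) :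
    (annihilate N k * create N k) (t, i) (t', j) =
      if i ::ₛ t = j ::ₛ t' then (((i ::ₛ t : Sym (Fin N) (k + 1)) : Multiset (Fin N)).count i : ℂ)
        else 0 := by
  rw [Matrix.mul_apply]
  simp only [create, annihilate, Matrix.of_apply, mul_ite, mul_one, mul_zero, Finset.sum_ite_eq',
    Finset.mem_univ, if_true, eq_comm (a := i ::ₛ t)]
  split_ifs with h
  · rw [h]
  · rfl

theorem annihilate_mul_create_zero (N : ℕ) : annihilate N 0 * create N 0 = 1 := by
  ext ⟨t, i⟩ ⟨t', j⟩
  obtain rfl := Subsingleton.elim t t'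
  rw [annihilate_mul_create_apply]
  have ht : (t : Multiset (Fin N)) = 0 := by rw [Sym.eq_nil_of_card_zero t]; rfl
  rcases eq_or_ne i j with rfl | h
  · simp [Sym.coe_cons, ht]
  · simp [h]

theorem annihilate_mul_create {N : ℕ} (k : ℕ) (t t' : Sym (Fin N) (k + 1)) (i j : Fin N) :
    (annihilate N (k + 1) * create N (k + 1)) (t, i) (t', j) =
    (1 : Matrix (Sym (Fin N) (k + 1)) (Sym (Fin N) (k + 1)) ℂ) t t' *
      (1 : Matrix (Fin N) (Fin N) ℂ) i j +
        1 * ∑ u, create N k t (u, j) * annihilate N k (u, i) t' := by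
  rw [annihilate_mul_create_apply]
  simp only [create, annihilate, Matrix.of_apply, ite_mul, zero_mul, one_mul]
  rw [Sym.sum_eq_cons]
  rcases eq_or_ne i j with rfl | hij
  · simp only [Sym.cons_inj_right, Matrix.one_apply_eq, mul_one, Matrix.one_apply]
    by_cases h : t = t'
    · subst h
      by_cases hi : i ∈ t
      · simp [hi, Sym.coe_cons, add_comm]
      · simp [hi, Sym.coe_cons]
    · simp only [h, if_false, zero_add]
      split_ifs with h1 h2
      · simp at h2; exact absurd h2.symm h
      · rfl
      · rfl
  · simp only [Matrix.one_apply_ne hij, mul_zero, zero_add]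
    by_cases hj : j ∈ t
    · obtain ⟨u, rfl⟩ := Sym.exists_cons_of_mem hj
      simp only [hj, dif_pos, Sym.erase_cons_head, Sym.cons_swap i j u, Sym.cons_inj_right,
        eq_comm (a := t')]
      split_ifs with h
      · rw [← h, Sym.coe_cons, Sym.coe_cons, Multiset.count_cons_of_ne hij]
      · rfl
    · simp only [hj, dif_neg, not_false_eq_true]
      rw [if_neg]
      intro h
      have : j ∈ i ::ₛ t := by rw [h]; simp
      rw [Sym.mem_cons] at this
      exact this.elim (fun h => hij h.symm) hj

end SymmetricPower

open SymmetricPower in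
/-- The symmetric powers, realised on homogeneous polynomials. -/
noncomputable def symmetricPowers (N : ℕ) : SecondQuantization N 1 where
  idx k := Sym (Fin N) k
  C := create N
  A := annihilate N
  rho := rho
  rho_zero M := by
    ext s t
    have : ((t : Sym (Fin N) 0) : Multiset (Fin N)) = 0 := by
      rw [Sym.eq_nil_of_card_zero t]; rfl
    rw [SymmetricPower.rho, Matrix.of_apply, this]
    have h1 : (MvPolynomial.monomial (Multiset.toFinsupp (0 : Multiset (Fin N))) (1 : ℂ)) = 1 := by
      simp
    rw [h1, Derivation.map_one_eq_zero]
    simp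
  C_mul_A := create_mul_annihilate N
  rho_mul_C := rho_mul_create
  A_mul_C_zero := annihilate_mul_create_zero N
  A_mul_C := annihilate_mul_create

end Bosons

/-! ### Exterior powers -/

section Fermions

open Matrix
open scoped Kronecker

namespace ExteriorPower

variable {N : ℕ}

/-- The sign of moving `e_j` past the `e_l` with `l ∈ t`, `l < j`. -/
def wedgeSign {R : Type*} [CommRing R] (j : Fin N) (t : Finset (Fin N)) : R :=
  (-1) ^ (t.filter (· < j)).card

theorem wedgeSign_mul_self {R : Type*} [CommRing R] (j : Fin N) (t : Finset (Fin N)) :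
    (wedgeSign j t : R) * wedgeSign j t = 1 := by
  rw [wedgeSign, ← mul_pow]; simp

theorem wedgeSign_insert {R : Type*} [CommRing R] {i j : Fin N} {u : Finset (Fin N)} (hj : j ∉ u) :
    (wedgeSign i (insert j u) : R) = (if j < i then -1 else 1) * wedgeSign i u := by
  rw [wedgeSign, wedgeSign, Finset.filter_insert]
  split_ifs with h
  · rw [Finset.card_insert_of_notMem (by simp [hj]), pow_succ']
  · rw [one_mul]

/-- The minor of `g` with rows `s` and columns `t`. -/
def minor {R : Type*} [CommRing R] (g : Matrix (Fin N) (Fin N) R) {k : ℕ}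
    (s t : {s : Finset (Fin N) // s.card = k}) : R :=
  (g.submatrix (s.1.orderEmbOfFin s.2) (t.1.orderEmbOfFin t.2)).det

/-- Removal of an element. -/
def remove {k : ℕ} (s : {s : Finset (Fin N) // s.card = k + 1}) (i : Fin N) (h : i ∈ s.1) :
    {s : Finset (Fin N) // s.card = k} :=
  ⟨s.1.erase i, by rw [Finset.card_erase_of_mem h, s.2]; rfl⟩

/-- Insertion of an element. -/
def adjoin {k : ℕ} (t : {s : Finset (Fin N) // s.card = k}) (j : Fin N) (h : j ∉ t.1) :
    {s : Finset (Fin N) // s.card = k + 1} :=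
  ⟨insert j t.1, by rw [Finset.card_insert_of_notMem h, t.2]⟩

theorem orderEmbOfFin_remove {k : ℕ} (s : {s : Finset (Fin N) // s.card = k + 1}) (i : Fin (k + 1))
    (h : s.1.orderEmbOfFin s.2 i ∈ s.1) :
    (s.1.orderEmbOfFin s.2) ∘ i.succAbove =
      ((remove s _ h).1.orderEmbOfFin (remove s _ h).2) := by
  refine Finset.orderEmbOfFin_unique _ (fun x => ?_) ?_
  · simp only [remove, Function.comp_apply, Finset.mem_erase]
    exact ⟨fun e => Fin.succAbove_ne i x ((s.1.orderEmbOfFin s.2).injective e),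
      Finset.orderEmbOfFin_mem _ _ _⟩
  · exact (s.1.orderEmbOfFin s.2).strictMono.comp (Fin.strictMono_succAbove i)

theorem wedgeSign_remove {R : Type*} [CommRing R] {k : ℕ}
    (s : {s : Finset (Fin N) // s.card = k + 1}) (i : Fin (k + 1)) :
    (wedgeSign (s.1.orderEmbOfFin s.2 i) (s.1.erase (s.1.orderEmbOfFin s.2 i)) : R) =
      (-1) ^ (i : ℕ) := by
  rw [wedgeSign]
  congr 1
  have : (s.1.erase (s.1.orderEmbOfFin s.2 i)).filter (· < s.1.orderEmbOfFin s.2 i) =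
      (Finset.Iio i).image (s.1.orderEmbOfFin s.2) := by
    ext x
    simp only [Finset.mem_filter, Finset.mem_erase, Finset.mem_image, Finset.mem_Iio]
    constructor
    · rintro ⟨⟨_, h⟩, h2⟩
      rw [← Finset.mem_coe, ← Finset.range_orderEmbOfFin s.1 s.2] at h
      obtain ⟨y, rfl⟩ := h
      exact ⟨y, by simpa using h2, rfl⟩
    · rintro ⟨y, h, rfl⟩
      have h1 : s.1.orderEmbOfFin s.2 y < s.1.orderEmbOfFin s.2 i := by simpa using h
      exact ⟨⟨h1.ne, Finset.orderEmbOfFin_mem _ _ _⟩, h1⟩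
  rw [this, Finset.card_image_of_injective _ (s.1.orderEmbOfFin s.2).injective, Fin.card_Iio]

/-- Laplace expansion of a minor along one of its columns. -/
theorem sum_minor_remove {R : Type*} [CommRing R] (g : Matrix (Fin N) (Fin N) R) {k : ℕ}
    (s : {s : Finset (Fin N) // s.card = k + 1}) (t : {s : Finset (Fin N) // s.card = k})
    (j : Fin N) :
    ∑ i, (if h : i ∈ s.1 then wedgeSign i (s.1.erase i) * (g i j * minor g (remove s i h) t)
      else 0) = if h : j ∈ t.1 then 0 else wedgeSign j t.1 * minor g s (adjoin t j h) := by
  have hsum : ∑ i, (if h : i ∈ s.1 then wedgeSign i (s.1.erase i) *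
      (g i j * minor g (remove s i h) t) else 0) =
      ∑ i : Fin (k + 1), (-1) ^ (i : ℕ) * g (s.1.orderEmbOfFin s.2 i) j *
        (g.submatrix ((s.1.orderEmbOfFin s.2) ∘ i.succAbove) (t.1.orderEmbOfFin t.2)).det := by
    symm
    refine Finset.sum_of_injOn (s.1.orderEmbOfFin s.2) ?_ ?_ ?_ ?_
    · exact (s.1.orderEmbOfFin s.2).injective.injOn
    · simp
    · intro i _ hi
      rw [dif_neg]
      intro h
      rw [← Finset.mem_coe, ← Finset.range_orderEmbOfFin s.1 s.2] at h
      exact hi (by simpa using h)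
    · intro i _
      have h := Finset.orderEmbOfFin_mem s.1 s.2 i
      rw [dif_pos h, wedgeSign_remove, minor, orderEmbOfFin_remove s i h, mul_assoc]
  rw [hsum]
  split_ifs with hj
  · have h1 := Matrix.det_succ_column_zero (g.submatrix (s.1.orderEmbOfFin s.2)
      (Fin.cons j (t.1.orderEmbOfFin t.2)))
    obtain ⟨q, hq⟩ : ∃ q, t.1.orderEmbOfFin t.2 q = j := by
      rw [← Finset.mem_coe, ← Finset.range_orderEmbOfFin t.1 t.2] at hj
      exact hj
    rw [Matrix.det_zero_of_column_eq (i := 0) (j := q.succ) (Fin.succ_ne_zero q).symm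
      (fun p => by simp [hq])] at h1
    rw [h1]
    refine Finset.sum_congr rfl fun i _ => ?_
    simp only [Matrix.submatrix_apply, Fin.cons_zero, Matrix.submatrix_submatrix]
    rfl
  · obtain ⟨p, hp⟩ : ∃ p, (adjoin t j hj).1.orderEmbOfFin (adjoin t j hj).2 p = j := by
      have : j ∈ ((adjoin t j hj).1 : Set (Fin N)) := by simp [adjoin]
      rw [← Finset.range_orderEmbOfFin _ (adjoin t j hj).2] at this
      exact this
    have h1 := Matrix.det_succ_column (g.submatrix (s.1.orderEmbOfFin s.2)
      ((adjoin t j hj).1.orderEmbOfFin (adjoin t j hj).2)) p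
    have h2 := wedgeSign_remove (R := R) (adjoin t j hj) p
    have h3 := orderEmbOfFin_remove (adjoin t j hj) p (Finset.orderEmbOfFin_mem _ _ _)
    have h4 : remove (adjoin t j hj) _ (Finset.orderEmbOfFin_mem _ (adjoin t j hj).2 p) = t := by
      refine Subtype.ext ?_
      simp only [remove]
      rw [hp]
      simp [adjoin, hj]
    rw [h4] at h3
    rw [hp] at h2
    simp only [adjoin, Finset.erase_insert hj] at h2
    rw [minor, h1, h2, Finset.mul_sum]
    refine Finset.sum_congr rfl fun i _ => ?_
    simp only [Matrix.submatrix_apply, Matrix.submatrix_submatrix, hp, h3]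
    rw [pow_add]
    have : ((-1 : R) ^ (p : ℕ)) * (-1) ^ (p : ℕ) = 1 := by rw [← mul_pow]; simp
    linear_combination (-(-1) ^ (i : ℕ) * g (s.1.orderEmbOfFin s.2 i) j *
        (g.submatrix ((s.1.orderEmbOfFin s.2) ∘ i.succAbove) (t.1.orderEmbOfFin t.2)).det) * this

/-- Exterior multiplication by `e_j`. -/
def create (N k : ℕ) : Matrix {s : Finset (Fin N) // s.card = k + 1}
    ({s : Finset (Fin N) // s.card = k} × Fin N) ℂ :=
  Matrix.of fun s x => if x.2 ∉ x.1.1 ∧ s.1 = insert x.2 x.1.1 then wedgeSign x.2 x.1.1 else 0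

/-- The action of a matrix on the exterior power, as the derivative of the minors. -/
noncomputable def rho (k : ℕ) (M : Matrix (Fin N) (Fin N) ℂ) :
    Matrix {s : Finset (Fin N) // s.card = k} {s : Finset (Fin N) // s.card = k} ℂ :=
  Matrix.of fun s t => (minor (1 + (Polynomial.X : Polynomial ℂ) • M.map Polynomial.C) s t).coeff 1

theorem sum_create_mul {k : ℕ} (s : {s : Finset (Fin N) // s.card = k + 1}) (j : Fin N)
    (f : {s : Finset (Fin N) // s.card = k} → ℂ) :
    ∑ u, create N k s (u, j) * f u =
      if h : j ∈ s.1 then wedgeSign j (s.1.erase j) * f (remove s j h) else 0 := by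
  simp only [create, Matrix.of_apply, ite_mul, zero_mul]
  split_ifs with h
  · rw [Finset.sum_eq_single (remove s j h)]
    · rw [if_pos]
      · rfl
      · simp [remove, Finset.insert_erase h]
    · intro u _ hu
      rw [if_neg]
      rintro ⟨h1, h2⟩
      exact hu (Subtype.ext (by simp [remove, h2, h1]))
    · simp
  · refine Finset.sum_eq_zero fun u _ => if_neg ?_
    rintro ⟨-, h2⟩
    exact h (by simp [h2])

theorem sum_mul_create {k : ℕ} (t : {s : Finset (Fin N) // s.card = k}) (j : Fin N)
    (f : {s : Finset (Fin N) // s.card = k + 1} → ℂ) :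
    ∑ u, f u * create N k u (t, j) =
      if h : j ∈ t.1 then 0 else wedgeSign j t.1 * f (adjoin t j h) := by
  simp only [create, Matrix.of_apply, mul_ite, mul_zero]
  split_ifs with h
  · simp [h]
  · rw [Finset.sum_eq_single (adjoin t j h)]
    · rw [if_pos ⟨h, rfl⟩, mul_comm]
    · intro u _ hu
      rw [if_neg]
      rintro ⟨-, h2⟩
      exact hu (Subtype.ext h2)
    · simp

theorem coeff_zero_minor {k : ℕ} (M : Matrix (Fin N) (Fin N) ℂ)
    (s t : {s : Finset (Fin N) // s.card = k}) :
    (minor (1 + (Polynomial.X : Polynomial ℂ) • M.map Polynomial.C) s t).coeff 0 =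
      if s = t then 1 else 0 := by
  rw [← Polynomial.constantCoeff_apply, minor, RingHom.map_det]
  have h : (Polynomial.constantCoeff (R := ℂ)).mapMatrix
      ((1 + (Polynomial.X : Polynomial ℂ) • M.map Polynomial.C).submatrix
        (s.1.orderEmbOfFin s.2) (t.1.orderEmbOfFin t.2)) =
      (1 : Matrix (Fin N) (Fin N) ℂ).submatrix (s.1.orderEmbOfFin s.2) (t.1.orderEmbOfFin t.2) := by
    ext i j
    simp only [RingHom.mapMatrix_apply, Matrix.map_apply, Matrix.submatrix_apply, Matrix.add_apply,
      Matrix.one_apply, Matrix.smul_apply]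
    split_ifs <;> simp
  rw [h]
  split_ifs with hst
  · subst hst
    rw [Matrix.submatrix_one _ (s.1.orderEmbOfFin s.2).injective, Matrix.det_one]
  · obtain ⟨x, hx, hxt⟩ : ∃ x ∈ s.1, x ∉ t.1 := by
      by_contra! hc
      exact hst (Subtype.ext (Finset.eq_of_subset_of_card_le hc (by rw [s.2, t.2])))
    rw [← Finset.mem_coe, ← Finset.range_orderEmbOfFin s.1 s.2] at hx
    obtain ⟨i, rfl⟩ := hx
    refine Matrix.det_eq_zero_of_row_eq_zero i fun q => ?_
    rw [Matrix.submatrix_apply, Matrix.one_apply_ne]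
    intro e
    exact hxt (e ▸ Finset.orderEmbOfFin_mem _ _ _)

theorem rho_mul_create (k : ℕ) (M : Matrix (Fin N) (Fin N) ℂ) :
    rho (k + 1) M * create N k = create N k * (rho k M ⊗ₖ 1 + 1 ⊗ₖ M) := by
  ext s ⟨t, j⟩
  rw [Matrix.mul_apply, sum_mul_create, Matrix.mul_apply, Fintype.sum_prod_type, Finset.sum_comm]
  refine Eq.trans ?_ (Finset.sum_congr rfl fun i _ => (sum_create_mul s i _).symm)
  have h := congrArg (Polynomial.coeff · 1)
    (sum_minor_remove (1 + (Polynomial.X : Polynomial ℂ) • M.map Polynomial.C) s t j)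
  have hsgn (i : Fin N) (u : Finset (Fin N)) (p : Polynomial ℂ) :
      (wedgeSign i u * p).coeff 1 = wedgeSign i u * p.coeff 1 := by
    have : (wedgeSign i u : Polynomial ℂ) = Polynomial.C (wedgeSign i u) := by simp [wedgeSign]
    rw [this, Polynomial.coeff_C_mul]
  simp only [Polynomial.finsetSum_coeff] at h
  calc _ = Polynomial.coeff (if h : j ∈ t.1 then 0 else wedgeSign j t.1 *
        minor (1 + (Polynomial.X : Polynomial ℂ) • M.map Polynomial.C) s (adjoin t j h)) 1 := by
        split_ifs with hj
        · simp
        · rw [hsgn]; rfl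
    _ = _ := by
        rw [← h]
        refine Finset.sum_congr rfl fun i _ => ?_
        split_ifs with hi
        · rw [hsgn]
          congr 1
          rw [Polynomial.coeff_mul, Finset.Nat.antidiagonal_succ]
          simp only [Matrix.one_apply, rho, Matrix.add_apply, Matrix.smul_apply,
            kroneckerMap_apply, Matrix.of_apply, Matrix.map_apply]
          rcases eq_or_ne i j with rfl | hij
          · simp [coeff_zero_minor, Polynomial.coeff_one]
          · simp [coeff_zero_minor, hij]
        · simp

theorem create_apply_remove {k : ℕ} (s s' : {s : Finset (Fin N) // s.card = k + 1}) (j : Fin N)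
    (h : j ∈ s.1) : create N k s' (remove s j h, j) =
      if s = s' then wedgeSign j (s.1.erase j) else 0 := by
  simp only [create, Matrix.of_apply, remove, Finset.notMem_erase, not_false_eq_true, true_and,
    Finset.insert_erase h, Subtype.ext_iff, eq_comm (a := s'.1)]

theorem create_mul_transpose (N k : ℕ) : create N k * (create N k)ᵀ = ((k : ℂ) + 1) • 1 := by
  ext s s'
  rw [Matrix.mul_apply, Fintype.sum_prod_type, Finset.sum_comm]
  simp only [Matrix.transpose_apply]
  refine (Finset.sum_congr rfl fun i _ => sum_create_mul s i _).trans ?_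
  simp only [create_apply_remove]
  rcases eq_or_ne s s' with rfl | h
  · simp only [if_true, wedgeSign_mul_self]
    rw [Matrix.smul_apply, Matrix.one_apply_eq]
    simp [s.2]
  · simp [h]

theorem transpose_mul_create_apply {k : ℕ} (t t' : {s : Finset (Fin N) // s.card = k})
    (i j : Fin N) : ((create N k)ᵀ * create N k) (t, i) (t', j) =
      if h : j ∈ t'.1 then 0 else wedgeSign j t'.1 * create N k (adjoin t' j h) (t, i) := by
  rw [Matrix.mul_apply, sum_mul_create]
  rfl

theorem transpose_mul_create_zero (N : ℕ) : (create N 0)ᵀ * create N 0 = 1 := by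
  ext ⟨t, i⟩ ⟨t', j⟩
  rw [transpose_mul_create_apply]
  have ht := Finset.card_eq_zero.mp t.2
  have ht' := Finset.card_eq_zero.mp t'.2
  have h : t = t' := Subtype.ext (ht.trans ht'.symm)
  subst h
  rw [dif_neg (by simp [ht])]
  rcases eq_or_ne i j with rfl | h
  · simp [create, adjoin, ht, wedgeSign]
  · simp [create, adjoin, ht, h, eq_comm]

theorem transpose_mul_create (k : ℕ) (t t' : {s : Finset (Fin N) // s.card = k + 1})
    (i j : Fin N) : ((create N (k + 1))ᵀ * create N (k + 1)) (t, i) (t', j) =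
    (1 : Matrix {s : Finset (Fin N) // s.card = k + 1} {s : Finset (Fin N) // s.card = k + 1} ℂ)
      t t' * (1 : Matrix (Fin N) (Fin N) ℂ) i j +
        (-1) * ∑ u, create N k t (u, j) * (create N k)ᵀ (u, i) t' := by
  rw [transpose_mul_create_apply]
  simp only [Matrix.transpose_apply]
  rw [sum_create_mul]
  rcases eq_or_ne i j with rfl | hij
  · rw [Matrix.one_apply_eq, mul_one]
    rcases eq_or_ne t t' with rfl | h
    · rw [Matrix.one_apply_eq]
      by_cases hi : i ∈ t.1
      · rw [dif_pos hi, dif_pos hi, create_apply_remove, if_pos rfl, wedgeSign_mul_self]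
        ring
      · rw [dif_neg hi, dif_neg hi]
        simp [create, adjoin, hi, wedgeSign_mul_self]
    · rw [Matrix.one_apply_ne h]
      have h1 : (if h : i ∈ t'.1 then (0 : ℂ) else
          wedgeSign i t'.1 * create N (k + 1) (adjoin t' i h) (t, i)) = 0 := by
        split_ifs with h1
        · rfl
        · rw [create, Matrix.of_apply, if_neg, mul_zero]
          rintro ⟨h2, h3⟩
          refine h (Subtype.ext ?_)
          simp only [adjoin] at h2 h3
          rw [← Finset.erase_insert h1, h3, Finset.erase_insert h2]
      rw [h1]
      split_ifs with h2
      · rw [create_apply_remove, if_neg h]; simp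
      · simp
  · rw [Matrix.one_apply_ne hij, mul_zero, zero_add]
    by_cases hu : ∃ u : Finset (Fin N), i ∉ u ∧ j ∉ u ∧ t.1 = insert j u ∧ t'.1 = insert i u
    · obtain ⟨u, hi, hj, h1, h2⟩ := hu
      rw [dif_neg (by simp [h2, hij.symm, hj]), dif_pos (by simp [h1])]
      simp only [create, Matrix.of_apply, adjoin, remove, h1, h2, Finset.erase_insert hj]
      rw [if_pos ⟨by simp [hij, hi], Finset.insert_comm _ _ _⟩, if_pos ⟨hi, trivial⟩,
        wedgeSign_insert hi, wedgeSign_insert hj]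
      rcases lt_or_gt_of_ne hij with h | h
      · rw [if_pos h, if_neg h.not_gt]; ring
      · rw [if_pos h, if_neg h.not_gt]; ring
    · have h1 : (if h : j ∈ t'.1 then (0 : ℂ) else
          wedgeSign j t'.1 * create N (k + 1) (adjoin t' j h) (t, i)) = 0 := by
        split_ifs with h1
        · rfl
        · rw [create, Matrix.of_apply, if_neg, mul_zero]
          rintro ⟨h2, h3⟩
          simp only [adjoin] at h2 h3
          have hj : j ∈ t.1 := by
            have : j ∈ insert i t.1 := by rw [← h3]; simp
            exact (Finset.mem_insert.mp this).resolve_left hij.symm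
          refine hu ⟨t.1.erase j, by simp [h2], by simp, (Finset.insert_erase hj).symm, ?_⟩
          rw [← Finset.erase_insert h1, h3, Finset.erase_insert_of_ne hij]
      have h2 : (if h : j ∈ t.1 then wedgeSign j (t.1.erase j) *
          create N k t' (remove t j h, i) else 0) = 0 := by
        split_ifs with h1
        · rw [create, Matrix.of_apply, if_neg, mul_zero]
          rintro ⟨h2, h3⟩
          exact hu ⟨t.1.erase j, h2, by simp, (Finset.insert_erase h1).symm, h3⟩
        · rfl
      rw [h1, h2, mul_zero]

end ExteriorPower

open ExteriorPower in
/-- The exterior powers, in the frame `e_{s_1} ∧ ⋯ ∧ e_{s_k}`; annihilation is the transpose of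
creation. -/
noncomputable def exteriorPowers (N : ℕ) : SecondQuantization N (-1) where
  idx k := {s : Finset (Fin N) // s.card = k}
  uniq := ⟨⟨⟨∅, rfl⟩⟩, fun s => Subtype.ext (Finset.card_eq_zero.mp s.2)⟩
  C := create N
  A k := (create N k)ᵀ
  rho := rho
  rho_zero M := by
    ext s t
    simp [ExteriorPower.rho, minor, Polynomial.coeff_one]
  C_mul_A := create_mul_transpose N
  rho_mul_C := rho_mul_create
  A_mul_C_zero := transpose_mul_create_zero N
  A_mul_C := transpose_mul_create

end Fermions

/-! ### Generating functions of characters -/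

section GeneratingFunction

open Matrix

theorem Derivation.exp_of_isNilpotent {R A : Type*} [CommRing R] [CommRing A] [Algebra R A]
    [Algebra ℚ A] (D : Derivation R A A) {a : A} (ha : IsNilpotent a) :
    D (IsNilpotent.exp a) = D a * IsNilpotent.exp a := by
  obtain ⟨k, hk⟩ := ha
  conv_lhs => rw [IsNilpotent.exp_eq_sum (k := k + 1) (pow_eq_zero_of_le (Nat.le_succ k) hk)]
  rw [IsNilpotent.exp_eq_sum hk, map_sum, Finset.sum_range_succ', Finset.mul_sum]
  simp only [pow_zero, Nat.factorial_zero, Nat.cast_one, inv_one, one_smul, map_one_eq_zero,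
    add_zero]
  refine Finset.sum_congr rfl fun i _ => ?_
  have h : D (((i + 1).factorial : ℚ)⁻¹ • a ^ (i + 1)) =
      ((i + 1).factorial : ℚ)⁻¹ • D (a ^ (i + 1)) := map_rat_smul D.toLinearMap _ _
  rw [h, Derivation.leibniz_pow, Nat.add_sub_cancel, Nat.factorial_succ, ← Nat.cast_smul_eq_nsmul ℚ,
    smul_smul, Nat.cast_mul, mul_inv, mul_comm, ← mul_assoc, mul_inv_cancel₀ (by positivity),
    one_mul, smul_eq_mul, mul_smul_comm, mul_comm]

theorem PowerSeries.coeff_pow_mem {R : Type*} [CommRing R] {I : Ideal R} {f : PowerSeries R}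
    (hf : ∀ j, f.coeff j ∈ I) (m j : ℕ) : (f ^ m).coeff j ∈ I ^ m := by
  induction m generalizing j with
  | zero => simp
  | succ m ih =>
    rw [pow_succ, pow_succ, PowerSeries.coeff_mul]
    exact Ideal.sum_mem _ fun k _ => Ideal.mul_mem_mul (ih _) (hf _)

theorem PowerSeries.pow_eq_zero_of_coeff_mem {R : Type*} [CommRing R] {I : Ideal R} {m : ℕ}
    (hI : I ^ m = ⊥) {f : PowerSeries R} (hf : ∀ j, f.coeff j ∈ I) : f ^ m = 0 := by
  ext j
  simpa [hI] using PowerSeries.coeff_pow_mem hf m j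

variable {R : Type*} [CommRing R] [Algebra ℚ R]

theorem eq_zero_of_natCast_add_one_mul {k : ℕ} {x : R} (h : ((k : R) + 1) * x = 0) : x = 0 := by
  have h1 : algebraMap ℚ R (1 / ((k : ℚ) + 1)) * ((k : R) + 1) = 1 := by
    have : ((k : R) + 1) = algebraMap ℚ R ((k : ℚ) + 1) := by simp
    rw [this, ← map_mul, one_div, inv_mul_cancel₀ (by positivity), map_one]
  rw [← one_mul x, ← h1, mul_assoc, h, mul_zero]

theorem PowerSeries.eq_of_derivative_eq_mul {P f g : PowerSeries R}
    (hf : PowerSeries.derivative R f = P * f) (hg : PowerSeries.derivative R g = P * g)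
    (h0 : f.constantCoeff = g.constantCoeff) : f = g := by
  rw [← sub_eq_zero]
  have h : PowerSeries.derivative R (f - g) = P * (f - g) := by rw [map_sub, hf, hg, mul_sub]
  ext k
  induction k using Nat.strong_induction_on with
  | _ k ih =>
  rcases k with _ | k
  · simp [h0]
  · have h1 := congrArg (PowerSeries.coeff k) h
    rw [PowerSeries.coeff_derivative, PowerSeries.coeff_mul, Finset.sum_eq_zero] at h1
    · rw [mul_comm] at h1
      simpa using eq_zero_of_natCast_add_one_mul h1
    · intro x hx
      rw [ih x.2 (by have := Finset.HasAntidiagonal.mem_antidiagonal.mp hx; omega), map_zero,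
        mul_zero]

/-- `tr (e^{jB}) - N`, when `B` is an `N × N` matrix with `B ^ m = 0`. -/
noncomputable def powerSum {N : ℕ} (m : ℕ) (B : Matrix (Fin N) (Fin N) R) (j : ℕ) : R :=
  ∑ i ∈ Finset.Ico 1 m, ((j : ℚ) ^ i / i.factorial) • trace (B ^ i)

theorem exp_pow_eq {A : Type*} [Ring A] [Module ℚ A] {a : A} (ha : IsNilpotent a) (j : ℕ) :
    IsNilpotent.exp a ^ j = IsNilpotent.exp (j • a) := by
  induction j with
  | zero => simp [IsNilpotent.exp_zero]
  | succ j ih =>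
    rw [pow_succ, ih, add_smul, one_smul, IsNilpotent.exp_add_of_commute _ (ha.smul j) ha]
    exact (Commute.refl a).smul_left j

theorem trace_exp_pow {N m : ℕ} {B : Matrix (Fin N) (Fin N) R} (hm : m ≠ 0) (hB : B ^ m = 0)
    (j : ℕ) : trace (IsNilpotent.exp B ^ j) = N + powerSum m B j := by
  rw [exp_pow_eq ⟨m, hB⟩, IsNilpotent.exp_eq_sum (k := m) (by rw [smul_pow, hB, smul_zero]),
    Finset.range_eq_Ico, ← Finset.insert_Ico_add_one_left_eq_Ico (Nat.pos_of_ne_zero hm),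
    Finset.sum_insert (by simp), trace_add]
  congr 1
  · simp
  · rw [trace_sum, powerSum]
    refine Finset.sum_congr rfl fun i _ => ?_
    rw [smul_pow, ← Nat.cast_smul_eq_nsmul ℚ, smul_smul, trace_smul]
    congr 1
    push_cast
    ring

theorem powerSum_mem {N m : ℕ} {I : Ideal R} {B : Matrix (Fin N) (Fin N) R}
    (hB : ∀ i j, B i j ∈ I) (j : ℕ) : powerSum m B j ∈ I := by
  refine Ideal.sum_mem _ fun i hi => ?_
  rw [Algebra.smul_def]
  refine I.mul_mem_left _ (Ideal.sum_mem _ fun a _ => ?_)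
  exact Ideal.pow_le_self (by have := Finset.mem_Ico.mp hi; omega) (Matrix.pow_apply_mem hB i a a)

namespace SecondQuantization

variable [Algebra ℂ R] {N : ℕ} {σ : ℂ} (F : SecondQuantization N σ)

/-- The logarithm of `(∑ tᵏ tr exp (rho k B)) / (∑ tᵏ dim)`. -/
noncomputable def logChar (_F : SecondQuantization N σ) (m : ℕ) (B : Matrix (Fin N) (Fin N) R) :
    PowerSeries R :=
  PowerSeries.mk fun j => if j = 0 then 0 else
    algebraMap ℂ R σ ^ (j - 1) * ((1 / (j : ℚ)) • powerSum m B j)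

theorem coeff_logChar_mem {m : ℕ} {I : Ideal R} {B : Matrix (Fin N) (Fin N) R}
    (hB : ∀ i j, B i j ∈ I) (j : ℕ) : (F.logChar m B).coeff j ∈ I := by
  rw [logChar, PowerSeries.coeff_mk]
  split_ifs
  · exact I.zero_mem
  · rw [Algebra.smul_def]
    exact I.mul_mem_left _ (I.mul_mem_left _ (powerSum_mem hB j))

theorem derivative_mk_trExp {m : ℕ} {I : Ideal R} (hI : I ^ m = ⊥) {B : Matrix (Fin N) (Fin N) R}
    (hB : ∀ i j, B i j ∈ I) :
    PowerSeries.derivative R (PowerSeries.mk fun k => F.trExp k B) =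
      PowerSeries.mk (fun j => algebraMap ℂ R σ ^ j * trace (IsNilpotent.exp B ^ (j + 1))) *
        PowerSeries.mk fun k => F.trExp k B := by
  ext k
  rw [PowerSeries.coeff_derivative, PowerSeries.coeff_mk, mul_comm, F.newton_trExp hI hB,
    PowerSeries.coeff_mul, Finset.Nat.sum_antidiagonal_eq_sum_range_succ_mk]
  simp

theorem trExp_matrix_zero (k : ℕ) :
    F.trExp k (0 : Matrix (Fin N) (Fin N) R) = Fintype.card (F.idx k) := by
  simp [trExp, rhoR, IsNilpotent.exp_zero]

/-- The generating function of the characters of the `S^k` or `Λ^k`. -/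
theorem mk_trExp {m : ℕ} (hm : m ≠ 0) {I : Ideal R} (hI : I ^ m = ⊥)
    {B : Matrix (Fin N) (Fin N) R} (hB : ∀ i j, B i j ∈ I) :
    (PowerSeries.mk fun k => F.trExp k B) =
      (PowerSeries.mk fun k => (Fintype.card (F.idx k) : R)) *
        IsNilpotent.exp (F.logChar m B) := by
  have hQ : IsNilpotent (F.logChar m B) :=
    ⟨m, PowerSeries.pow_eq_zero_of_coeff_mem hI (F.coeff_logChar_mem hB)⟩
  have hB0 : B ^ m = 0 := Matrix.pow_eq_zero_of_mem hI hB
  have h0 := F.derivative_mk_trExp hI (B := 0) (fun _ _ => I.zero_mem)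
  simp only [trExp_matrix_zero] at h0
  refine PowerSeries.eq_of_derivative_eq_mul (F.derivative_mk_trExp hI hB) ?_ ?_
  · have hd : PowerSeries.derivative R (F.logChar m B) =
        PowerSeries.mk (fun j => algebraMap ℂ R σ ^ j * trace (IsNilpotent.exp B ^ (j + 1))) -
        PowerSeries.mk (fun j => algebraMap ℂ R σ ^ j *
          trace (IsNilpotent.exp (0 : Matrix (Fin N) (Fin N) R) ^ (j + 1))) := by
      ext j
      rw [PowerSeries.coeff_derivative, map_sub, PowerSeries.coeff_mk, PowerSeries.coeff_mk,
        logChar, PowerSeries.coeff_mk, if_neg (Nat.succ_ne_zero j), trace_exp_pow hm hB0,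
        IsNilpotent.exp_zero, one_pow, trace_one, Fintype.card_fin, Nat.add_sub_cancel]
      have h1 : ((j : R) + 1) = algebraMap ℚ R ((j : ℚ) + 1) := by simp
      have h2 : algebraMap ℚ R (1 / ((j + 1 : ℕ) : ℚ)) * algebraMap ℚ R ((j : ℚ) + 1) = 1 := by
        rw [← map_mul, Nat.cast_add, Nat.cast_one, one_div, inv_mul_cancel₀ (by positivity), map_one]
      rw [h1, Algebra.smul_def]
      linear_combination (algebraMap ℂ R σ ^ j * powerSum m B (j + 1)) * h2
    rw [Derivation.leibniz, (PowerSeries.derivative R).exp_of_isNilpotent hQ, h0, hd]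
    simp only [smul_eq_mul]
    ring
  · have h1 := IsNilpotent.map_exp hQ (PowerSeries.constantCoeff (R := R))
    have h2 : PowerSeries.constantCoeff (F.logChar m B) = 0 := by
      rw [← PowerSeries.coeff_zero_eq_constantCoeff_apply, logChar, PowerSeries.coeff_mk, if_pos rfl]
    rw [h2, IsNilpotent.exp_zero] at h1
    rw [map_mul, h1, mul_one, ← PowerSeries.coeff_zero_eq_constantCoeff_apply,
      ← PowerSeries.coeff_zero_eq_constantCoeff_apply, PowerSeries.coeff_mk, PowerSeries.coeff_mk,
      trExp_zero]
    simp

end SecondQuantization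

end GeneratingFunction

/-! ### The commutative algebra of even forms -/

section EvenForms

open AnomalyCancellation

/-- The commutative algebra generated by the two-forms `dx^a ∧ dx^b`. -/
def evenForms (n : ℕ) : Subalgebra ℂ (Form n) :=
  Algebra.adjoin ℂ {w | ∃ a b : Fin n, w = dx a * dx b}

theorem dx_mul_dx_comm {n : ℕ} (a b : Fin n) : dx a * dx b = -(dx b * dx a) :=
  eq_neg_of_add_eq_zero_left (ExteriorAlgebra.ι_add_mul_swap _ _)

theorem dx_mul_dx_commute {n : ℕ} (a b c d : Fin n) :
    dx a * dx b * (dx c * dx d) = dx c * dx d * (dx a * dx b) := by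
  have h1 := dx_mul_dx_comm b c
  have h2 := dx_mul_dx_comm a c
  have h3 := dx_mul_dx_comm b d
  have h4 := dx_mul_dx_comm a d
  calc dx a * dx b * (dx c * dx d) = dx a * (dx b * dx c) * dx d := by noncomm_ring
    _ = -((dx a * dx c) * (dx b * dx d)) := by rw [h1]; noncomm_ring
    _ = -(dx c * (dx a * dx d) * dx b) := by rw [h2, h3]; noncomm_ring
    _ = _ := by rw [h4]; noncomm_ring

instance (n : ℕ) : IsMulCommutative (evenForms n) :=
  Algebra.isMulCommutative_adjoin ℂ (by
    rintro _ ⟨a, b, rfl⟩ _ ⟨c, d, rfl⟩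
    exact dx_mul_dx_commute a b c d)

instance (n : ℕ) : CommRing (evenForms n) :=
  { (inferInstance : Ring (evenForms n)) with
    mul_comm := fun x y => IsMulCommutative.is_comm.comm x y }

variable {n : ℕ}

/-- The two-form `dx^a ∧ dx^b`. -/
def dxdx (a b : Fin n) : evenForms n := ⟨dx a * dx b, Algebra.subset_adjoin ⟨a, b, rfl⟩⟩

/-- The ideal generated by the two-forms. -/
def evenIdeal (n : ℕ) : Ideal (evenForms n) := Ideal.span {w | ∃ a b : Fin n, w = dxdx a b}

theorem dx_mem (a : Fin n) : dx a ∈ ⋀[ℂ]^1 (Fin n → ℂ) := by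
  rw [ExteriorAlgebra.exteriorPower, pow_one]
  exact ⟨_, rfl⟩

theorem dxdx_mem (a b : Fin n) : (dxdx a b : Form n) ∈ ⋀[ℂ]^2 (Fin n → ℂ) :=
  SetLike.mul_mem_graded (dx_mem a) (dx_mem b)

theorem exteriorPower_eq_bot {j : ℕ} (hj : n < j) : ⋀[ℂ]^j (Fin n → ℂ) = ⊥ := by
  rw [← Submodule.finrank_eq_zero (R := ℂ), exteriorPower.finrank_eq, Module.finrank_fin_fun,
    Nat.choose_eq_zero_of_lt hj]

/-- The forms all of whose components have degree at least `k`. -/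
def formFiltration (n k : ℕ) : Submodule ℂ (Form n) := ⨆ j, ⋀[ℂ]^(k + j) (Fin n → ℂ)

theorem formFiltration_mul (k l : ℕ) :
    formFiltration n k * formFiltration n l ≤ formFiltration n (k + l) := by
  rw [formFiltration, formFiltration, Submodule.iSup_mul]
  refine iSup_le fun i => ?_
  rw [Submodule.mul_iSup]
  refine iSup_le fun j => ?_
  refine le_trans ?_ (le_iSup _ (i + j))
  rw [Submodule.mul_le]
  intro x hx y hy
  have := SetLike.mul_mem_graded hx hy
  rwa [show k + i + (l + j) = k + l + (i + j) by ring] at this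

theorem formFiltration_zero : formFiltration n 0 = ⊤ := by
  rw [formFiltration]
  simp only [zero_add]
  exact (DirectSum.Decomposition.isInternal
    (fun i : ℕ => ⋀[ℂ]^i (Fin n → ℂ))).submodule_iSup_eq_top

theorem formFiltration_eq_bot {k : ℕ} (hk : n < k) : formFiltration n k = ⊥ := by
  rw [formFiltration, iSup_eq_bot]
  exact fun j => exteriorPower_eq_bot (by omega)

theorem coe_mem_formFiltration {k : ℕ} {x : evenForms n} (hx : x ∈ evenIdeal n ^ k) :
    (x : Form n) ∈ formFiltration n k := by
  induction k generalizing x with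
  | zero => rw [formFiltration_zero]; trivial
  | succ k ih =>
    rw [pow_succ] at hx
    refine Submodule.mul_induction_on hx (fun y hy z hz => ?_) (fun y z hy hz => ?_)
    · have h1 : (z : Form n) ∈ formFiltration n 1 := by
        refine Submodule.span_induction (R := evenForms n)
          (s := {w | ∃ a b : Fin n, w = dxdx a b})
          (p := fun z _ => (z : Form n) ∈ formFiltration n 1) ?_ ?_ ?_ ?_ hz
        · rintro _ ⟨a, b, rfl⟩
          exact (le_iSup (fun j => ⋀[ℂ]^(1 + j) (Fin n → ℂ)) 1) (dxdx_mem a b)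
        · exact Submodule.zero_mem _
        · intro x y _ _ hx hy
          exact Submodule.add_mem _ hx hy
        · intro a x _ hx
          have ha : (a : Form n) ∈ formFiltration n 0 := by rw [formFiltration_zero]; trivial
          have := formFiltration_mul 0 1 (Submodule.mul_mem_mul ha hx)
          rwa [zero_add] at this
      exact formFiltration_mul k 1 (Submodule.mul_mem_mul (ih hy) h1)
    · exact Submodule.add_mem _ hy hz

/-- Products of more than `n` two-forms vanish, since their degree exceeds `n`. -/
theorem evenIdeal_pow_eq_bot (n : ℕ) : evenIdeal n ^ (n + 1) = ⊥ := by
  rw [eq_bot_iff]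
  intro x hx
  have := coe_mem_formFiltration hx
  rw [formFiltration_eq_bot (Nat.lt_succ_self n)] at this
  exact Subtype.ext this

/-- The even forms of degree `2 w`. -/
def evenDegree (n w : ℕ) : Submodule ℂ (evenForms n) :=
  (⋀[ℂ]^(2 * w) (Fin n → ℂ)).comap (evenForms n).val.toLinearMap

theorem mem_evenDegree {w : ℕ} {x : evenForms n} :
    x ∈ evenDegree n w ↔ (x : Form n) ∈ ⋀[ℂ]^(2 * w) (Fin n → ℂ) := Iff.rfl

theorem mul_mem_evenDegree {v w : ℕ} {x y : evenForms n} (hx : x ∈ evenDegree n v)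
    (hy : y ∈ evenDegree n w) : x * y ∈ evenDegree n (v + w) := by
  rw [mem_evenDegree] at *
  have := SetLike.mul_mem_graded hx hy
  rwa [← mul_add] at this

theorem one_mem_evenDegree : (1 : evenForms n) ∈ evenDegree n 0 :=
  SetLike.one_mem_graded (fun i : ℕ => ⋀[ℂ]^i (Fin n → ℂ))

theorem Matrix.pow_apply_mem_evenDegree {ι : Type*} [Fintype ι] [DecidableEq ι]
    {M : Matrix ι ι (evenForms n)} (hM : ∀ i j, M i j ∈ evenDegree n 1) (k : ℕ) (i j : ι) :
    (M ^ k) i j ∈ evenDegree n k := by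
  induction k generalizing i j with
  | zero =>
    rw [pow_zero, Matrix.one_apply]
    split_ifs
    · exact one_mem_evenDegree
    · exact Submodule.zero_mem _
  | succ k ih =>
    rw [pow_succ, Matrix.mul_apply]
    exact Submodule.sum_mem _ fun l _ => mul_mem_evenDegree (ih i l) (hM l j)

/-- The component of a given degree, as a linear map. -/
def degPartLin (j : ℤ) : Form n →ₗ[ℂ] Form n where
  toFun := degPart j
  map_add' x y := by
    simp only [degPart]
    split_ifs
    · exact map_add _ _ _
    · simp
  map_smul' c x := by
    simp only [degPart, RingHom.id_apply]
    split_ifs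
    · rw [GradedRing.proj_apply, GradedRing.proj_apply, DirectSum.decompose_smul]
      rfl
    · simp

theorem degPart_of_mem_of_ne {i : ℕ} {j : ℤ} {x : Form n} (hx : x ∈ ⋀[ℂ]^i (Fin n → ℂ))
    (h : (i : ℤ) ≠ j) : degPart j x = 0 := by
  rw [degPart]
  split_ifs with hj
  · rw [GradedRing.proj_apply]
    exact DirectSum.decompose_of_mem_ne (fun i : ℕ => ⋀[ℂ]^i (Fin n → ℂ)) hx (by omega)
  · rfl

theorem degPart_mul {i : ℕ} (j : ℤ) {x : Form n} (hx : x ∈ ⋀[ℂ]^i (Fin n → ℂ)) (y : Form n) :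
    degPart (i + j) (x * y) = x * degPart j y := by
  rw [degPart, degPart]
  split_ifs with h1 h2 h2
  · rw [GradedRing.proj_apply, GradedRing.proj_apply, show (i + j).toNat = i + j.toNat by omega]
    exact DirectSum.coe_decompose_mul_add_of_left_mem (fun i : ℕ => ⋀[ℂ]^i (Fin n → ℂ)) hx
  · rw [mul_zero, GradedRing.proj_apply]
    exact DirectSum.coe_decompose_mul_of_left_mem_of_not_le (fun i : ℕ => ⋀[ℂ]^i (Fin n → ℂ)) hx
      (by omega)
  · omega
  · rw [mul_zero]

end EvenForms

/-! ### Logarithms of `sinh z / z` and `cosh z` -/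

section PowerSeriesAtNilpotents

open AnomalyCancellation PowerSeries

section

variable {A : Type*} [Ring A] [Algebra ℂ A] {n : ℕ}

theorem psEval_sub (f g : PowerSeries ℂ) (y : A) :
    psEval n (f - g) y = psEval n f y - psEval n g y := by
  simp [psEval, sub_smul]

theorem psEval_smul (c : ℂ) (f : PowerSeries ℂ) (y : A) :
    psEval n (c • f) y = c • psEval n f y := by
  simp [psEval, Finset.smul_sum, mul_smul]

theorem psEval_sum {ι : Type*} (s : Finset ι) (f : ι → PowerSeries ℂ) (y : A) :
    psEval n (∑ i ∈ s, f i) y = ∑ i ∈ s, psEval n (f i) y := by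
  simp only [psEval, map_sum, Finset.sum_smul]
  exact Finset.sum_comm

theorem psEval_one (y : A) : psEval n 1 y = 1 := by
  simp [psEval, PowerSeries.coeff_one]

theorem psEval_congr {f g : PowerSeries ℂ} (h : ∀ i ≤ n, f.coeff i = g.coeff i) (y : A) :
    psEval n f y = psEval n g y :=
  Finset.sum_congr rfl fun i hi => by rw [h i (Nat.lt_succ_iff.mp (Finset.mem_range.mp hi))]

theorem psEval_mul {y : A} (hy : y ^ (n + 1) = 0) (f g : PowerSeries ℂ) :
    psEval n (f * g) y = psEval n f y * psEval n g y := by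
  have hz (i : ℕ) (hi : n + 1 ≤ i) : y ^ i = 0 := pow_eq_zero_of_le hi hy
  simp only [psEval, Finset.sum_mul_sum, smul_mul_smul_comm, ← pow_add]
  simp only [PowerSeries.coeff_mul, Finset.sum_smul]
  rw [Finset.sum_sigma', ← Finset.sum_product']
  refine Finset.sum_bij_ne_zero (fun x _ _ => x.2) ?_ ?_ ?_ ?_
  · rintro ⟨a, i, j⟩ h _
    simp only [Finset.mem_sigma, Finset.mem_range, Finset.HasAntidiagonal.mem_antidiagonal,
      Finset.mem_product] at h ⊢
    omega
  · rintro ⟨a, i, j⟩ h _ ⟨a', i', j'⟩ h' _ e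
    simp only [Finset.mem_sigma, Finset.HasAntidiagonal.mem_antidiagonal, Prod.mk.injEq] at h h' e
    obtain ⟨rfl, rfl⟩ := e
    obtain ⟨_, rfl⟩ := h
    obtain ⟨_, rfl⟩ := h'
    rfl
  · rintro ⟨i, j⟩ h hne
    have hij : i + j < n + 1 := by
      by_contra hc
      exact hne (by simp [hz (i + j) (by omega)])
    exact ⟨⟨i + j, i, j⟩, by simpa using hij, hne, rfl⟩
  · rintro ⟨a, i, j⟩ h _
    simp only [Finset.mem_sigma, Finset.HasAntidiagonal.mem_antidiagonal] at h
    rw [h.2]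

theorem psEval_pow {y : A} (hy : y ^ (n + 1) = 0) (f : PowerSeries ℂ) (k : ℕ) :
    psEval n (f ^ k) y = psEval n f y ^ k := by
  induction k with
  | zero => simp [psEval_one]
  | succ k ih => rw [pow_succ, psEval_mul hy, ih, pow_succ]

theorem psEval_exp [Module ℚ A] {y : A} (hy : y ^ (n + 1) = 0) :
    psEval n (PowerSeries.exp ℂ) y = IsNilpotent.exp y := by
  rw [IsNilpotent.exp_eq_sum hy]
  refine Finset.sum_congr rfl fun i _ => ?_
  rw [PowerSeries.coeff_exp, ← Rat.cast_smul_eq_qsmul ℂ]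
  simp

theorem map_psEval {A' : Type*} [Ring A'] [Algebra ℂ A'] (φ : A →ₐ[ℂ] A') (f : PowerSeries ℂ)
    (y : A) : φ (psEval n f y) = psEval n f (φ y) := by
  simp [psEval]

/-- If `L` is the logarithm of `f`, in the sense that `f L' = f'`, then the truncated logarithm of
`f(y)` is `L(y)`. -/
theorem psEval_log {y : A} (hy : y ^ (n + 1) = 0) {f L : PowerSeries ℂ}
    (hf : f.constantCoeff = 1) (hL : L.constantCoeff = 0)
    (h : f * derivative ℂ L = derivative ℂ f) :
    psEval n (PowerSeries.log ℂ) (psEval n f y - 1) = psEval n L y := by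
  set G : PowerSeries ℂ := ∑ k ∈ Finset.range (n + 1), (PowerSeries.log ℂ).coeff k • (f - 1) ^ k
    with hG
  have h1 : psEval n (PowerSeries.log ℂ) (psEval n f y - 1) = psEval n G y := by
    rw [hG, psEval_sum, psEval]
    refine Finset.sum_congr rfl fun k _ => ?_
    rw [psEval_smul, psEval_pow hy, psEval_sub, psEval_one]
  have hX : (X : PowerSeries ℂ) ∣ f - 1 := by
    rw [X_dvd_iff]; simp [hf]
  have hG0 : G.constantCoeff = 0 := by
    rw [hG, ← PowerSeries.coeff_zero_eq_constantCoeff_apply, map_sum]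
    refine Finset.sum_eq_zero fun k _ => ?_
    rcases k with _ | k
    · simp [PowerSeries.coeff_log]
    · rw [PowerSeries.coeff_smul,
        PowerSeries.coeff_zero_eq_constantCoeff_apply, map_pow]
      simp [hf]
  have hG' : f * derivative ℂ G = derivative ℂ f * (1 - (1 - f) ^ n) := by
    have h2 : derivative ℂ G = ∑ k ∈ Finset.range n, (1 - f) ^ k * derivative ℂ f := by
      rw [hG, map_sum, Finset.sum_range_succ']
      rw [pow_zero, Derivation.map_smul, Derivation.map_one_eq_zero, smul_zero, add_zero]
      refine Finset.sum_congr rfl fun k _ => ?_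
      rw [Derivation.map_smul, Derivation.leibniz_pow, map_sub, Derivation.map_one_eq_zero, sub_zero, Nat.add_sub_cancel,
        PowerSeries.coeff_log, if_neg (Nat.succ_ne_zero k), ← Nat.cast_smul_eq_nsmul ℂ, smul_smul]
      have : (algebraMap ℚ ℂ ((-1) ^ (k + 1 + 1) / ((k + 1 : ℕ) : ℚ))) * ((k + 1 : ℕ) : ℂ) =
          (-1) ^ k := by
        have h0 : ((k + 1 : ℕ) : ℂ) ≠ 0 := by exact_mod_cast Nat.succ_ne_zero k
        simp only [map_div₀, map_pow, map_neg, map_one, map_natCast]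
        rw [div_mul_cancel₀ _ h0]
        ring
      rw [this, show (1 - f) = (-1 : ℂ) • (f - 1) by simp, smul_pow, smul_eq_mul, smul_mul_assoc]
    rw [h2, ← Finset.sum_mul]
    have h3 := mul_neg_geom_sum (1 - f) n
    rw [sub_sub_cancel] at h3
    rw [← mul_assoc, h3, mul_comm]
  have hdvd : (X : PowerSeries ℂ) ^ n ∣ derivative ℂ G - derivative ℂ L := by
    have hu : IsUnit f := by
      rw [PowerSeries.isUnit_iff_constantCoeff, hf]; exact isUnit_one
    rw [← hu.dvd_mul_left, mul_sub, hG', h]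
    have : derivative ℂ f * (1 - (1 - f) ^ n) - derivative ℂ f =
      - (derivative ℂ f) * (1 - f) ^ n := by ring
    rw [this]
    refine Dvd.dvd.mul_left (pow_dvd_pow_of_dvd ?_ n) _
    rw [← neg_sub]
    exact (dvd_neg).mpr hX
  rw [h1]
  refine psEval_congr (fun i hi => ?_) y
  rcases i with _ | i
  · simp [hG0, hL]
  · have h4 := (PowerSeries.X_pow_dvd_iff.mp hdvd) i (by omega)
    rw [map_sub, coeff_derivative, coeff_derivative, ← sub_mul] at h4
    have h0 : ((i : ℂ) + 1) ≠ 0 := Nat.cast_add_one_ne_zero i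
    exact sub_eq_zero.mp ((mul_eq_zero.mp h4).resolve_right h0)

end

/-- `sinh z / z`. -/
noncomputable def sinhcSeries : PowerSeries ℂ :=
  PowerSeries.mk fun k => if Even k then 1 / ((k + 1).factorial : ℂ) else 0

/-- `cosh z`. -/
noncomputable def coshSeries : PowerSeries ℂ :=
  PowerSeries.mk fun k => if Even k then 1 / (k.factorial : ℂ) else 0

/-- `z coth z = z + ∑ B_k (2 z)ᵏ / k!`. -/
noncomputable def zCothSeries : PowerSeries ℂ :=
  X + rescale 2 (bernoulliPowerSeries ℂ)

theorem powerSeries_two_ne_zero : (2 : PowerSeries ℂ) ≠ 0 := fun h => by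
  have := congrArg (constantCoeff (R := ℂ)) h
  rw [map_ofNat, map_zero] at this
  exact two_ne_zero this

theorem two_mul_X_mul_sinhcSeries :
    2 * (X * sinhcSeries) = PowerSeries.exp ℂ - evalNegHom (PowerSeries.exp ℂ) := by
  ext k
  rw [show (2 : PowerSeries ℂ) = C 2 from (map_ofNat C 2).symm, coeff_C_mul, map_sub, evalNegHom,
    coeff_rescale, coeff_exp]
  rcases k with _ | k
  · simp
  · rw [coeff_succ_X_mul, sinhcSeries, coeff_mk]
    rcases Nat.even_or_odd k with h | h
    · rw [if_pos h, (h.add_one).neg_one_pow]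
      push_cast; simp; ring
    · rw [if_neg (Nat.not_even_iff_odd.mpr h), (h.add_one).neg_one_pow]
      simp

theorem two_mul_coshSeries :
    2 * coshSeries = PowerSeries.exp ℂ + evalNegHom (PowerSeries.exp ℂ) := by
  ext k
  rw [show (2 : PowerSeries ℂ) = C 2 from (map_ofNat C 2).symm, coeff_C_mul, map_add, evalNegHom,
    coeff_rescale, coeff_exp, coshSeries, coeff_mk]
  rcases Nat.even_or_odd k with h | h
  · rw [if_pos h, h.neg_one_pow]
    simp; ring
  · rw [if_neg (Nat.not_even_iff_odd.mpr h), h.neg_one_pow]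
    simp

/-- The identity `sinh z · z coth z = z cosh z`, in terms of exponentials. -/
theorem exp_sub_mul_zCothSeries :
    (PowerSeries.exp ℂ - evalNegHom (PowerSeries.exp ℂ)) * zCothSeries =
      X * (PowerSeries.exp ℂ + evalNegHom (PowerSeries.exp ℂ)) := by
  have h1 := congrArg (rescale (2 : ℂ)) (bernoulliPowerSeries_mul_exp_sub_one ℂ)
  have h2 := exp_pow_eq_rescale_exp (A := ℂ) 2
  have h3 := exp_mul_exp_neg_eq_one (A := ℂ)
  rw [map_mul, map_sub, map_one, ← Nat.cast_ofNat (R := ℂ) (n := 2), ← h2, rescale_X,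
    Nat.cast_ofNat, show (C (2 : ℂ)) = 2 from map_ofNat C 2] at h1
  rw [zCothSeries]
  linear_combination (evalNegHom (PowerSeries.exp ℂ)) * h1 -
    PowerSeries.exp ℂ * rescale (2 : ℂ) (bernoulliPowerSeries ℂ) * h3

theorem derivative_rescale (c : ℂ) (f : PowerSeries ℂ) :
    derivative ℂ (rescale c f) = C c * rescale c (derivative ℂ f) := by
  ext k
  simp only [coeff_derivative, coeff_rescale, coeff_C_mul, pow_succ]
  ring

theorem X_mul_derivative_sinhcSeries :
    X * derivative ℂ sinhcSeries = sinhcSeries * (zCothSeries - 1) := by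
  have h1 := two_mul_X_mul_sinhcSeries
  have h2 := congrArg (derivative ℂ) h1
  rw [map_sub, evalNegHom, derivative_rescale, PowerSeries.derivative_exp, ← evalNegHom,
    show (2 : PowerSeries ℂ) = C 2 from (map_ofNat C 2).symm, Derivation.leibniz, derivative_C,
    Derivation.leibniz, derivative_X, show (C (2 : ℂ)) = 2 from map_ofNat C 2, map_neg, map_one] at h2
  have h3 := exp_sub_mul_zCothSeries
  simp only [smul_eq_mul] at h2
  have hX : (2 * X : PowerSeries ℂ) ≠ 0 := mul_ne_zero powerSeries_two_ne_zero X_ne_zero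
  refine mul_left_cancel₀ hX ?_
  linear_combination X * h2 - h3 - zCothSeries * h1

theorem rescale_two_sinhcSeries :
    rescale 2 sinhcSeries = sinhcSeries * coshSeries := by
  have h1 := two_mul_X_mul_sinhcSeries
  have h2 := two_mul_coshSeries
  have h3 := congrArg (rescale (2 : ℂ)) h1
  have h4 : rescale (2 : ℂ) (evalNegHom (PowerSeries.exp ℂ)) =
      evalNegHom (PowerSeries.exp ℂ) ^ 2 := by
    rw [← map_pow, exp_pow_eq_rescale_exp, evalNegHom, rescale_rescale, rescale_rescale]
    norm_num
  have h5 := exp_pow_eq_rescale_exp (A := ℂ) 2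
  rw [Nat.cast_ofNat] at h5
  rw [map_mul, map_mul, map_sub, rescale_X, h4, ← h5, show (C (2 : ℂ)) = 2 from map_ofNat C 2,
    map_ofNat] at h3
  have hX : (2 * (2 * X) : PowerSeries ℂ) ≠ 0 :=
    mul_ne_zero powerSeries_two_ne_zero (mul_ne_zero powerSeries_two_ne_zero X_ne_zero)
  refine mul_left_cancel₀ hX ?_
  linear_combination h3 - 2 * coshSeries * h1 - (PowerSeries.exp ℂ - evalNegHom (PowerSeries.exp ℂ)) * h2

theorem constantCoeff_sinhcSeries : sinhcSeries.constantCoeff = 1 := by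
  rw [← coeff_zero_eq_constantCoeff_apply, sinhcSeries, coeff_mk]; simp

theorem constantCoeff_coshSeries : coshSeries.constantCoeff = 1 := by
  rw [← coeff_zero_eq_constantCoeff_apply, coshSeries, coeff_mk]; simp

theorem X_mul_derivative_coshSeries :
    X * derivative ℂ coshSeries = coshSeries * (rescale 2 zCothSeries - zCothSeries) := by
  have h1 := X_mul_derivative_sinhcSeries
  have h2 := congrArg (rescale (2 : ℂ)) h1
  have h3 := rescale_two_sinhcSeries
  have h4 := congrArg (derivative ℂ) h3
  rw [derivative_rescale, Derivation.leibniz] at h4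
  rw [map_mul, map_mul, map_sub, map_one, rescale_X, h3] at h2
  simp only [smul_eq_mul] at h4
  have hs : sinhcSeries ≠ 0 := fun h => by
    have := constantCoeff_sinhcSeries
    rw [h] at this; simp at this
  refine mul_left_cancel₀ hs ?_
  linear_combination h2 - X * h4 - coshSeries * h1

/-- `log (sinh z / z)`. -/
noncomputable def logSinhc : PowerSeries ℂ :=
  PowerSeries.mk fun k => if k = 0 then 0 else zCothSeries.coeff k / k

/-- `log (cosh z)`. -/
noncomputable def logCosh : PowerSeries ℂ :=
  PowerSeries.mk fun k => (2 ^ k - 1) * logSinhc.coeff k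

theorem constantCoeff_zCothSeries : zCothSeries.constantCoeff = 1 := by
  rw [← coeff_zero_eq_constantCoeff_apply, zCothSeries, map_add, coeff_rescale]
  simp [bernoulliPowerSeries]

theorem X_mul_derivative_logSinhc : X * derivative ℂ logSinhc = zCothSeries - 1 := by
  ext k
  rcases k with _ | k
  · simp [constantCoeff_zCothSeries]
  · have : ((k : ℂ) + 1) ≠ 0 := Nat.cast_add_one_ne_zero k
    rw [coeff_succ_X_mul, coeff_derivative, logSinhc, coeff_mk, if_neg (Nat.succ_ne_zero k),
      map_sub, coeff_one, if_neg (Nat.succ_ne_zero k)]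
    push_cast
    field_simp
    ring

theorem X_mul_derivative_logCosh :
    X * derivative ℂ logCosh = rescale 2 zCothSeries - zCothSeries := by
  have h1 := X_mul_derivative_logSinhc
  have h2 := congrArg (rescale (2 : ℂ)) h1
  have h3 : rescale 2 zCothSeries - zCothSeries =
      rescale 2 (X * derivative ℂ logSinhc) - X * derivative ℂ logSinhc := by
    rw [h1, map_sub, map_one]; ring
  rw [h3]
  ext k
  rw [map_sub, coeff_rescale]
  rcases k with _ | k
  · simp
  · simp only [coeff_succ_X_mul, coeff_derivative, logCosh, coeff_mk]
    ring

theorem mul_derivative_eq_of_X_mul {f L K : PowerSeries ℂ} (hf : X * derivative ℂ f = f * K)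
    (hL : X * derivative ℂ L = K) : f * derivative ℂ L = derivative ℂ f := by
  refine mul_left_cancel₀ (X_ne_zero (R := ℂ)) ?_
  rw [hf, ← hL]; ring

theorem coshSeries_mul_derivative_logCosh :
    coshSeries * derivative ℂ logCosh = derivative ℂ coshSeries :=
  mul_derivative_eq_of_X_mul X_mul_derivative_coshSeries X_mul_derivative_logCosh

theorem inv_sinhcSeries_mul_derivative_neg_logSinhc :
    sinhcSeries⁻¹ * derivative ℂ (-logSinhc) = derivative ℂ sinhcSeries⁻¹ := by
  have h := mul_derivative_eq_of_X_mul X_mul_derivative_sinhcSeries X_mul_derivative_logSinhc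
  have h1 : sinhcSeries * sinhcSeries⁻¹ = 1 :=
    PowerSeries.mul_inv_cancel _ (by rw [constantCoeff_sinhcSeries]; exact one_ne_zero)
  rw [derivative_inv', map_neg, ← h]
  linear_combination (sinhcSeries⁻¹ * derivative ℂ logSinhc) * h1

theorem coeff_logSinhc {k : ℕ} (hk : 2 ≤ k) :
    logSinhc.coeff k = 2 ^ k * (bernoulli k : ℂ) / (k * k.factorial) := by
  rw [logSinhc, coeff_mk, if_neg (by omega), zCothSeries, map_add, coeff_X, if_neg (by omega),
    coeff_rescale, bernoulliPowerSeries, coeff_mk]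
  push_cast
  rw [zero_add, mul_div_assoc', div_div, mul_comm (k : ℂ)]
  simp

end PowerSeriesAtNilpotents

/-! ### Curvature and compatible bilinear forms in coordinates -/

section FlatCurvature

open AnomalyCancellation Filter Topology

variable {n : ℕ} {ι : Type*}

/-- The entrywise partial derivative `∂_a M` of a matrix of functions. -/
noncomputable def partialMatrix (M : Coord n → Matrix ι ι ℂ) (p : Coord n) (a : Fin n) :
    Matrix ι ι ℂ :=
  Matrix.of fun i j => fderiv ℝ (fun y => M y i j) p (EuclideanSpace.single a 1)

/-- Entrywise differentiability of a matrix of functions. -/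
def MatrixDifferentiableAt (M : Coord n → Matrix ι ι ℂ) (p : Coord n) : Prop :=
  ∀ i j, DifferentiableAt ℝ (fun y => M y i j) p

theorem partialMatrix_transpose (M : Coord n → Matrix ι ι ℂ) (p : Coord n) (a : Fin n) :
    partialMatrix (fun y => (M y)ᵀ) p a = (partialMatrix M p a)ᵀ := rfl

theorem MatrixDifferentiableAt.transpose {M : Coord n → Matrix ι ι ℂ} {p : Coord n}
    (hM : MatrixDifferentiableAt M p) : MatrixDifferentiableAt (fun y => (M y)ᵀ) p :=
  fun i j => hM j i

theorem partialMatrix_add {M M' : Coord n → Matrix ι ι ℂ} {p : Coord n}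
    (hM : MatrixDifferentiableAt M p) (hM' : MatrixDifferentiableAt M' p) (a : Fin n) :
    partialMatrix (fun y => M y + M' y) p a = partialMatrix M p a + partialMatrix M' p a := by
  ext i j
  simp only [partialMatrix, Matrix.of_apply, Matrix.add_apply]
  rw [fderiv_fun_add (hM i j) (hM' i j)]
  rfl

theorem partialMatrix_congr {M M' : Coord n → Matrix ι ι ℂ} {p : Coord n}
    (h : ∀ᶠ y in 𝓝 p, M y = M' y) (a : Fin n) : partialMatrix M p a = partialMatrix M' p a := by
  ext i j
  simp only [partialMatrix, Matrix.of_apply]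
  rw [Filter.EventuallyEq.fderiv_eq (h.mono fun y hy => by rw [hy])]

variable [Fintype ι]

theorem MatrixDifferentiableAt.mul {M M' : Coord n → Matrix ι ι ℂ} {p : Coord n}
    (hM : MatrixDifferentiableAt M p) (hM' : MatrixDifferentiableAt M' p) :
    MatrixDifferentiableAt (fun y => M y * M' y) p := fun i j => by
  simp only [Matrix.mul_apply]
  exact DifferentiableAt.fun_sum fun k _ => (hM i k).mul (hM' k j)

theorem partialMatrix_mul {M M' : Coord n → Matrix ι ι ℂ} {p : Coord n}
    (hM : MatrixDifferentiableAt M p) (hM' : MatrixDifferentiableAt M' p) (a : Fin n) :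
    partialMatrix (fun y => M y * M' y) p a =
      partialMatrix M p a * M' p + M p * partialMatrix M' p a := by
  ext i j
  simp only [partialMatrix, Matrix.of_apply, Matrix.add_apply, Matrix.mul_apply]
  rw [fderiv_fun_sum fun k _ => (hM i k).fun_mul (hM' k j), ← Finset.sum_add_distrib,
    sum_apply]
  refine Finset.sum_congr rfl fun k _ => ?_
  rw [fderiv_fun_mul (hM i k) (hM' k j)]
  simp only [add_apply, smul_apply, smul_eq_mul]
  ring

/-- The coefficient of `dx^a ∧ dx^b` in the curvature of the connection with matrices `A`. -/
noncomputable def curvatureCoeff (A : Fin n → Coord n → Matrix ι ι ℂ) (p : Coord n)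
    (a b : Fin n) : Matrix ι ι ℂ :=
  partialMatrix (A b) p a - partialMatrix (A a) p b + (A a p * A b p - A b p * A a p)

omit [Fintype ι] in
theorem partialMatrix_partialMatrix_comm {G : Coord n → Matrix ι ι ℂ} {p : Coord n}
    (hG : ∀ i j, ContDiffAt ℝ 2 (fun y => G y i j) p) (a b : Fin n) :
    partialMatrix (fun q => partialMatrix G q a) p b =
      partialMatrix (fun q => partialMatrix G q b) p a := by
  ext i j
  have h := (hG i j).isSymmSndFDerivAt (by simp)
  have hd : DifferentiableAt ℝ (fderiv ℝ fun y => G y i j) p :=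
    ((hG i j).fderiv_right (m := 1) (by norm_num)).differentiableAt one_ne_zero
  have key (c d : Fin n) : partialMatrix (fun q => partialMatrix G q c) p d i j =
      fderiv ℝ (fderiv ℝ fun y => G y i j) p (EuclideanSpace.single d 1)
        (EuclideanSpace.single c 1) := by
    simp only [partialMatrix, Matrix.of_apply]
    rw [fderiv_clm_apply hd (differentiableAt_const _)]
    simp
  rw [key, key]
  exact h _ _

/-- The curvature of a connection compatible with a bilinear form `G` is skew for `G`: the second
derivatives of `G`, computed from `∂_a G = A_aᵀ G + G A_a`, are symmetric. -/
theorem curvatureCoeff_skew {A : Fin n → Coord n → Matrix ι ι ℂ} {G : Coord n → Matrix ι ι ℂ}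
    {p : Coord n} (hA : ∀ a, MatrixDifferentiableAt (A a) p)
    (hG : ∀ i j, ContDiffAt ℝ 2 (fun y => G y i j) p)
    (h : ∀ᶠ q in 𝓝 p, ∀ a, partialMatrix G q a = (A a q)ᵀ * G q + G q * A a q) (a b : Fin n) :
    (curvatureCoeff A p a b)ᵀ * G p + G p * curvatureCoeff A p a b = 0 := by
  have hGd : MatrixDifferentiableAt G p := fun i j => (hG i j).differentiableAt two_ne_zero
  have h0 := h.self_of_nhds
  have key (c d : Fin n) : partialMatrix (fun q => partialMatrix G q c) p d =
      (partialMatrix (A c) p d)ᵀ * G p + (A c p)ᵀ * ((A d p)ᵀ * G p + G p * A d p) +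
      (((A d p)ᵀ * G p + G p * A d p) * A c p + G p * partialMatrix (A c) p d) := by
    rw [partialMatrix_congr (h.mono fun q hq => hq c),
      partialMatrix_add ((hA c).transpose.mul hGd) (hGd.mul (hA c)),
      partialMatrix_mul (hA c).transpose hGd, partialMatrix_mul hGd (hA c), h0 d,
      partialMatrix_transpose]
  have hs := partialMatrix_partialMatrix_comm hG a b
  rw [key, key, ← sub_eq_zero] at hs
  simp only [curvatureCoeff, Matrix.transpose_add, Matrix.transpose_sub, Matrix.transpose_mul]
  rw [← neg_eq_zero, ← hs]
  noncomm_ring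

end FlatCurvature

/-! ### Connections in a chart -/

section ChartGeometry

open AnomalyCancellation Filter Topology

variable {n N : ℕ} {X : Type*} [TopologicalSpace X] [ChartedSpace (Coord n) X]
  [IsManifold (𝓡 n) ∞ X] {V : X → Type*} [TopologicalSpace (TotalSpace (Coord N) V)]

section Smooth

variable [∀ x, AddCommGroup (V x)] [∀ x, Module ℝ (V x)] [∀ x, TopologicalSpace (V x)]
  [FiberBundle (Coord N) V] [VectorBundle ℝ (Coord N) V]
  [ContMDiffVectorBundle ∞ (Coord N) V (𝓡 n)]
  [∀ x, IsTopologicalAddGroup (V x)] [∀ x, ContinuousSMul ℝ (V x)]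

/-- The frame of `V` in the trivialisation at `x₀`. -/
noncomputable def frameAt (N : ℕ) {X : Type*} [TopologicalSpace X] (V : X → Type*)
    [TopologicalSpace (TotalSpace (Coord N) V)]
    [∀ x, AddCommGroup (V x)] [∀ x, Module ℝ (V x)] [∀ x, TopologicalSpace (V x)]
    [FiberBundle (Coord N) V] [VectorBundle ℝ (Coord N) V] (x₀ : X) (i : Fin N) (x : X) : V x :=
  (trivializationAt (Coord N) V x₀).localFrame (EuclideanSpace.basisFun (Fin N) ℝ).toBasis i x

omit [IsManifold (𝓡 n) ∞ X] [∀ (x : X), IsTopologicalAddGroup (V x)] [∀ (x : X), ContinuousSMul ℝ (V x)] in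
theorem contMDiffAt_frameAt {x₀ x : X}
    (hx : x ∈ (trivializationAt (Coord N) V x₀).baseSet) (i : Fin N) :
    ContMDiffAt (𝓡 n) ((𝓡 n).prod 𝓘(ℝ, Coord N)) ∞
      (fun y => TotalSpace.mk' (Coord N) y (frameAt N V x₀ i y)) x :=
  contMDiffAt_localFrame_of_mem _ _ _ i hx

/-- The covariant derivative of a frame section along a coordinate vector field is smooth. -/
theorem contMDiffAt_cov_frameAt [T2Space X] (cov : CovariantDerivative (𝓡 n) (Coord N) V)
    [CovariantDerivative.ContMDiffCovariantDerivative cov ∞] (x₀ : X) (a : Fin n) (j : Fin N) :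
    ContMDiffAt (𝓡 n) ((𝓡 n).prod 𝓘(ℝ, Coord N)) ∞
      (fun y => TotalSpace.mk' (Coord N) y (cov (frameAt N V x₀ j) y
        (frameAt n (fun x : X => TangentSpace (𝓡 n) x) x₀ a y))) x₀ := by
  have hmem := FiberBundle.mem_baseSet_trivializationAt (Coord N) V x₀
  have hopen := (trivializationAt (Coord N) V x₀).open_baseSet
  -- A cut-off function extends the frame section to a global one with the same germ at `x₀`.
  obtain ⟨ψ, -, hψ⟩ := (SmoothBumpFunction.nhds_basis_tsupport (I := 𝓡 n) x₀).mem_iff.mp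
    (hopen.mem_nhds hmem)
  have hσ : ContMDiff (𝓡 n) ((𝓡 n).prod 𝓘(ℝ, Coord N)) ∞
      (fun y => TotalSpace.mk' (Coord N) y (((ψ : X → ℝ) • frameAt N V x₀ j) y)) :=
    ContMDiffOn.smul_section_of_tsupport ψ.contMDiff.contMDiffOn hopen hψ
      fun x hx => (contMDiffAt_frameAt hx j).contMDiffWithinAt
  have h1 := (CovariantDerivative.ContMDiffCovariantDerivative.contMDiff (cov := cov)
    (k := ∞)).contMDiff (σ := (ψ : X → ℝ) • frameAt N V x₀ j) (by
      rw [show ((∞ : ℕ∞ω) + 1) = ∞ from rfl]; exact hσ.contMDiffOn)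
  have h2 := (h1.contMDiffAt Filter.univ_mem).clm_bundle_apply
    (contMDiffAt_frameAt (V := fun x : X => TangentSpace (𝓡 n) x)
      (FiberBundle.mem_baseSet_trivializationAt (Coord n) (fun x : X => TangentSpace (𝓡 n) x) x₀) a)
  refine h2.congr_of_eventuallyEq ?_
  filter_upwards [ψ.eventuallyEq_one.eventuallyEq_nhds, hopen.mem_nhds hmem] with y hy hyB
  have : cov (frameAt N V x₀ j) y = cov ((ψ : X → ℝ) • frameAt N V x₀ j) y :=
    cov.isCovariantDerivativeOnUniv.congr_of_eventuallyEq
      ((contMDiffAt_frameAt hyB j).mdifferentiableAt (by simp))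
      (hσ.contMDiffAt.mdifferentiableAt (by simp)) Filter.univ_mem
      (hy.mono fun z hz => by simp [hz])
  rw [this]

theorem matrixDifferentiableAt_connForm [T2Space X] (cov : CovariantDerivative (𝓡 n) (Coord N) V)
    [CovariantDerivative.ContMDiffCovariantDerivative cov ∞] (x₀ : X) (a : Fin n) :
    MatrixDifferentiableAt (connForm cov x₀ a) (extChartAt (𝓡 n) x₀ x₀) := by
  intro i j
  have h1 := contMDiffAt_localFrameCoeff (I := 𝓡 n) (k := ∞) (EuclideanSpace.basisFun (Fin N) ℝ).toBasis
    (FiberBundle.mem_baseSet_trivializationAt (Coord N) V x₀)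
    (contMDiffAt_cov_frameAt cov x₀ a j) i
  have h2 : ContMDiffAt 𝓘(ℝ, Coord n) (𝓡 n) ∞ (extChartAt (𝓡 n) x₀).symm (extChartAt (𝓡 n) x₀ x₀) :=
    (contMDiffOn_extChartAt_symm x₀).contMDiffAt (extChartAt_target_mem_nhds x₀)
  have h3 := (h1.comp_of_eq h2 (extChartAt_to_inv x₀)).contDiffAt
  exact Complex.ofRealCLM.differentiableAt.comp _ (h3.differentiableAt (by simp))

end Smooth

section Metric

variable [∀ x, NormedAddCommGroup (V x)] [∀ x, InnerProductSpace ℝ (V x)]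
  [FiberBundle (Coord N) V] [VectorBundle ℝ (Coord N) V]
  [ContMDiffVectorBundle ∞ (Coord N) V (𝓡 n)]
  [IsContMDiffRiemannianBundle (𝓡 n) ∞ (Coord N) V]

/-- The complexified Gram matrix of the frame at `x₀`, as a function of the coordinates. -/
noncomputable def gramForm (n N : ℕ) {X : Type*} [TopologicalSpace X] [ChartedSpace (Coord n) X]
    (V : X → Type*) [TopologicalSpace (TotalSpace (Coord N) V)]
    [∀ x, NormedAddCommGroup (V x)] [∀ x, InnerProductSpace ℝ (V x)]
    [FiberBundle (Coord N) V] [VectorBundle ℝ (Coord N) V] (x₀ : X) (p : Coord n) :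
    Matrix (Fin N) (Fin N) ℂ :=
  Matrix.of fun i j => ((inner ℝ (frameAt N V x₀ i ((extChartAt (𝓡 n) x₀).symm p))
    (frameAt N V x₀ j ((extChartAt (𝓡 n) x₀).symm p)) : ℝ) : ℂ)

theorem contDiffAt_gramForm (x₀ : X) (i j : Fin N) :
    ContDiffAt ℝ 2 (fun p => gramForm n N V x₀ p i j) (extChartAt (𝓡 n) x₀ x₀) := by
  have hmem := FiberBundle.mem_baseSet_trivializationAt (Coord N) V x₀
  have h1 : ContMDiffAt (𝓡 n) 𝓘(ℝ, ℝ) ∞ (fun y => inner ℝ (frameAt N V x₀ i y) (frameAt N V x₀ j y)) x₀ :=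
    (contMDiffAt_frameAt hmem i).inner_bundle (contMDiffAt_frameAt hmem j)
  have h2 : ContMDiffAt 𝓘(ℝ, Coord n) (𝓡 n) ∞ (extChartAt (𝓡 n) x₀).symm (extChartAt (𝓡 n) x₀ x₀) :=
    (contMDiffOn_extChartAt_symm x₀).contMDiffAt (extChartAt_target_mem_nhds x₀)
  have h3 := (h1.comp_of_eq h2 (extChartAt_to_inv x₀)).contDiffAt
  exact Complex.ofRealCLM.contDiff.contDiffAt.comp _ (h3.of_le (by norm_cast))

omit [IsManifold (𝓡 n) ∞ X] [IsContMDiffRiemannianBundle (𝓡 n) ∞ (Coord N) V] in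
theorem isUnit_det_gramForm (x₀ : X) :
    IsUnit (gramForm n N V x₀ (extChartAt (𝓡 n) x₀ x₀)).det := by
  have hmem := FiberBundle.mem_baseSet_trivializationAt (Coord N) V x₀
  have hli : LinearIndependent ℝ fun i => frameAt N V x₀ i x₀ :=
    ((trivializationAt (Coord N) V x₀).isLocalFrameOn_localFrame_baseSet (𝓡 n) 1
      (EuclideanSpace.basisFun (Fin N) ℝ).toBasis).linearIndependent hmem
  have h := (Matrix.posDef_gram_of_linearIndependent (𝕜 := ℝ) hli).det_pos
  have h2 : gramForm n N V x₀ (extChartAt (𝓡 n) x₀ x₀) =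
      (Matrix.gram ℝ fun i => frameAt N V x₀ i x₀).map (algebraMap ℝ ℂ) := by
    ext i j
    simp only [gramForm, Matrix.of_apply, Matrix.map_apply, Matrix.gram_apply]
    rw [extChartAt_to_inv]
    rfl
  rw [h2, isUnit_iff_ne_zero, ← RingHom.mapMatrix_apply, ← RingHom.map_det]
  exact (map_ne_zero _).mpr h.ne'

/-- Metric compatibility in coordinates. -/
theorem partialMatrix_gramForm [T2Space X] (cov : CovariantDerivative (𝓡 n) (Coord N) V)
    (hcov : cov.IsMetricCompatible) (x₀ : X) :
    ∀ᶠ q in 𝓝 (extChartAt (𝓡 n) x₀ x₀), ∀ a, partialMatrix (gramForm n N V x₀) q a =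
      (connForm cov x₀ a q)ᵀ * gramForm n N V x₀ q + gramForm n N V x₀ q * connForm cov x₀ a q := by
  have hmem := FiberBundle.mem_baseSet_trivializationAt (Coord N) V x₀
  have hopen := (trivializationAt (Coord N) V x₀).open_baseSet
  have hcont : ContinuousAt (extChartAt (𝓡 n) x₀).symm (extChartAt (𝓡 n) x₀ x₀) :=
    continuousAt_extChartAt_symm x₀
  filter_upwards [hcont.preimage_mem_nhds (hopen.mem_nhds (by rwa [extChartAt_to_inv])),
    extChartAt_target_mem_nhds x₀] with q hq hqt a
  set y := (extChartAt (𝓡 n) x₀).symm q with hy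
  have hyB : y ∈ (trivializationAt (Coord N) V x₀).baseSet := hq
  have hys : y ∈ (chartAt (Coord n) x₀).source := by
    rw [← extChartAt_source (𝓡 n)]; exact (extChartAt (𝓡 n) x₀).map_target hqt
  have hyq : extChartAt (𝓡 n) x₀ y = q := (extChartAt (𝓡 n) x₀).right_inv hqt
  have hfr (i : Fin N) : MDifferentiableAt (𝓡 n) ((𝓡 n).prod 𝓘(ℝ, Coord N))
      (fun y => TotalSpace.mk' (Coord N) y (frameAt N V x₀ i y)) y :=
    (contMDiffAt_frameAt hyB i).mdifferentiableAt (by simp)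
  classical
  have hexp (v : V y) : v = ∑ k, (trivializationAt (Coord N) V x₀).localFrameCoeff (𝓡 n)
      (EuclideanSpace.basisFun (Fin N) ℝ).toBasis k y v • frameAt N V x₀ k y := by
    have := ((trivializationAt (Coord N) V x₀).basisAt
      (EuclideanSpace.basisFun (Fin N) ℝ).toBasis hyB).sum_repr v
    conv_lhs => rw [← this]
    refine Finset.sum_congr rfl fun k _ => ?_
    have h := Trivialization.localFrameCoeff_apply_of_mem_baseSet (I := 𝓡 n)
      (trivializationAt (Coord N) V x₀) (EuclideanSpace.basisFun (Fin N) ℝ).toBasis hyB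
      (Function.update (fun _ => 0) y v) k
    rw [Function.update_self] at h
    rw [frameAt, Trivialization.localFrame_apply_of_mem_baseSet _ _ hyB, h]
  have hγ : MDifferentiableAt 𝓘(ℝ, Coord n) (𝓡 n) (extChartAt (𝓡 n) x₀).symm q :=
    ((contMDiffOn_extChartAt_symm (n := ∞) x₀).contMDiffAt
      ((isOpen_extChartAt_target x₀).mem_nhds hqt)).mdifferentiableAt (by simp)
  have hv : frameAt n (fun x : X => TangentSpace (𝓡 n) x) x₀ a y =
      mfderiv 𝓘(ℝ, Coord n) (𝓡 n) (extChartAt (𝓡 n) x₀).symm q (EuclideanSpace.single a 1) := by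
    have h1 := TangentBundle.symmL_trivializationAt (I := 𝓡 n) hys
    rw [ModelWithCorners.range_eq_univ, mfderivWithin_univ, hyq] at h1
    rw [← h1, frameAt, Trivialization.localFrame_apply_of_mem_baseSet _ _
      (by simpa using hys)]
    simp only [Trivialization.basisAt, Module.Basis.map_apply, OrthonormalBasis.coe_toBasis,
      EuclideanSpace.basisFun_apply]
    exact (Trivialization.symmL_apply (R := ℝ) (trivializationAt (Coord n)
      (fun x : X => TangentSpace (𝓡 n) x) x₀) (by simpa using hys) _).symm
  ext i j
  have hmet := hcov.mvfderiv_inner_eq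
    (frameAt n (fun x : X => TangentSpace (𝓡 n) x) x₀ a) (hfr i) (hfr j)
  have hg : MDifferentiableAt (𝓡 n) 𝓘(ℝ, ℝ)
      (fun z => inner ℝ (frameAt N V x₀ i z) (frameAt N V x₀ j z)) y :=
    (hfr i).inner_bundle (hfr j)
  have h1 : mvfderiv 𝓘(ℝ, Coord n) ((fun z => inner ℝ (frameAt N V x₀ i z)
      (frameAt N V x₀ j z)) ∘ (extChartAt (𝓡 n) x₀).symm) q (EuclideanSpace.single a 1) =
      mvfderiv (𝓡 n) (fun z => inner ℝ (frameAt N V x₀ i z) (frameAt N V x₀ j z)) y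
        (mfderiv 𝓘(ℝ, Coord n) (𝓡 n) (extChartAt (𝓡 n) x₀).symm q (EuclideanSpace.single a 1)) :=
    mvfderiv_comp_apply q hg hγ (EuclideanSpace.single a 1)
  rw [← hv, hmet] at h1
  have hgq : DifferentiableAt ℝ ((fun z => inner ℝ (frameAt N V x₀ i z) (frameAt N V x₀ j z)) ∘
      (extChartAt (𝓡 n) x₀).symm) q :=
    mdifferentiableAt_iff_differentiableAt.mp (hg.comp q hγ)
  have h2 : partialMatrix (gramForm n N V x₀) q a i j =
      ((mvfderiv 𝓘(ℝ, Coord n) ((fun z => inner ℝ (frameAt N V x₀ i z) (frameAt N V x₀ j z)) ∘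
        (extChartAt (𝓡 n) x₀).symm) q (EuclideanSpace.single a 1) : ℝ) : ℂ) := by
    have h3 := (Complex.ofRealCLM.hasFDerivAt.comp q hgq.hasFDerivAt).fderiv
    have h4 := congrArg (fun L => L (EuclideanSpace.single a 1)) h3
    refine h4.trans ?_
    simp [mvfderiv]
    rfl
  rw [h2, h1]
  have key (i j : Fin N) : inner ℝ (cov (frameAt N V x₀ i) y
      (frameAt n (fun x : X => TangentSpace (𝓡 n) x) x₀ a y)) (frameAt N V x₀ j y) =
      ∑ k, (trivializationAt (Coord N) V x₀).localFrameCoeff (𝓡 n)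
        (EuclideanSpace.basisFun (Fin N) ℝ).toBasis k y (cov (frameAt N V x₀ i) y
          (frameAt n (fun x : X => TangentSpace (𝓡 n) x) x₀ a y)) *
        inner ℝ (frameAt N V x₀ k y) (frameAt N V x₀ j y) := by
    conv_lhs => rw [hexp (cov (frameAt N V x₀ i) y
      (frameAt n (fun x : X => TangentSpace (𝓡 n) x) x₀ a y))]
    simp only [sum_inner, real_inner_smul_left]
  simp only [Matrix.add_apply, Matrix.mul_apply, Matrix.transpose_apply]
  rw [real_inner_comm (cov (frameAt N V x₀ j) y
    (frameAt n (fun x : X => TangentSpace (𝓡 n) x) x₀ a y)) (frameAt N V x₀ i y), key, key]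
  push_cast
  refine congrArg₂ (· + ·) ?_ ?_
  · refine Finset.sum_congr rfl fun k _ => ?_
    rfl
  · refine Finset.sum_congr rfl fun k _ => ?_
    rw [mul_comm, real_inner_comm]
    rfl

theorem curvatureCoeff_connForm_skew [T2Space X] (cov : CovariantDerivative (𝓡 n) (Coord N) V)
    [CovariantDerivative.ContMDiffCovariantDerivative cov ∞]
    (hcov : cov.IsMetricCompatible) (x₀ : X) (a b : Fin n) :
    (curvatureCoeff (connForm cov x₀) (extChartAt (𝓡 n) x₀ x₀) a b)ᵀ *
        gramForm n N V x₀ (extChartAt (𝓡 n) x₀ x₀) +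
      gramForm n N V x₀ (extChartAt (𝓡 n) x₀ x₀) *
        curvatureCoeff (connForm cov x₀) (extChartAt (𝓡 n) x₀ x₀) a b = 0 :=
  curvatureCoeff_skew (fun a => matrixDifferentiableAt_connForm cov x₀ a)
    (contDiffAt_gramForm x₀) (partialMatrix_gramForm cov hcov x₀) a b

end Metric

end ChartGeometry

/-! ### Curvature with values in the even forms -/

section EvenCurvature

open AnomalyCancellation

variable {n : ℕ} {ι : Type*} [Fintype ι]

/-- The curvature as a matrix over the commutative ring of even forms. -/
noncomputable def evenCurvature (A : Fin n → Coord n → Matrix ι ι ℂ) (p : Coord n) :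
    Matrix ι ι (evenForms n) :=
  ∑ a : Fin n, ∑ b : Fin n, if a < b then
    dxdx a b • (curvatureCoeff A p a b).map (algebraMap ℂ (evenForms n)) else 0

theorem evenCurvature_apply (A : Fin n → Coord n → Matrix ι ι ℂ) (p : Coord n) (i j : ι) :
    evenCurvature A p i j = ∑ a : Fin n, ∑ b : Fin n, if a < b then
      curvatureCoeff A p a b i j • dxdx a b else 0 := by
  simp only [evenCurvature, Matrix.sum_apply]
  refine Finset.sum_congr rfl fun a _ => Finset.sum_congr rfl fun b _ => ?_
  split_ifs
  · rw [Matrix.smul_apply, Matrix.map_apply, smul_eq_mul, mul_comm, ← Algebra.smul_def]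
  · rfl

theorem evenCurvature_mem_evenIdeal (A : Fin n → Coord n → Matrix ι ι ℂ) (p : Coord n) (i j : ι) :
    evenCurvature A p i j ∈ evenIdeal n := by
  rw [evenCurvature_apply]
  refine Submodule.sum_mem _ fun a _ => Submodule.sum_mem _ fun b _ => ?_
  split_ifs
  · exact Submodule.smul_of_tower_mem _ _ (Ideal.subset_span ⟨a, b, rfl⟩)
  · exact Submodule.zero_mem _

theorem evenCurvature_mem_evenDegree (A : Fin n → Coord n → Matrix ι ι ℂ) (p : Coord n)
    (i j : ι) : evenCurvature A p i j ∈ evenDegree n 1 := by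
  rw [evenCurvature_apply]
  refine Submodule.sum_mem _ fun a _ => Submodule.sum_mem _ fun b _ => ?_
  split_ifs
  · exact Submodule.smul_mem _ _ (dxdx_mem a b)
  · exact Submodule.zero_mem _

theorem AnomalyCancellation.LocalBundle.curvature_eq_map (E : LocalBundle n) (p : Coord n) :
    E.curvature p = (evenCurvature E.conn p).map (evenForms n).val := by
  ext i j
  simp only [LocalBundle.curvature, Matrix.map_apply, evenCurvature_apply, map_sum]
  refine Finset.sum_congr rfl fun a _ => Finset.sum_congr rfl fun b _ => ?_
  split_ifs
  · rfl
  · rw [map_zero]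

/-- The curvature normalised as in the Chern character, `√-1/(2π) R`. -/
noncomputable def chernMatrix (A : Fin n → Coord n → Matrix ι ι ℂ) (p : Coord n) :
    Matrix ι ι (evenForms n) :=
  (Complex.I / (2 * Real.pi)) • evenCurvature A p

theorem chernMatrix_mem_evenIdeal (A : Fin n → Coord n → Matrix ι ι ℂ) (p : Coord n) (i j : ι) :
    chernMatrix A p i j ∈ evenIdeal n := by
  rw [chernMatrix, Matrix.smul_apply]
  exact Submodule.smul_of_tower_mem _ _ (evenCurvature_mem_evenIdeal A p i j)

theorem chernMatrix_mem_evenDegree (A : Fin n → Coord n → Matrix ι ι ℂ) (p : Coord n)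
    (i j : ι) : chernMatrix A p i j ∈ evenDegree n 1 :=
  Submodule.smul_mem _ _ (evenCurvature_mem_evenDegree A p i j)

variable [DecidableEq ι]

theorem chernMatrix_pow_eq_zero (A : Fin n → Coord n → Matrix ι ι ℂ) (p : Coord n) :
    chernMatrix A p ^ (n + 1) = 0 :=
  Matrix.pow_eq_zero_of_mem (evenIdeal_pow_eq_bot n) (chernMatrix_mem_evenIdeal A p)

/-- The Chern character form lies in the even forms, where it is an honest exponential. -/
theorem AnomalyCancellation.LocalBundle.ch_eq (E : LocalBundle n) (p : Coord n) :
    E.ch p = (Matrix.trace (IsNilpotent.exp (chernMatrix E.conn p)) : evenForms n) := by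
  have h : (Complex.I / (2 * Real.pi)) • E.curvature p =
      (evenForms n).val.mapMatrix (chernMatrix E.conn p) := by
    rw [E.curvature_eq_map, chernMatrix, map_smul]
    rfl
  rw [LocalBundle.ch, h, ← map_psEval, psEval_exp (chernMatrix_pow_eq_zero _ _)]
  exact (AddMonoidHom.map_trace ((evenForms n).val : evenForms n →+ Form n) _).symm

section Linear

variable {κ : Type*} [Fintype κ]

omit [Fintype κ] in
theorem partialMatrix_linearMap (ρ : Matrix ι ι ℂ →ₗ[ℂ] Matrix κ κ ℂ)
    {M : Coord n → Matrix ι ι ℂ} {p : Coord n} (hM : MatrixDifferentiableAt M p) (a : Fin n) :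
    MatrixDifferentiableAt (fun y => ρ (M y)) p ∧
      partialMatrix (fun y => ρ (M y)) p a = ρ (partialMatrix M p a) := by
  have key (B : Matrix ι ι ℂ) (s t : κ) :
      ρ B s t = ∑ i, ∑ j, B i j * ρ (Matrix.single i j 1) s t := by
    conv_lhs => rw [Matrix.matrix_eq_sum_single B]
    simp only [map_sum, Matrix.sum_apply]
    refine Finset.sum_congr rfl fun i _ => Finset.sum_congr rfl fun j _ => ?_
    rw [show Matrix.single i j (B i j) = B i j • Matrix.single i j (1 : ℂ) by simp, map_smul]
    rfl
  have hd (s t : κ) (i j : ι) :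
      DifferentiableAt ℝ (fun y => M y i j * ρ (Matrix.single i j 1) s t) p :=
    (hM i j).mul_const _
  have hfun (s t : κ) : (fun y => ρ (M y) s t) =
      fun y => ∑ i, ∑ j, M y i j * ρ (Matrix.single i j 1) s t := funext fun y => key (M y) s t
  refine ⟨fun s t => ?_, ?_⟩
  · rw [hfun]
    exact DifferentiableAt.fun_sum fun i _ => DifferentiableAt.fun_sum fun j _ => hd s t i j
  · ext s t
    rw [key, partialMatrix, Matrix.of_apply, hfun]
    rw [fderiv_fun_sum fun i _ => DifferentiableAt.fun_sum fun j _ => hd s t i j, sum_apply]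
    refine Finset.sum_congr rfl fun i _ => ?_
    rw [fderiv_fun_sum fun j _ => hd s t i j, sum_apply]
    refine Finset.sum_congr rfl fun j _ => ?_
    rw [fderiv_mul_const (hM i j)]
    simp [partialMatrix, mul_comm]

/-- A homomorphism of Lie algebras sends the curvature of a connection to the curvature of the
induced connection. -/
theorem curvatureCoeff_linearMap (ρ : Matrix ι ι ℂ →ₗ[ℂ] Matrix κ κ ℂ)
    (hρ : ∀ M M', ρ (M * M' - M' * M) = ρ M * ρ M' - ρ M' * ρ M)
    {A : Fin n → Coord n → Matrix ι ι ℂ} {p : Coord n}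
    (hA : ∀ a, MatrixDifferentiableAt (A a) p) (a b : Fin n) :
    curvatureCoeff (fun a y => ρ (A a y)) p a b = ρ (curvatureCoeff A p a b) := by
  simp only [curvatureCoeff, map_add, map_sub ρ (partialMatrix _ _ _), hρ,
    (partialMatrix_linearMap ρ (hA _) _).2]

/-- The induced connection on `S^k` or `Λ^k` has the induced curvature. -/
theorem chernMatrix_rho {N : ℕ} {σ : ℂ} (F : SecondQuantization N σ) (k : ℕ)
    {A : Fin n → Coord n → Matrix (Fin N) (Fin N) ℂ} {p : Coord n}
    (hA : ∀ a, MatrixDifferentiableAt (A a) p) :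
    chernMatrix (fun a y => F.rho k (A a y)) p = F.rhoR k (chernMatrix A p) := by
  have hsmul (c : ℂ) (B : Matrix (Fin N) (Fin N) (evenForms n)) :
      F.rhoR k (c • B) = c • F.rhoR k B := by
    simp only [SecondQuantization.rhoR, Matrix.smul_apply, smul_assoc, Finset.smul_sum]
  rw [chernMatrix, chernMatrix, hsmul]
  congr 1
  change _ = F.rhoRHom k _
  rw [evenCurvature, evenCurvature, map_sum]
  refine Finset.sum_congr rfl fun a _ => ?_
  rw [map_sum]
  refine Finset.sum_congr rfl fun b _ => ?_
  split_ifs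
  · rw [show curvatureCoeff (fun a y => F.rho k (A a y)) p a b =
      F.rho k (curvatureCoeff A p a b) from
      curvatureCoeff_linearMap (F.rhoLin k) (F.rho_commutator k) hA a b]
    exact (F.rhoR_map k _ _).symm
  · rw [map_zero]

end Linear

/-- The odd power traces of a curvature which is skew for a nondegenerate bilinear form vanish. -/
theorem trace_chernMatrix_pow_of_odd {A : Fin n → Coord n → Matrix ι ι ℂ} {p : Coord n}
    {G : Matrix ι ι ℂ} (hG : IsUnit G.det)
    (h : ∀ a b, (curvatureCoeff A p a b)ᵀ * G + G * curvatureCoeff A p a b = 0) {k : ℕ}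
    (hk : Odd k) : Matrix.trace (chernMatrix A p ^ k) = 0 := by
  set φ : Matrix ι ι ℂ →+* Matrix ι ι (evenForms n) := (algebraMap ℂ (evenForms n)).mapMatrix
  set B := chernMatrix A p with hB
  have h1 : Bᵀ * φ G + φ G * B = 0 := by
    have : (evenCurvature A p)ᵀ * φ G + φ G * evenCurvature A p = 0 := by
      simp only [evenCurvature, Matrix.transpose_sum, Finset.sum_mul, Finset.mul_sum,
        ← Finset.sum_add_distrib]
      refine Finset.sum_eq_zero fun a _ => Finset.sum_eq_zero fun b _ => ?_
      split_ifs
      · have h2 := congrArg φ (h a b)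
        rw [map_add, map_mul, map_mul, map_zero] at h2
        rw [Matrix.transpose_smul, Matrix.smul_mul, Matrix.mul_smul, ← smul_add]
        exact (congrArg _ h2).trans (smul_zero _)
      · simp
    rw [hB, chernMatrix, Matrix.transpose_smul, Matrix.smul_mul, Matrix.mul_smul, ← smul_add, this,
      smul_zero]
  have h3 : φ G * φ G⁻¹ = 1 := by rw [← map_mul, Matrix.mul_nonsing_inv _ hG, map_one]
  have h4 (k : ℕ) : φ G * B ^ k = (-1) ^ k * ((Bᵀ) ^ k * φ G) := by
    induction k with
    | zero => simp
    | succ k ih =>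
      rw [pow_succ, ← Matrix.mul_assoc, ih, Matrix.mul_assoc, Matrix.mul_assoc,
        ← neg_eq_of_add_eq_zero_right h1, pow_succ Bᵀ, pow_succ (-1)]
      noncomm_ring
  have h5 : Matrix.trace (B ^ k) = -Matrix.trace (B ^ k) := by
    calc Matrix.trace (B ^ k) = Matrix.trace ((φ G * B ^ k) * φ G⁻¹) := by
          rw [Matrix.trace_mul_comm, ← Matrix.mul_assoc, mul_eq_one_comm.mp h3, one_mul]
      _ = -Matrix.trace (B ^ k) := by
          rw [h4, hk.neg_one_pow, ← Matrix.transpose_pow, neg_one_mul, Matrix.neg_mul,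
            Matrix.mul_assoc, h3, mul_one, Matrix.trace_neg, Matrix.trace_transpose]
  have h6 : (2 : ℂ) • Matrix.trace (B ^ k) = 0 := by
    rw [two_smul]; nth_rw 1 [h5]; exact neg_add_cancel _
  exact (smul_eq_zero.mp h6).resolve_left two_ne_zero

end EvenCurvature

/-! ### Tensor products of matrices -/

section TensorProducts

variable {J : Type*} [Fintype J] [DecidableEq J] {idx : J → Type*} [∀ j, Fintype (idx j)]
  [∀ j, DecidableEq (idx j)] {R : Type*} [CommRing R]

/-- The tensor product of a family of matrices. -/
def Matrix.piKronecker (X : ∀ j, Matrix (idx j) (idx j) R) :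
    Matrix (∀ j, idx j) (∀ j, idx j) R :=
  Matrix.of fun s t => ∏ j, X j (s j) (t j)

omit [(j : J) → DecidableEq (idx j)] in
theorem Matrix.piKronecker_mul (X Y : ∀ j, Matrix (idx j) (idx j) R) :
    piKronecker X * piKronecker Y = piKronecker (X * Y) := by
  ext s t
  simp only [piKronecker, Matrix.mul_apply, Matrix.of_apply, Pi.mul_apply, Finset.prod_univ_sum,
    Fintype.piFinset_univ, Finset.prod_mul_distrib]

omit [DecidableEq J] [(j : J) → Fintype (idx j)] in
theorem Matrix.piKronecker_one : piKronecker (1 : ∀ j, Matrix (idx j) (idx j) R) = 1 := by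
  ext s t
  simp only [piKronecker, Matrix.of_apply, Pi.one_apply, Matrix.one_apply]
  rw [Fintype.prod_ite_zero]
  simp [funext_iff]

omit [(j : J) → DecidableEq (idx j)] in
theorem Matrix.trace_piKronecker (X : ∀ j, Matrix (idx j) (idx j) R) :
    trace (piKronecker X) = ∏ j, trace (X j) := by
  simp only [trace, piKronecker, diag_apply, Matrix.of_apply, Finset.prod_univ_sum,
    Fintype.piFinset_univ]

/-- A matrix acting on one factor of a tensor product. -/
def Matrix.tensorSlot (j : J) (M : Matrix (idx j) (idx j) R) :
    Matrix (∀ j, idx j) (∀ j, idx j) R :=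
  Matrix.of fun s t => if ∀ j', j' ≠ j → s j' = t j' then M (s j) (t j) else 0

omit [(j : J) → Fintype (idx j)] in
theorem Matrix.tensorSlot_eq (j : J) (M : Matrix (idx j) (idx j) R) :
    tensorSlot j M = piKronecker (Function.update 1 j M) := by
  ext s t
  rw [tensorSlot, piKronecker, Matrix.of_apply, Matrix.of_apply,
    ← Finset.mul_prod_erase _ _ (Finset.mem_univ j), Function.update_self]
  have : ∏ x ∈ Finset.univ.erase j, Function.update (1 : ∀ j, Matrix (idx j) (idx j) R) j M x
      (s x) (t x) = ∏ x ∈ Finset.univ.erase j, if s x = t x then 1 else 0 := by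
    refine Finset.prod_congr rfl fun x hx => ?_
    rw [Function.update_of_ne (Finset.ne_of_mem_erase hx), Pi.one_apply, Matrix.one_apply]
  rw [this, Finset.prod_ite_zero]
  simp

/-- The action on one factor as a ring homomorphism. -/
def Matrix.tensorSlotHom (j : J) :
    Matrix (idx j) (idx j) R →+* Matrix (∀ j, idx j) (∀ j, idx j) R where
  toFun := tensorSlot j
  map_zero' := by ext; simp [tensorSlot]
  map_one' := by
    rw [tensorSlot_eq, ← Matrix.piKronecker_one]
    congr 1
    exact Function.update_eq_self j _
  map_add' M M' := by
    ext s t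
    simp only [tensorSlot, Matrix.of_apply, Matrix.add_apply]
    split_ifs <;> simp
  map_mul' M M' := by
    rw [tensorSlot_eq, tensorSlot_eq, tensorSlot_eq, Matrix.piKronecker_mul, ← Function.update_mul,
      one_mul]

omit [(j : J) → Fintype (idx j)] in
theorem Matrix.tensorSlot_smul {S : Type*} [SMulZeroClass S R] (j : J) (c : S)
    (M : Matrix (idx j) (idx j) R) : tensorSlot j (c • M) = c • tensorSlot j M := by
  ext s t
  simp only [tensorSlot, Matrix.of_apply, Matrix.smul_apply]
  split_ifs <;> simp

omit [(j : J) → Fintype (idx j)] in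
theorem Matrix.tensorSlot_map {R' : Type*} [CommRing R'] (φ : R →+* R') (j : J)
    (M : Matrix (idx j) (idx j) R) : (tensorSlot j M).map φ = tensorSlot j (M.map φ) := by
  ext s t
  simp only [tensorSlot, Matrix.of_apply, Matrix.map_apply]
  split_ifs <;> simp

theorem Matrix.tensorSlot_sum {κ : Type*} (s : Finset κ) (j : J)
    (M : κ → Matrix (idx j) (idx j) R) : tensorSlot j (∑ k ∈ s, M k) = ∑ k ∈ s, tensorSlot j (M k) :=
  map_sum (tensorSlotHom j) M s

theorem Matrix.tensorSlot_commute {i j : J} (hij : i ≠ j) (M : Matrix (idx i) (idx i) R)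
    (M' : Matrix (idx j) (idx j) R) : Commute (tensorSlot i M) (tensorSlot j M') := by
  rw [commute_iff_eq, tensorSlot_eq, tensorSlot_eq, Matrix.piKronecker_mul, Matrix.piKronecker_mul]
  congr 1
  ext1 k
  rw [Pi.mul_apply, Pi.mul_apply]
  by_cases hk : k = i
  · subst hk
    rw [Function.update_of_ne hij, Pi.one_apply, mul_one, one_mul]
  · rw [Function.update_of_ne hk, Pi.one_apply, mul_one, one_mul]

/-- The exponential of an action on one factor at a time is the tensor product of exponentials. -/
theorem Matrix.exp_sum_tensorSlot [Algebra ℚ R] (X : ∀ j, Matrix (idx j) (idx j) R)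
    (hX : ∀ j, IsNilpotent (X j)) (s : Finset J) :
    IsNilpotent (∑ j ∈ s, tensorSlot j (X j)) ∧
    IsNilpotent.exp (∑ j ∈ s, tensorSlot j (X j)) =
      piKronecker (fun j => if j ∈ s then IsNilpotent.exp (X j) else 1) := by
  have hslot (j : J) : IsNilpotent (tensorSlot j (X j)) := (hX j).map (tensorSlotHom j)
  induction s using Finset.induction_on with
  | empty =>
    refine ⟨by simp, ?_⟩
    simp only [Finset.sum_empty, IsNilpotent.exp_zero, Finset.notMem_empty, if_false]
    exact Matrix.piKronecker_one.symm
  | insert j s hj ih =>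
    have hc : Commute (tensorSlot j (X j)) (∑ i ∈ s, tensorSlot i (X i)) :=
      Commute.sum_right _ _ _ fun i hi =>
        Matrix.tensorSlot_commute (by rintro rfl; exact hj hi) _ _
    rw [Finset.sum_insert hj]
    refine ⟨hc.isNilpotent_add (hslot j) ih.1, ?_⟩
    rw [IsNilpotent.exp_add_of_commute hc (hslot j) ih.1, ih.2]
    have h : tensorSlot j (IsNilpotent.exp (X j)) = IsNilpotent.exp (tensorSlot j (X j)) :=
      (hX j).map_exp (tensorSlotHom j)
    rw [← h, tensorSlot_eq, Matrix.piKronecker_mul]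
    congr 1
    ext1 k
    rw [Pi.mul_apply]
    by_cases hk : k = j
    · subst hk
      simp [hj]
    · simp [hk]

end TensorProducts

/-! ### Curvature of tensor products -/

section TensorCurvature

open AnomalyCancellation Matrix

variable {n : ℕ} {J : Type*} [Fintype J] [DecidableEq J] {idx : J → Type*} [∀ j, Fintype (idx j)]
  [∀ j, DecidableEq (idx j)] {A : ∀ j, Fin n → Coord n → Matrix (idx j) (idx j) ℂ} {p : Coord n}

/-- The curvature of a tensor product acts on one factor at a time: the mixed commutators vanish. -/
theorem curvatureCoeff_tensor (hA : ∀ j a, MatrixDifferentiableAt (A j a) p)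
    (a b : Fin n) : curvatureCoeff (fun a y => ∑ j, tensorSlot j (A j a y)) p a b =
      ∑ j, tensorSlot j (curvatureCoeff (A j) p a b) := by
  let ρ (j : J) : Matrix (idx j) (idx j) ℂ →ₗ[ℂ] Matrix (∀ j, idx j) (∀ j, idx j) ℂ :=
    { toFun := tensorSlot j
      map_add' := map_add (tensorSlotHom j)
      map_smul' := tensorSlot_smul j }
  have hρ (j : J) (M : Matrix (idx j) (idx j) ℂ) : ρ j M = tensorSlot j M := rfl
  have hpart (a b : Fin n) : partialMatrix (fun y => ∑ j, ρ j (A j a y)) p b =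
      ∑ j, ρ j (partialMatrix (A j a) p b) := by
    ext s t
    simp only [← (partialMatrix_linearMap (ρ _) (hA _ a) b).2]
    simp only [partialMatrix, Matrix.of_apply, Matrix.sum_apply]
    rw [fderiv_fun_sum fun j _ => (partialMatrix_linearMap (ρ j) (hA j a) b).1 s t, _root_.sum_apply]
  have hmul (a b : Fin n) : (∑ j, tensorSlot j (A j a p)) * (∑ j, tensorSlot j (A j b p)) =
      ∑ j, tensorSlot j (A j a p * A j b p) + ∑ j, ∑ i ∈ Finset.univ.erase j,
        tensorSlot j (A j a p) * tensorSlot i (A i b p) := by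
    rw [Finset.sum_mul_sum, ← Finset.sum_add_distrib]
    refine Finset.sum_congr rfl fun j _ => ?_
    rw [← Finset.add_sum_erase _ _ (Finset.mem_univ j)]
    congr 1
    exact (map_mul (tensorSlotHom j) _ _).symm
  have hcross : ∑ j, ∑ i ∈ Finset.univ.erase j, tensorSlot j (A j a p) * tensorSlot i (A i b p) =
      ∑ j, ∑ i ∈ Finset.univ.erase j, tensorSlot j (A j b p) * tensorSlot i (A i a p) := by
    simp only [← Finset.filter_ne', Finset.sum_filter]
    rw [Finset.sum_comm]
    refine Finset.sum_congr rfl fun j _ => Finset.sum_congr rfl fun i _ => ?_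
    by_cases hij : i = j
    · simp [hij]
    · rw [if_pos (Ne.symm hij), if_pos hij]
      exact tensorSlot_commute hij _ _
  change partialMatrix (fun y => ∑ j, ρ j (A j b y)) p a -
    partialMatrix (fun y => ∑ j, ρ j (A j a y)) p b +
    ((∑ j, tensorSlot j (A j a p)) * (∑ j, tensorSlot j (A j b p)) -
      (∑ j, tensorSlot j (A j b p)) * (∑ j, tensorSlot j (A j a p))) = _
  rw [hpart, hpart, hmul, hmul, hcross, add_sub_add_right_eq_sub,
    ← Finset.sum_sub_distrib, ← Finset.sum_sub_distrib, ← Finset.sum_add_distrib]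
  refine Finset.sum_congr rfl fun j _ => ?_
  simp only [← hρ]
  rw [← map_sub, ← map_sub, ← map_add]
  rfl

theorem chernMatrix_tensor (hA : ∀ j a, MatrixDifferentiableAt (A j a) p) :
    chernMatrix (fun a y => ∑ j, tensorSlot j (A j a y)) p =
      ∑ j, tensorSlot j (chernMatrix (A j) p) := by
  simp only [chernMatrix, tensorSlot_smul, ← Finset.smul_sum]
  congr 1
  simp only [evenCurvature, tensorSlot_sum]
  refine Eq.trans (Finset.sum_congr rfl fun a _ => ?_) Finset.sum_comm
  refine Eq.trans (Finset.sum_congr rfl fun b _ => ?_) Finset.sum_comm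
  split_ifs
  · rw [curvatureCoeff_tensor hA]
    simp only [tensorSlot_smul, ← Finset.smul_sum, ← tensorSlot_map]
    congr 1
    change (algebraMap ℂ (evenForms n)).mapMatrix (∑ j, tensorSlot j (curvatureCoeff (A j) p a b)) = _
    rw [map_sum]
    rfl
  · rw [eq_comm]
    exact Finset.sum_eq_zero fun j _ => map_zero (tensorSlotHom j)

/-- The Chern character form is multiplicative. -/
theorem trace_exp_chernMatrix_tensor (hA : ∀ j a, MatrixDifferentiableAt (A j a) p) :
    trace (IsNilpotent.exp (chernMatrix (fun a y => ∑ j, tensorSlot j (A j a y)) p)) =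
      ∏ j, trace (IsNilpotent.exp (chernMatrix (A j) p)) := by
  rw [chernMatrix_tensor hA,
    (exp_sum_tensorSlot _ (fun j => ⟨n + 1, chernMatrix_pow_eq_zero _ _⟩) _).2, trace_piKronecker]
  simp

theorem AnomalyCancellation.LocalBundle.ch_tensor {J : Type} [Fintype J] [DecidableEq J]
    {E : J → LocalBundle n} (hE : ∀ j a, MatrixDifferentiableAt ((E j).conn a) p) :
    (LocalBundle.tensor E).ch p =
      (∏ j, trace (IsNilpotent.exp (chernMatrix (E j).conn p)) : evenForms n) := by
  have h : (LocalBundle.tensor E).conn = fun a y => ∑ j, tensorSlot j ((E j).conn a y) := by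
    funext a y
    ext s t
    refine Eq.trans ?_ (Matrix.sum_apply s t Finset.univ fun j => tensorSlot j ((E j).conn a y)).symm
    rfl
  rw [LocalBundle.ch_eq, ← trace_exp_chernMatrix_tensor hE, ← h]
  rfl

end TensorCurvature

/-! ### The Chern character of virtual bundles -/

section ChernCharacterHom

open AnomalyCancellation

variable {n N M : ℕ}

/-- The Chern character form of a generator, as an even form. -/
noncomputable def genChern (D : BundleTriple n N M) (p : Coord n) : Gen → evenForms n
  | .symT k => (symmetricPowers n).trExp k (chernMatrix D.T p)
  | .extW k => (exteriorPowers N).trExp k (chernMatrix D.W p)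
  | .extXi k => (exteriorPowers M).trExp k (chernMatrix D.xi p)

/-- The Chern character form as a ring homomorphism from virtual bundles to even forms. -/
noncomputable def chernHom (D : BundleTriple n N M) (p : Coord n) : VirtualBundle →+* evenForms n :=
  MvPolynomial.eval₂Hom (Int.castRingHom _) (genChern D p)

theorem matrixDifferentiableAt_rho {N : ℕ} {σ : ℂ} (F : SecondQuantization N σ) (k : ℕ)
    {M : Coord n → Matrix (Fin N) (Fin N) ℂ} {p : Coord n} (hM : MatrixDifferentiableAt M p) :
    MatrixDifferentiableAt (fun y => F.rho k (M y)) p := by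
  rcases Nat.eq_zero_or_pos n with rfl | hn
  · intro i j
    have : Subsingleton (Coord 0) := inferInstance
    exact (differentiableAt_const (F.rho k (M p) i j)).congr_of_eventuallyEq
      (Filter.Eventually.of_forall fun y => by rw [Subsingleton.elim y p])
  · exact (partialMatrix_linearMap (F.rhoLin k) hM ⟨0, hn⟩).1

variable {D : BundleTriple n N M} {p : Coord n}

theorem trace_exp_gen (hT : ∀ a, MatrixDifferentiableAt (D.T a) p)
    (hW : ∀ a, MatrixDifferentiableAt (D.W a) p) (hxi : ∀ a, MatrixDifferentiableAt (D.xi a) p)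
    (g : Gen) : (∀ a, MatrixDifferentiableAt ((D.gen g).conn a) p) ∧
      Matrix.trace (IsNilpotent.exp (chernMatrix (D.gen g).conn p)) = genChern D p g := by
  rcases g with k | k | k
  · exact ⟨fun a => matrixDifferentiableAt_rho (symmetricPowers n) k (hT a),
      congrArg (fun B => Matrix.trace (IsNilpotent.exp B)) (chernMatrix_rho (symmetricPowers n) k hT)⟩
  · exact ⟨fun a => matrixDifferentiableAt_rho (exteriorPowers N) k (hW a),
      congrArg (fun B => Matrix.trace (IsNilpotent.exp B)) (chernMatrix_rho (exteriorPowers N) k hW)⟩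
  · exact ⟨fun a => matrixDifferentiableAt_rho (exteriorPowers M) k (hxi a),
      congrArg (fun B => Matrix.trace (IsNilpotent.exp B)) (chernMatrix_rho (exteriorPowers M) k hxi)⟩

theorem ch_monomialBundle (hT : ∀ a, MatrixDifferentiableAt (D.T a) p)
    (hW : ∀ a, MatrixDifferentiableAt (D.W a) p) (hxi : ∀ a, MatrixDifferentiableAt (D.xi a) p)
    (s : Gen →₀ ℕ) :
    (D.monomialBundle s).ch p = (∏ g ∈ s.support, genChern D p g ^ s g : evenForms n) := by
  classical
  have h := trace_exp_gen hT hW hxi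
  rw [BundleTriple.monomialBundle, LocalBundle.ch_tensor fun j a => (h _).1 a]
  simp only [(h _).2]
  rw [Fintype.prod_sigma]
  simp only [Finset.prod_const, Finset.card_univ, Fintype.card_fin]
  exact congrArg _ (Finset.prod_coe_sort s.support fun g => genChern D p g ^ s g)

theorem ch_eq_chernHom (hT : ∀ a, MatrixDifferentiableAt (D.T a) p)
    (hW : ∀ a, MatrixDifferentiableAt (D.W a) p) (hxi : ∀ a, MatrixDifferentiableAt (D.xi a) p)
    (F : VirtualBundle) : D.ch p F = (chernHom D p F : evenForms n) := by
  rw [BundleTriple.ch, chernHom, MvPolynomial.coe_eval₂Hom, MvPolynomial.eval₂_eq]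
  change _ = (evenForms n).val _
  rw [map_sum]
  refine Finset.sum_congr rfl fun s _ => ?_
  rw [ch_monomialBundle hT hW hxi, map_mul, zsmul_eq_mul]
  congr 1

end ChernCharacterHom

/-! ### Total powers as power series -/

section ThetaLogarithm

open AnomalyCancellation PowerSeries

variable {R : Type*} [CommRing R]

theorem totalPower_eq (a : ℕ → R) (c : ℤ) (d : ℕ) (hd : d ≠ 0) :
    totalPower a c d = expand d hd (rescale (c : R) (mk a)) := by
  ext j
  rw [totalPower, coeff_mk, coeff_expand]
  split_ifs <;> simp

theorem map_totalPower {R' : Type*} [CommRing R'] (φ : R →+* R') (a : ℕ → R) (c : ℤ) (d : ℕ) :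
    map φ (totalPower a c d) = totalPower (fun k => φ (a k)) c d := by
  ext j
  simp only [totalPower, coeff_map, coeff_mk]
  split_ifs <;> simp

theorem mul_map_invOfUnit {R' : Type*} [CommRing R'] (φ : R →+* R') {f g : PowerSeries R}
    {e : PowerSeries R'} (hg : constantCoeff g = 1) (h : map φ f = map φ g * e) :
    map φ (f * invOfUnit g 1) = e := by
  have h1 : g * invOfUnit g 1 = 1 := mul_invOfUnit g 1 (by simpa using hg)
  have h2 := congrArg (map φ) h1
  rw [map_mul, map_one] at h2
  rw [map_mul, h]
  linear_combination e * h2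

theorem coeff_exp_congr [Algebra ℚ R] {f g : PowerSeries R} {m : ℕ} (hf : f ^ m = 0)
    (hg : g ^ m = 0) {j : ℕ} (h : ∀ i ≤ j, coeff i f = coeff i g) :
    coeff j (IsNilpotent.exp f) = coeff j (IsNilpotent.exp g) := by
  have h1 : (X : PowerSeries R) ^ (j + 1) ∣ f - g := by
    rw [X_pow_dvd_iff]
    intro i hi
    rw [map_sub, h i (by omega), sub_self]
  have h2 : (X : PowerSeries R) ^ (j + 1) ∣ IsNilpotent.exp f - IsNilpotent.exp g := by
    rw [IsNilpotent.exp_eq_sum hf, IsNilpotent.exp_eq_sum hg, ← Finset.sum_sub_distrib]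
    refine Finset.dvd_sum fun i _ => ?_
    rw [← smul_sub]
    exact (h1.trans (sub_dvd_pow_sub_pow f g i)).trans (Dvd.intro_left (algebraMap ℚ _ _)
      (Algebra.smul_def _ _).symm)
  have h3 := (X_pow_dvd_iff.mp h2) j (Nat.lt_succ_self j)
  rwa [map_sub, sub_eq_zero] at h3

end ThetaLogarithm

/-! ### The Chern character of `Θ_2` -/

section ThetaSeries

open AnomalyCancellation PowerSeries

theorem sum_range_even_divisors {M : Type*} [AddCommMonoid M] (g : ℕ → M) {i J : ℕ} (hi : i ≠ 0)
    (hJ : i ≤ J) : ∑ v ∈ Finset.range J, (if 2 * (v + 1) ∣ i then g (i / (2 * (v + 1))) else 0) =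
      if 2 ∣ i then ∑ d ∈ (i / 2).divisors, g d else 0 := by
  split_ifs with h
  · obtain ⟨k, rfl⟩ := h
    have hk : k ≠ 0 := by omega
    have h1 (v : ℕ) : 2 * (v + 1) ∣ 2 * k ↔ v + 1 ∣ k := Nat.mul_dvd_mul_iff_left two_pos
    have h2 (v : ℕ) : 2 * k / (2 * (v + 1)) = k / (v + 1) := Nat.mul_div_mul_left _ _ two_pos
    simp only [h1, h2, Nat.mul_div_cancel_left k two_pos]
    rw [← Nat.sum_div_divisors k g, ← Finset.sum_filter]
    refine Finset.sum_nbij' (fun v => v + 1) (fun d => d - 1) ?_ ?_ ?_ ?_ ?_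
    · intro v hv
      rw [Finset.mem_filter] at hv
      exact Nat.mem_divisors.mpr ⟨hv.2, hk⟩
    · intro d hd
      have h3 := Nat.pos_of_mem_divisors hd
      have h4 := Nat.divisor_le hd
      rw [Finset.mem_filter, Finset.mem_range, Nat.sub_add_cancel h3]
      exact ⟨by omega, (Nat.mem_divisors.mp hd).1⟩
    · intro v _
      rfl
    · intro d hd
      exact Nat.sub_add_cancel (Nat.pos_of_mem_divisors hd)
    · intro v _
      rfl
  · refine Finset.sum_eq_zero fun v _ => if_neg fun h' => h ((Dvd.intro _ rfl).trans h')

theorem sum_range_odd_divisors {M : Type*} [AddCommMonoid M] (g : ℕ → M) {i J : ℕ} (hi : i ≠ 0)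
    (hJ : i ≤ J) :
    ∑ v ∈ Finset.range J, (if 2 * (v + 1) - 1 ∣ i then g (i / (2 * (v + 1) - 1)) else 0) =
      ∑ d ∈ i.divisors with Odd (i / d), g d := by
  have h0 : ∑ d ∈ i.divisors with Odd (i / d), g d = ∑ d ∈ i.divisors with Odd d, g (i / d) := by
    rw [Finset.sum_filter, Finset.sum_filter, ← Nat.sum_div_divisors i]
    refine Finset.sum_congr rfl fun d hd => ?_
    rw [Nat.div_div_self (Nat.mem_divisors.mp hd).1 hi]
  rw [h0, ← Finset.sum_filter]
  refine Finset.sum_nbij' (fun v => 2 * (v + 1) - 1) (fun d => (d - 1) / 2) ?_ ?_ ?_ ?_ ?_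
  · intro v hv
    rw [Finset.mem_filter] at hv ⊢
    exact ⟨Nat.mem_divisors.mpr ⟨hv.2, hi⟩, ⟨v, by omega⟩⟩
  · intro d hd
    rw [Finset.mem_filter] at hd
    obtain ⟨hd, e, rfl⟩ := hd
    have h4 := Nat.divisor_le hd
    rw [Finset.mem_filter, Finset.mem_range, show 2 * ((2 * e + 1 - 1) / 2 + 1) - 1 = 2 * e + 1 by
      omega]
    exact ⟨by omega, (Nat.mem_divisors.mp hd).1⟩
  · intro v _
    omega
  · intro d hd
    rw [Finset.mem_filter] at hd
    obtain ⟨hd, e, rfl⟩ := hd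
    omega
  · intro v _
    rfl

variable {R : Type*} [CommRing R] [Algebra ℂ R]

/-- The component `tr (Bᵏ) / k!` of `tr exp B`. -/
noncomputable def charTrace {N : ℕ} (B : Matrix (Fin N) (Fin N) R) (k : ℕ) : R :=
  (1 / (k.factorial : ℂ)) • Matrix.trace (B ^ k)

theorem inv_smul_powerSum [Algebra ℚ R] {N : ℕ} (m : ℕ) (B : Matrix (Fin N) (Fin N) R) {j : ℕ}
    (hj : j ≠ 0) : (1 / (j : ℚ)) • powerSum m B j =
      ∑ i ∈ Finset.Ico 1 m, ((j : ℂ) ^ (i - 1)) • charTrace B i := by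
  rw [powerSum, Finset.smul_sum]
  refine Finset.sum_congr rfl fun i hi => ?_
  have hi1 := (Finset.mem_Ico.mp hi).1
  obtain ⟨k, rfl⟩ : ∃ k, i = k + 1 := ⟨i - 1, by omega⟩
  have hj' : (j : ℂ) ≠ 0 := Nat.cast_ne_zero.mpr hj
  rw [smul_smul, charTrace, smul_smul, ← Rat.cast_smul_eq_qsmul ℂ]
  congr 1
  push_cast
  rw [pow_succ]
  field_simp

omit [Algebra ℂ R] in
theorem prod_exp_of_coeff_mem [Algebra ℚ R] {I : Ideal R} {m : ℕ} (hI : I ^ m = ⊥) {κ : Type*}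
    (s : Finset κ) (f : κ → PowerSeries R) (hf : ∀ v j, coeff j (f v) ∈ I) :
    ∏ v ∈ s, IsNilpotent.exp (f v) = IsNilpotent.exp (∑ v ∈ s, f v) := by
  classical
  induction s using Finset.induction_on with
  | empty => simp [IsNilpotent.exp_zero]
  | insert v s hv ih =>
    rw [Finset.prod_insert hv, Finset.sum_insert hv, ih,
      IsNilpotent.exp_add_of_commute (Commute.all _ _) ⟨m, pow_eq_zero_of_coeff_mem hI (hf v)⟩
        ⟨m, pow_eq_zero_of_coeff_mem hI fun j => by
          rw [map_sum]; exact Ideal.sum_mem _ fun u _ => hf u j⟩]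

variable {n N M : ℕ} (BT : Matrix (Fin n) (Fin n) (evenForms n))
  (BW : Matrix (Fin N) (Fin N) (evenForms n))

/-- The logarithm of `ch(Θ_2)`, in terms of Eisenstein series. -/
noncomputable def thetaLog : PowerSeries (evenForms n) :=
  ∑ i ∈ Finset.Ico 1 (n + 1),
    (map (algebraMap ℂ (evenForms n)) (expand 2 two_ne_zero (eisensteinG i) -
        C (constantCoeff (eisensteinG i))) * C (charTrace BT i) -
      map (algebraMap ℂ (evenForms n)) (eisensteinG i - expand 2 two_ne_zero (eisensteinG i)) *
        C (charTrace BW i))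

theorem coeff_zero_logChar [Algebra ℚ R] {σ : ℂ} (F : SecondQuantization N σ) (m : ℕ)
    (B : Matrix (Fin N) (Fin N) R) : coeff 0 (F.logChar m B) = 0 := by
  rw [SecondQuantization.logChar, coeff_mk, if_pos rfl]

theorem coeff_zero_thetaLog : coeff 0 (thetaLog BT BW) = 0 := by
  rw [thetaLog, map_sum]
  refine Finset.sum_eq_zero fun i _ => ?_
  rw [map_sub, coeff_mul_C, coeff_mul_C, coeff_map, coeff_map, map_sub, map_sub,
    coeff_zero_eq_constantCoeff_apply, coeff_zero_eq_constantCoeff_apply,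
    coeff_zero_eq_constantCoeff_apply, constantCoeff_expand, constantCoeff_C]
  simp

theorem coeff_thetaLog {i : ℕ} (hi : i ≠ 0) :
    coeff i (thetaLog BT BW) = ∑ k ∈ Finset.Ico 1 (n + 1),
      ((if 2 ∣ i then ∑ d ∈ (i / 2).divisors, ((d : ℂ) ^ (k - 1)) • charTrace BT k else 0) -
        ∑ d ∈ i.divisors with Odd (i / d), ((d : ℂ) ^ (k - 1)) • charTrace BW k) := by
  rw [thetaLog, map_sum]
  refine Finset.sum_congr rfl fun k hk => ?_
  have hG (j : ℕ) (hj : j ≠ 0) : coeff j (eisensteinG k) = ∑ d ∈ j.divisors, (d : ℂ) ^ (k - 1) := by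
    rw [eisensteinG, coeff_mk, if_neg hj, ArithmeticFunction.sigma_apply]
    push_cast
    rfl
  have hE : coeff i (expand 2 two_ne_zero (eisensteinG k)) =
      if 2 ∣ i then ∑ d ∈ (i / 2).divisors, (d : ℂ) ^ (k - 1) else 0 := by
    rw [coeff_expand]
    split_ifs with h
    · rw [hG _ (by omega)]
    · rfl
  have h1 : coeff i (expand 2 two_ne_zero (eisensteinG k) - C (constantCoeff (eisensteinG k))) =
      if 2 ∣ i then ∑ d ∈ (i / 2).divisors, (d : ℂ) ^ (k - 1) else 0 := by
    rw [map_sub, coeff_C, if_neg hi, sub_zero, hE]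
  have h2 : coeff i (eisensteinG k - expand 2 two_ne_zero (eisensteinG k)) =
      ∑ d ∈ i.divisors with Odd (i / d), (d : ℂ) ^ (k - 1) := by
    rw [map_sub, hE, hG i hi, sum_divisors_odd_quotient (fun d => (d : ℂ) ^ (k - 1))]
  rw [map_sub, coeff_mul_C, coeff_mul_C, coeff_map, coeff_map, h1, h2,
    ← Algebra.smul_def, ← Algebra.smul_def]
  congr 1
  · split_ifs with h
    · rw [Finset.sum_smul]
    · rw [zero_smul]
  · rw [Finset.sum_smul]

variable {BT BW}

/-- The logarithm of the factor of `ch(Θ_2)` with index `v + 1`. -/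
noncomputable def thetaFactorLog (BT : Matrix (Fin n) (Fin n) (evenForms n))
    (BW : Matrix (Fin N) (Fin N) (evenForms n)) (v : ℕ) : PowerSeries (evenForms n) :=
  expand (2 * (v + 1)) (by omega) ((symmetricPowers n).logChar (n + 1) BT) +
    expand (2 * (v + 1) - 1) (by omega)
      (rescale (-1) ((exteriorPowers N).logChar (n + 1) BW))

theorem coeff_thetaFactorLog (v i : ℕ) : coeff i (thetaFactorLog BT BW v) =
    (if 2 * (v + 1) ∣ i then
      coeff (i / (2 * (v + 1))) ((symmetricPowers n).logChar (n + 1) BT) else 0) +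
    (if 2 * (v + 1) - 1 ∣ i then (-1) ^ (i / (2 * (v + 1) - 1)) *
      coeff (i / (2 * (v + 1) - 1)) ((exteriorPowers N).logChar (n + 1) BW) else 0) := by
  rw [thetaFactorLog, map_add, coeff_expand, coeff_expand, coeff_rescale]

theorem coeff_thetaFactorLog_mem (hT : ∀ i j, BT i j ∈ evenIdeal n)
    (hW : ∀ i j, BW i j ∈ evenIdeal n) (v i : ℕ) :
    coeff i (thetaFactorLog BT BW v) ∈ evenIdeal n := by
  rw [coeff_thetaFactorLog]
  refine Ideal.add_mem _ ?_ ?_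
  · split_ifs
    · exact SecondQuantization.coeff_logChar_mem _ hT _
    · exact Ideal.zero_mem _
  · split_ifs
    · exact Ideal.mul_mem_left _ _ (SecondQuantization.coeff_logChar_mem _ hW _)
    · exact Ideal.zero_mem _

/-- Summing the logarithms of the factors of `Θ_2` produces divisor sums, the coefficients of
Eisenstein series; factors of index greater than `i` do not contribute to the coefficient `i`. -/
theorem coeff_sum_thetaFactorLog {i J : ℕ} (hJ : i ≤ J) :
    coeff i (∑ v ∈ Finset.range J, thetaFactorLog BT BW v) = coeff i (thetaLog BT BW) := by
  rcases eq_or_ne i 0 with rfl | hi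
  · rw [coeff_zero_thetaLog, map_sum]
    refine Finset.sum_eq_zero fun v _ => ?_
    rw [coeff_thetaFactorLog]
    simp [coeff_zero_logChar]
  · rw [map_sum]
    simp only [coeff_thetaFactorLog]
    rw [Finset.sum_add_distrib, sum_range_even_divisors
        (fun d => coeff d ((symmetricPowers n).logChar (n + 1) BT)) hi hJ,
      sum_range_odd_divisors
        (fun d => (-1) ^ d * coeff d ((exteriorPowers N).logChar (n + 1) BW)) hi hJ,
      coeff_thetaLog _ _ hi, Finset.sum_sub_distrib, sub_eq_add_neg]
    congr 1
    · split_ifs with h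
      · rw [Finset.sum_comm]
        refine Finset.sum_congr rfl fun d hd => ?_
        have hd0 : d ≠ 0 := (Nat.pos_of_mem_divisors hd).ne'
        rw [SecondQuantization.logChar, coeff_mk, if_neg hd0, map_one, one_pow, one_mul,
          inv_smul_powerSum _ _ hd0]
      · rw [Finset.sum_const_zero]
    · rw [Finset.sum_comm, ← Finset.sum_neg_distrib]
      refine Finset.sum_congr rfl fun d hd => ?_
      have hd0 : d ≠ 0 := (Nat.pos_of_mem_divisors (Finset.mem_filter.mp hd).1).ne'
      obtain ⟨e, rfl⟩ := Nat.exists_eq_succ_of_ne_zero hd0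
      rw [SecondQuantization.logChar, coeff_mk, if_neg hd0, ← inv_smul_powerSum _ _ hd0, map_neg,
        map_one, Nat.succ_sub_one, ← mul_assoc, pow_succ, mul_assoc ((-1) ^ e), mul_comm (-1),
        ← mul_assoc, ← mul_pow]
      simp

theorem expand_exp_eq {S : Type*} [CommRing S] [Algebra ℚ S] {f : PowerSeries S}
    (hf : IsNilpotent f) {d : ℕ} (hd : d ≠ 0) (c : S) :
    expand d hd (rescale c (IsNilpotent.exp f)) =
      IsNilpotent.exp (expand d hd (rescale c f)) := by
  rw [IsNilpotent.map_exp hf (rescale c), IsNilpotent.map_exp (hf.map (rescale c)) (expand d hd)]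

/-- The ratio of total powers defining a reduced bundle, under a ring homomorphism sending the
powers to the characters of a second quantisation. -/
theorem map_reduced {S : Type*} [CommRing S] [Algebra ℂ S] [Algebra ℚ S] {K : ℕ} {τ : ℂ}
    (F : SecondQuantization K τ) {A : Type*} [CommRing A] (φ : A →+* S) {I : Ideal S} {m : ℕ}
    (hm : m ≠ 0) (hI : I ^ m = ⊥) {B : Matrix (Fin K) (Fin K) S} (hB : ∀ i j, B i j ∈ I)
    {a r : ℕ → A} (ha : ∀ k, φ (a k) = F.trExp k B) (hr : ∀ k, φ (r k) = Fintype.card (F.idx k))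
    (hr0 : r 0 = 1) (c : ℤ) {d : ℕ} (hd : d ≠ 0) :
    map φ (totalPower a c d * invOfUnit (totalPower r c d) 1) =
      IsNilpotent.exp (expand d hd (rescale (c : S) (F.logChar m B))) := by
  refine mul_map_invOfUnit φ ?_ ?_
  · rw [← coeff_zero_eq_constantCoeff_apply, totalPower, coeff_mk, if_pos (dvd_zero d)]
    simp [hr0]
  · rw [map_totalPower, map_totalPower, totalPower_eq _ _ _ hd, totalPower_eq _ _ _ hd,
      ← expand_exp_eq ⟨m, pow_eq_zero_of_coeff_mem hI (F.coeff_logChar_mem hB)⟩, ← map_mul,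
      ← map_mul]
    congr 2
    simp only [ha, hr]
    exact F.mk_trExp hm hI hB

theorem card_exteriorPowers_idx (N k : ℕ) :
    Fintype.card ((exteriorPowers N).idx k) = N.choose k := by
  have : Fintype.card {s : Finset (Fin N) // s.card = k} = N.choose k := by
    rw [Fintype.card_finset_len, Fintype.card_fin]
  rw [← this]
  exact Fintype.card_congr (Equiv.refl _)

theorem card_symmetricPowers_idx (N k : ℕ) :
    Fintype.card ((symmetricPowers N).idx k) = N.multichoose k := by
  rw [← Sym.card_sym_fin_eq_multichoose]
  exact Fintype.card_congr (Equiv.refl _)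

/-- The Chern character of `Θ_2`, for a flat `ξ`, is the exponential of a combination of traces of
powers of the curvatures whose coefficients are Eisenstein series. -/
theorem map_chernHom_theta2 (D : BundleTriple n N M) (p : Coord n) (hxi : chernMatrix D.xi p = 0) :
    map (chernHom D p) (theta2 n N M) =
      IsNilpotent.exp (thetaLog (chernMatrix D.T p) (chernMatrix D.W p)) := by
  have hT := chernMatrix_mem_evenIdeal D.T p
  have hW := chernMatrix_mem_evenIdeal D.W p
  have hI := evenIdeal_pow_eq_bot n
  have hX (g : Gen) : chernHom D p (MvPolynomial.X g) = genChern D p g := by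
    rw [chernHom, MvPolynomial.coe_eval₂Hom, MvPolynomial.eval₂_X]
  have hsym {d : ℕ} (hd : d ≠ 0) : map (chernHom D p) (symReduced n d) =
      IsNilpotent.exp (expand d hd ((symmetricPowers n).logChar (n + 1) (chernMatrix D.T p))) := by
    rw [symReduced, map_reduced (symmetricPowers n) (chernHom D p) (Nat.succ_ne_zero n) hI hT
      _ _ _ 1 hd]
    · simp
    · rintro (_ | k)
      · simp [SecondQuantization.trExp_zero]
      · rw [if_neg (Nat.succ_ne_zero k), hX]; rfl
    · intro k
      rw [map_natCast, card_symmetricPowers_idx]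
    · simp
  have hext {d : ℕ} (hd : d ≠ 0) (c : ℤ) : map (chernHom D p) (extWReduced N c d) =
      IsNilpotent.exp (expand d hd (rescale (c : evenForms n)
        ((exteriorPowers N).logChar (n + 1) (chernMatrix D.W p)))) := by
    rw [extWReduced, map_reduced (exteriorPowers N) (chernHom D p) (Nat.succ_ne_zero n) hI hW
      _ _ _ c hd]
    · rintro (_ | k)
      · simp [SecondQuantization.trExp_zero]
      · rw [if_neg (Nat.succ_ne_zero k), hX]; rfl
    · intro k
      rw [map_natCast, card_exteriorPowers_idx]
    · simp
  have hflat {d : ℕ} (hd : d ≠ 0) (c : ℤ) : map (chernHom D p) (extXiReduced M c d) = 1 := by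
    refine mul_map_invOfUnit _ ?_ ?_
    · rw [← coeff_zero_eq_constantCoeff_apply, totalPower, coeff_mk, if_pos (dvd_zero d)]
      simp
    · rw [map_totalPower, map_totalPower, mul_one]
      congr 1
      funext k
      rcases k with _ | k
      · simp
      · rw [if_neg (Nat.succ_ne_zero k), hX, map_natCast, ← card_exteriorPowers_idx]
        rw [genChern, hxi]
        exact (exteriorPowers M).trExp_matrix_zero (k + 1)
  have hflat' {d : ℕ} (hd : d ≠ 0) (c : ℤ) :
      map (chernHom D p) (invOfUnit (extXiReduced M c d) 1) = 1 := by
    have h1 : constantCoeff (extXiReduced M c d) = 1 := by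
      rw [extXiReduced, map_mul, constantCoeff_invOfUnit, ← coeff_zero_eq_constantCoeff_apply,
        totalPower, coeff_mk, if_pos (dvd_zero d)]
      simp
    have h2 : extXiReduced M c d * invOfUnit (extXiReduced M c d) 1 = 1 :=
      mul_invOfUnit _ 1 (by simpa using h1)
    have h3 := congrArg (map (chernHom D p)) h2
    rwa [map_mul, hflat hd, one_mul, map_one] at h3
  ext1 j
  rw [coeff_map, theta2, coeff_mk, ← coeff_map, map_prod,
    show Finset.Icc 1 (j + 1) = Finset.Ico 1 (j + 2) from rfl, Finset.prod_Ico_eq_prod_range]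
  have hfac (v : ℕ) : map (chernHom D p) (symReduced n (2 * (1 + v)) *
      (extWReduced N (-1) (2 * (1 + v) - 1) *
        invOfUnit (extXiReduced M (-1) (2 * (1 + v) - 1)) 1 ^ 2) *
      extXiReduced M 1 (2 * (1 + v) - 1) * extXiReduced M 1 (2 * (1 + v))) =
      IsNilpotent.exp (thetaFactorLog (chernMatrix D.T p) (chernMatrix D.W p) v) := by
    have h1 : 2 * (1 + v) ≠ 0 := by omega
    have h2 : 2 * (1 + v) - 1 ≠ 0 := by omega
    rw [map_mul, map_mul, map_mul, map_mul, map_pow, hflat h1, hflat h2, hflat' h2, hsym h1,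
      hext h2, one_pow, mul_one, mul_one, mul_one, thetaFactorLog,
      IsNilpotent.exp_add_of_commute (Commute.all _ _)]
    · simp only [add_comm 1 v, Int.cast_neg, Int.cast_one]
    · exact ⟨n + 1, pow_eq_zero_of_coeff_mem hI fun i => by
        rw [coeff_expand]
        split_ifs
        · exact SecondQuantization.coeff_logChar_mem _ hT _
        · exact Ideal.zero_mem _⟩
    · exact ⟨n + 1, pow_eq_zero_of_coeff_mem hI fun i => by
        rw [coeff_expand]
        split_ifs
        · rw [coeff_rescale]
          exact Ideal.mul_mem_left _ _ (SecondQuantization.coeff_logChar_mem _ hW _)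
        · exact Ideal.zero_mem _⟩
  simp only [hfac]
  have hmem (J i : ℕ) : coeff i (∑ v ∈ Finset.range J,
      thetaFactorLog (chernMatrix D.T p) (chernMatrix D.W p) v) ∈ evenIdeal n := by
    rw [map_sum]
    exact Ideal.sum_mem _ fun v _ => coeff_thetaFactorLog_mem hT hW v i
  rw [prod_exp_of_coeff_mem hI _ _ (coeff_thetaFactorLog_mem hT hW)]
  refine coeff_exp_congr (pow_eq_zero_of_coeff_mem hI (hmem _))
    (pow_eq_zero_of_coeff_mem hI fun i => ?_) fun i hi => coeff_sum_thetaFactorLog (by omega)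
  rw [← coeff_sum_thetaFactorLog le_rfl]
  exact hmem _ _

end ThetaSeries

/-! ### The forms `Â` and `det^{1/2} cosh` -/

section CharacteristicForms

open AnomalyCancellation PowerSeries

variable {n : ℕ}

theorem pow_eq_zero_of_mem_evenIdeal {y : evenForms n} (hy : y ∈ evenIdeal n) : y ^ (n + 1) = 0 := by
  have := Ideal.pow_mem_pow hy (n + 1)
  rwa [evenIdeal_pow_eq_bot, Ideal.mem_bot] at this

section Trace

variable {N : ℕ} {B : Matrix (Fin N) (Fin N) (evenForms n)}

theorem charTrace_mem_evenIdeal (hB : ∀ i j, B i j ∈ evenIdeal n) {k : ℕ} (hk : 1 ≤ k) :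
    charTrace B k ∈ evenIdeal n :=
  Submodule.smul_of_tower_mem _ _ (Ideal.sum_mem _ fun i _ =>
    Ideal.pow_le_self (Nat.one_le_iff_ne_zero.mp hk) (Matrix.pow_apply_mem hB k i i))

theorem charTrace_mem_evenDegree (hB : ∀ i j, B i j ∈ evenDegree n 1) (k : ℕ) :
    charTrace B k ∈ evenDegree n k :=
  Submodule.smul_mem _ _ (Submodule.sum_mem _ fun i _ => Matrix.pow_apply_mem_evenDegree hB k i i)

theorem charTrace_of_lt (hB : ∀ i j, B i j ∈ evenIdeal n) {k : ℕ} (hk : n < k) :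
    charTrace B k = 0 := by
  rw [charTrace, pow_eq_zero_of_le hk (Matrix.pow_eq_zero_of_mem (evenIdeal_pow_eq_bot n) hB),
    Matrix.trace_zero, smul_zero]

theorem sum_charTrace_mem (hB : ∀ i j, B i j ∈ evenIdeal n) (c : ℕ → ℂ) :
    ∑ k ∈ Finset.Ico 1 (n + 1), c k • charTrace B k ∈ evenIdeal n :=
  Ideal.sum_mem _ fun _ hk => Submodule.smul_of_tower_mem _ _
    (charTrace_mem_evenIdeal hB (Finset.mem_Ico.mp hk).1)

end Trace

variable (E : LocalBundle n) (p : Coord n)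

theorem trace_psEval (L : PowerSeries ℂ) {ι : Type*} [Fintype ι] [DecidableEq ι]
    (B : Matrix ι ι (evenForms n)) (hL : L.constantCoeff = 0) (c : ℂ) :
    Matrix.trace (psEval n L (c • B)) =
      ∑ k ∈ Finset.Ico 1 (n + 1), (L.coeff k * c ^ k) • Matrix.trace (B ^ k) := by
  rw [psEval, Matrix.trace_sum, Finset.range_eq_Ico,
    ← Finset.insert_Ico_add_one_left_eq_Ico (Nat.succ_pos n), Finset.sum_insert (by simp),
    coeff_zero_eq_constantCoeff_apply, hL, zero_smul, Matrix.trace_zero, zero_add]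
  refine Finset.sum_congr rfl fun k _ => ?_
  rw [smul_pow, smul_smul, Matrix.trace_smul]

/-- The form `det^{1/2} f` in terms of a logarithm `L` of `f`. -/
theorem AnomalyCancellation.LocalBundle.detHalf_eq {N : ℕ}
    (A : Fin n → Coord n → Matrix (Fin N) (Fin N) ℂ) {f L : PowerSeries ℂ}
    (hf : f.constantCoeff = 1) (hL : L.constantCoeff = 0)
    (h : f * derivative ℂ L = derivative ℂ f) :
    (⟨Fin N, A⟩ : LocalBundle n).detHalf f p =
      (IsNilpotent.exp (∑ k ∈ Finset.Ico 1 (n + 1),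
        (1 / 2 * (L.coeff k * (1 / 2) ^ k) * k.factorial) • charTrace (chernMatrix A p) k) :
        evenForms n) := by
  have hB : ∀ i j, chernMatrix A p i j ∈ evenIdeal n := chernMatrix_mem_evenIdeal A p
  have h1 : (Complex.I / (4 * Real.pi)) • (⟨Fin N, A⟩ : LocalBundle n).curvature p =
      (evenForms n).val.mapMatrix ((1 / 2 : ℂ) • chernMatrix A p) := by
    rw [LocalBundle.curvature_eq_map, chernMatrix, smul_smul, map_smul]
    congr 1
    field_simp
    norm_num
  have hnil : ((1 / 2 : ℂ) • chernMatrix A p) ^ (n + 1) = 0 := by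
    rw [smul_pow, chernMatrix_pow_eq_zero, smul_zero]
  have h2 : Matrix.trace (psEval n (PowerSeries.log ℂ) (psEval n f ((Complex.I / (4 * Real.pi)) •
      (⟨Fin N, A⟩ : LocalBundle n).curvature p) - 1)) = (evenForms n).val (Matrix.trace
        (psEval n L ((1 / 2 : ℂ) • chernMatrix A p))) := by
    rw [← psEval_log hnil hf hL h, h1, ← map_psEval]
    rw [show (1 : Matrix (Fin N) (Fin N) (Form n)) = (evenForms n).val.mapMatrix 1 from
      (map_one _).symm]
    change Matrix.trace (psEval n (PowerSeries.log ℂ) ((evenForms n).val.mapMatrix _ -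
      (evenForms n).val.mapMatrix 1)) = _
    rw [← map_sub, ← map_psEval]
    exact (AddMonoidHom.map_trace ((evenForms n).val : evenForms n →+ Form n) _).symm
  have h3 : (1 / 2 : ℂ) • Matrix.trace (psEval n L ((1 / 2 : ℂ) • chernMatrix A p)) =
      ∑ k ∈ Finset.Ico 1 (n + 1),
        (1 / 2 * (L.coeff k * (1 / 2) ^ k) * k.factorial) • charTrace (chernMatrix A p) k := by
    rw [trace_psEval L _ hL, Finset.smul_sum]
    refine Finset.sum_congr rfl fun k _ => ?_
    have : (k.factorial : ℂ) ≠ 0 := Nat.cast_ne_zero.mpr k.factorial_ne_zero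
    rw [charTrace, smul_smul, smul_smul]
    congr 1
    field_simp
  rw [LocalBundle.detHalf, h2, ← map_smul, ← map_psEval, h3,
    psEval_exp (pow_eq_zero_of_mem_evenIdeal (sum_charTrace_mem hB _))]
  rfl

variable {p} {N : ℕ} {A : Fin n → Coord n → Matrix (Fin N) (Fin N) ℂ}

theorem charTrace_of_odd (hodd : ∀ k, Odd k → Matrix.trace (chernMatrix A p ^ k) = 0) {k : ℕ}
    (hk : Odd k) : charTrace (chernMatrix A p) k = 0 := by
  rw [charTrace, hodd k hk, smul_zero]

/-- The logarithm of `Â`: the coefficients of `-log (sinh z / z)` are, up to normalisation, the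
constant terms `-B_k / 2k` of the Eisenstein series. -/
theorem AnomalyCancellation.LocalBundle.aHat_eq
    (hodd : ∀ k, Odd k → Matrix.trace (chernMatrix A p ^ k) = 0) :
    (⟨Fin N, A⟩ : LocalBundle n).aHat p = (IsNilpotent.exp (∑ k ∈ Finset.Ico 1 (n + 1),
      constantCoeff (eisensteinG k) • charTrace (chernMatrix A p) k) : evenForms n) := by
  have hf : constantCoeff (sinhcSeries⁻¹) = 1 := by
    rw [constantCoeff_inv, constantCoeff_sinhcSeries, inv_one]
  have hL : constantCoeff (-logSinhc) = 0 := by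
    rw [map_neg, ← coeff_zero_eq_constantCoeff_apply, logSinhc, coeff_mk, if_pos rfl, neg_zero]
  refine (LocalBundle.detHalf_eq p A hf hL inv_sinhcSeries_mul_derivative_neg_logSinhc).trans ?_
  congr 2
  refine Finset.sum_congr rfl fun k hk => ?_
  rcases Nat.even_or_odd k with hk2 | hk2
  · have h2 : 2 ≤ k := by
      obtain ⟨j, rfl⟩ := hk2
      have := (Finset.mem_Ico.mp hk).1
      omega
    congr 1
    have h3 : (k.factorial : ℂ) ≠ 0 := Nat.cast_ne_zero.mpr k.factorial_ne_zero
    have h4 : (k : ℂ) ≠ 0 := Nat.cast_ne_zero.mpr (by omega)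
    rw [map_neg, coeff_logSinhc h2, constantCoeff_eisensteinG, one_div, inv_pow]
    field_simp
  · rw [charTrace_of_odd hodd hk2, smul_zero, smul_zero]

/-- The logarithm of `det^{1/2} cosh`: since `cosh z` is the quotient of `sinh (2z) / (2z)` by
`sinh z / z`, the constant terms of the Eisenstein series are multiplied by `1 - 2ᵏ`. -/
theorem AnomalyCancellation.LocalBundle.detHalfTwoCosh_eq (l : ℕ)
    (hodd : ∀ k, Odd k → Matrix.trace (chernMatrix A p ^ k) = 0) :
    (⟨Fin N, A⟩ : LocalBundle n).detHalfTwoCosh l p =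
      (2 : ℂ) ^ l • (IsNilpotent.exp (∑ k ∈ Finset.Ico 1 (n + 1),
        ((1 - 2 ^ k) * constantCoeff (eisensteinG k)) • charTrace (chernMatrix A p) k) :
          evenForms n) := by
  have hL : constantCoeff logCosh = 0 := by
    rw [← coeff_zero_eq_constantCoeff_apply, logCosh, coeff_mk, pow_zero, sub_self, zero_mul]
  refine congrArg (fun z => (2 : ℂ) ^ l • z) ((LocalBundle.detHalf_eq p A constantCoeff_coshSeries hL
    coshSeries_mul_derivative_logCosh).trans ?_)
  congr 2
  refine Finset.sum_congr rfl fun k hk => ?_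
  rcases Nat.even_or_odd k with hk2 | hk2
  · have h2 : 2 ≤ k := by
      obtain ⟨j, rfl⟩ := hk2
      have := (Finset.mem_Ico.mp hk).1
      omega
    congr 1
    have h3 : (k.factorial : ℂ) ≠ 0 := Nat.cast_ne_zero.mpr k.factorial_ne_zero
    have h4 : (k : ℂ) ≠ 0 := Nat.cast_ne_zero.mpr (by omega)
    rw [logCosh, coeff_mk, coeff_logSinhc h2, constantCoeff_eisensteinG, one_div, inv_pow]
    field_simp
    ring
  · rw [charTrace_of_odd hodd hk2, smul_zero, smul_zero]

theorem AnomalyCancellation.LocalBundle.p1_eq :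
    (⟨Fin N, A⟩ : LocalBundle n).p1 p = (charTrace (chernMatrix A p) 2 : evenForms n) := by
  rw [LocalBundle.p1, LocalBundle.curvature_eq_map, charTrace, chernMatrix, smul_pow,
    Matrix.trace_smul, smul_smul]
  refine Eq.trans ?_ (map_smul (evenForms n).val _ _).symm
  have h : (1 / ((2 : ℕ).factorial : ℂ)) * (Complex.I / (2 * Real.pi)) ^ 2 =
      -1 / (8 * (Real.pi : ℂ) ^ 2) := by
    have : (Real.pi : ℂ) ≠ 0 := Complex.ofReal_ne_zero.mpr Real.pi_ne_zero
    rw [div_pow, Complex.I_sq, Nat.factorial_two]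
    push_cast
    field_simp
    norm_num
  rw [h]
  congr 1
  change Matrix.trace (((evenForms n).val.mapMatrix (evenCurvature A p)) ^ 2) = _
  rw [← map_pow]
  exact (AddMonoidHom.map_trace ((evenForms n).val : evenForms n →+ Form n) _).symm

end CharacteristicForms

/-! ### Modular forms with values in even forms -/

section ModularPairs

open AnomalyCancellation PowerSeries

variable {n : ℕ}

/-- A modular form, given by its expansions at the two cusps, times an even form. -/
noncomputable def pairForm (x : PowerSeries ℂ × ℂ) (t : evenForms n) :
    PowerSeries (evenForms n) × evenForms n :=
  (map (algebraMap ℂ (evenForms n)) x.1 * C t, x.2 • t)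

theorem pairForm_add_left (x y : PowerSeries ℂ × ℂ) (t : evenForms n) :
    pairForm (x + y) t = pairForm x t + pairForm y t := by
  simp only [pairForm, Prod.fst_add, Prod.snd_add, map_add, add_mul, add_smul, Prod.mk_add_mk]

theorem pairForm_zero_right (x : PowerSeries ℂ × ℂ) : pairForm x (0 : evenForms n) = 0 := by
  simp only [pairForm, map_zero, mul_zero, smul_zero, Prod.mk_zero_zero]

theorem pairForm_mul (x y : PowerSeries ℂ × ℂ) (s t : evenForms n) :
    pairForm x s * pairForm y t = pairForm (x * y) (s * t) := by
  simp only [pairForm, Prod.mk_mul_mk, Prod.fst_mul, Prod.snd_mul, map_mul, smul_mul_smul_comm,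
    mul_mul_mul_comm]

/-- Pairs of expansions, at the two cusps, of modular forms with values in even forms, in which the
component of degree `4 w` has weight `2 w`. -/
noncomputable def formPairs (n : ℕ) : Submodule ℂ (PowerSeries (evenForms n) × evenForms n) :=
  Submodule.span ℂ {z | ∃ w x t, x ∈ cuspPairs w ∧ t ∈ evenDegree n (2 * w) ∧ z = pairForm x t}

theorem pairForm_mem_formPairs {w : ℕ} {x : PowerSeries ℂ × ℂ} {t : evenForms n}
    (hx : x ∈ cuspPairs w) (ht : t ∈ evenDegree n (2 * w)) : pairForm x t ∈ formPairs n :=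
  Submodule.subset_span ⟨w, x, t, hx, ht, rfl⟩

theorem mul_mem_formPairs {y z : PowerSeries (evenForms n) × evenForms n} (hy : y ∈ formPairs n)
    (hz : z ∈ formPairs n) : y * z ∈ formPairs n := by
  have h := Submodule.mul_mem_mul hy hz
  rw [formPairs, Submodule.span_mul_span] at h
  refine Submodule.span_mono ?_ h
  rintro _ ⟨_, ⟨v, x, s, hx, hs, rfl⟩, _, ⟨w, y, t, hy, ht, rfl⟩, rfl⟩
  refine ⟨v + w, x * y, s * t, mul_mem_cuspPairs hx hy, ?_, pairForm_mul x y s t⟩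
  rw [mul_add]
  exact mul_mem_evenDegree hs ht

theorem one_mem_formPairs : (1 : PowerSeries (evenForms n) × evenForms n) ∈ formPairs n := by
  have h := pairForm_mem_formPairs (n := n) one_mem_cuspPairs one_mem_evenDegree
  have h1 : pairForm (1 : PowerSeries ℂ × ℂ) (1 : evenForms n) = 1 := by
    simp only [pairForm, Prod.fst_one, Prod.snd_one, map_one, mul_one, one_smul, Prod.mk_one_one]
  rwa [h1] at h

theorem exp_mem_formPairs {f : PowerSeries (evenForms n)} {s : evenForms n} {m : ℕ}
    (hf : f ^ m = 0) (hs : s ^ m = 0) (h : (f, s) ∈ formPairs n) :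
    (IsNilpotent.exp f, IsNilpotent.exp s) ∈ formPairs n := by
  have hpow (i : ℕ) : (f, s) ^ i ∈ formPairs n := by
    induction i with
    | zero => rw [pow_zero]; exact one_mem_formPairs
    | succ i ih => rw [pow_succ]; exact mul_mem_formPairs ih h
  have : (IsNilpotent.exp f, IsNilpotent.exp s) =
      ∑ i ∈ Finset.range m, ((i.factorial : ℂ)⁻¹) • (f, s) ^ i := by
    rw [IsNilpotent.exp_eq_sum hf, IsNilpotent.exp_eq_sum hs]
    ext1
    · dsimp only
      rw [Prod.fst_sum]
      refine Finset.sum_congr rfl fun i _ => ?_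
      rw [← Rat.cast_smul_eq_qsmul ℂ, Rat.cast_inv, Rat.cast_natCast]
      rfl
    · dsimp only
      rw [Prod.snd_sum]
      refine Finset.sum_congr rfl fun i _ => ?_
      rw [← Rat.cast_smul_eq_qsmul ℂ, Rat.cast_inv, Rat.cast_natCast]
      rfl
  rw [this]
  exact Submodule.sum_mem _ fun i _ => Submodule.smul_mem _ _ (hpow i)

/-- A form of weight `2 w` is a combination of the monomials `(8 δ_2)^{w-2r} ε_2^r`, `0 ≤ r ≤ m`; as
`w ≤ 2 m + 1`, these are all the monomials of this weight. -/
theorem exists_coeff_of_mem_cuspPairs {w m : ℕ} (hw : w ≤ 2 * m + 1) {x : PowerSeries ℂ × ℂ}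
    (hx : x ∈ cuspPairs w) : ∃ c : Fin (m + 1) → ℂ,
      (∀ j, coeff j x.1 = ∑ r : Fin (m + 1),
        ((coeff j (eightDelta2 ^ (w - 2 * (r : ℕ)) * eps2 ^ (r : ℕ)) : ℤ) : ℂ) * c r) ∧
      x.2 = ∑ r : Fin (m + 1), (2 ^ (w - 2 * (r : ℕ)) * (1 / 16) ^ (r : ℕ)) * c r := by
  refine Submodule.span_induction ?_ ?_ ?_ ?_ hx
  · rintro _ ⟨a, b, rfl, rfl⟩
    refine ⟨Pi.single ⟨b, by omega⟩ 1, fun j => ?_, ?_⟩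
    · rw [Finset.sum_eq_single ⟨b, by omega⟩ (fun r _ hr => by
        rw [Pi.single_eq_of_ne hr, mul_zero]) (by simp)]
      simp only [Pi.single_eq_same, mul_one, Nat.add_sub_cancel]
      rw [deltaC, epsC, ← map_pow, ← map_pow, ← map_mul, coeff_map]
      rfl
    · rw [Finset.sum_eq_single ⟨b, by omega⟩ (fun r _ hr => by
        rw [Pi.single_eq_of_ne hr, mul_zero]) (by simp)]
      simp only [Pi.single_eq_same, mul_one, Nat.add_sub_cancel]
  · exact ⟨0, fun j => by simp, by simp⟩
  · rintro x y _ _ ⟨c, hc1, hc2⟩ ⟨d, hd1, hd2⟩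
    refine ⟨c + d, fun j => ?_, ?_⟩
    · simp only [Prod.fst_add, map_add, hc1, hd1, Pi.add_apply, mul_add, Finset.sum_add_distrib]
    · simp only [Prod.snd_add, hc2, hd2, Pi.add_apply, mul_add, Finset.sum_add_distrib]
  · rintro a x _ ⟨c, hc1, hc2⟩
    refine ⟨a • c, fun j => ?_, ?_⟩
    · simp only [Prod.smul_fst, coeff_smul, hc1, Pi.smul_apply, smul_eq_mul, Finset.mul_sum,
        mul_left_comm]
    · simp only [Prod.smul_snd, hc2, Pi.smul_apply, smul_eq_mul, Finset.mul_sum, mul_left_comm]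

/-- The component of degree `4 w` of a modular form in even forms is a combination of the monomials
of weight `2 w` in `8 δ_2` and `ε_2`, with the same coefficients at both cusps. -/
theorem exists_degPart_of_mem_formPairs {w m : ℕ} (hw : w ≤ 2 * m + 1)
    {z : PowerSeries (evenForms n) × evenForms n} (hz : z ∈ formPairs n) :
    ∃ h : Fin (m + 1) → Form n,
      (∀ j, degPart ((2 * (2 * w) : ℕ) : ℤ) ((coeff j z.1 : evenForms n) : Form n) = ∑ r : Fin (m + 1),
        ((coeff j (eightDelta2 ^ (w - 2 * (r : ℕ)) * eps2 ^ (r : ℕ)) : ℤ) : ℂ) • h r) ∧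
      degPart ((2 * (2 * w) : ℕ) : ℤ) (z.2 : Form n) =
        ∑ r : Fin (m + 1), ((2 : ℂ) ^ (w - 2 * (r : ℕ)) * (1 / 16) ^ (r : ℕ)) • h r := by
  set L : evenForms n →ₗ[ℂ] Form n :=
    (degPartLin ((2 * (2 * w) : ℕ) : ℤ)).comp (evenForms n).val.toLinearMap
  change ∃ h : Fin (m + 1) → Form n, (∀ j, L (coeff j z.1) = _) ∧ L z.2 = _
  refine Submodule.span_induction ?_ ?_ ?_ ?_ hz
  · rintro _ ⟨v, x, t, hx, ht, rfl⟩
    have h1 (j : ℕ) : L (coeff j (pairForm x t).1) = coeff j x.1 • L t := by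
      rw [pairForm, coeff_mul_C, coeff_map, ← Algebra.smul_def, map_smul]
    have h2 : L (pairForm x t).2 = x.2 • L t := by rw [pairForm, map_smul]
    simp only [h1, h2]
    by_cases hv : v = w
    · subst hv
      obtain ⟨c, hc1, hc2⟩ := exists_coeff_of_mem_cuspPairs hw hx
      refine ⟨fun r => c r • L t, fun j => ?_, ?_⟩
      · simp only [hc1, Finset.sum_smul, smul_smul]
      · simp only [hc2, Finset.sum_smul, smul_smul]
    · have h3 : L t = 0 := by
        change degPart ((2 * (2 * w) : ℕ) : ℤ) (t : Form n) = 0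
        exact degPart_of_mem_of_ne (mem_evenDegree.mp ht) (by omega)
      exact ⟨0, fun j => by simp [h3], by simp [h3]⟩
  · exact ⟨0, fun j => by simp, by simp⟩
  · rintro x y _ _ ⟨c, hc1, hc2⟩ ⟨d, hd1, hd2⟩
    refine ⟨c + d, fun j => ?_, ?_⟩
    · simp only [Prod.fst_add, map_add, hc1, hd1, Pi.add_apply, smul_add, Finset.sum_add_distrib]
    · simp only [Prod.snd_add, map_add, hc2, hd2, Pi.add_apply, smul_add, Finset.sum_add_distrib]
  · rintro a x _ ⟨c, hc1, hc2⟩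
    refine ⟨a • c, fun j => ?_, ?_⟩
    · simp only [Prod.smul_fst, coeff_smul, map_smul, hc1, Pi.smul_apply, Finset.smul_sum,
        smul_comm a]
    · simp only [Prod.smul_snd, map_smul, hc2, Pi.smul_apply, Finset.smul_sum, smul_comm a]

variable {N : ℕ} {BT : Matrix (Fin n) (Fin n) (evenForms n)}
  {BW : Matrix (Fin N) (Fin N) (evenForms n)}

/-- The exponents at the two cusps of `exp (E_2 x / 24) Â(TX) ch(Θ_2)` and of
`exp (x / 24) Â(TX) det^{1/2} cosh`: the quasimodular terms in `E_2` cancel. -/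
theorem exponent_mem_formPairs (hT : ∀ i j, BT i j ∈ evenDegree n 1)
    (hW : ∀ i j, BW i j ∈ evenDegree n 1) (hTI : ∀ i j, BT i j ∈ evenIdeal n)
    (hWI : ∀ i j, BW i j ∈ evenIdeal n) (hTodd : ∀ k, Odd k → charTrace BT k = 0)
    (hWodd : ∀ k, Odd k → charTrace BW k = 0) :
    (map (algebraMap ℂ (evenForms n)) (-expand 2 two_ne_zero (eisensteinG 2)) *
        C (charTrace BT 2 - charTrace BW 2) +
      C (∑ k ∈ Finset.Ico 1 (n + 1), constantCoeff (eisensteinG k) • charTrace BT k) +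
        thetaLog BT BW,
     (1 / 24 : ℂ) • (charTrace BT 2 - charTrace BW 2) +
      ∑ k ∈ Finset.Ico 1 (n + 1), constantCoeff (eisensteinG k) • charTrace BT k +
      ∑ k ∈ Finset.Ico 1 (n + 1), ((1 - 2 ^ k) * constantCoeff (eisensteinG k)) • charTrace BW k)
      ∈ formPairs n := by
  set a : ℕ → PowerSeries ℂ × ℂ := fun k =>
    (expand 2 two_ne_zero (eisensteinG k), constantCoeff (eisensteinG k)) with ha
  set b : ℕ → PowerSeries ℂ × ℂ := fun k =>
    (expand 2 two_ne_zero (eisensteinG k) - eisensteinG k,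
      (1 - 2 ^ k) * constantCoeff (eisensteinG k)) with hb
  have hc2 : constantCoeff (eisensteinG 2) = -(1 / 24) := by
    rw [constantCoeff_eisensteinG, bernoulli_two]; norm_num
  have hdecomp : (map (algebraMap ℂ (evenForms n)) (-expand 2 two_ne_zero (eisensteinG 2)) *
        C (charTrace BT 2 - charTrace BW 2) +
      C (∑ k ∈ Finset.Ico 1 (n + 1), constantCoeff (eisensteinG k) • charTrace BT k) +
        thetaLog BT BW,
     (1 / 24 : ℂ) • (charTrace BT 2 - charTrace BW 2) +
      ∑ k ∈ Finset.Ico 1 (n + 1), constantCoeff (eisensteinG k) • charTrace BT k +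
      ∑ k ∈ Finset.Ico 1 (n + 1), ((1 - 2 ^ k) * constantCoeff (eisensteinG k)) • charTrace BW k) =
      ∑ k ∈ Finset.Ico 1 (n + 1), (pairForm (a k) (charTrace BT k) +
        pairForm (b k) (charTrace BW k)) - pairForm (a 2) (charTrace BT 2) +
        pairForm (a 2) (charTrace BW 2) := by
    ext1
    · simp only [Prod.fst_add, Prod.fst_sub, Prod.fst_sum, thetaLog, map_sum, pairForm, ha, hb]
      have : ∑ k ∈ Finset.Ico 1 (n + 1),
          (map (algebraMap ℂ (evenForms n)) (expand 2 two_ne_zero (eisensteinG k)) *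
            C (charTrace BT k) + map (algebraMap ℂ (evenForms n))
              (expand 2 two_ne_zero (eisensteinG k) - eisensteinG k) * C (charTrace BW k)) =
          ∑ k ∈ Finset.Ico 1 (n + 1), C (constantCoeff (eisensteinG k) • charTrace BT k) +
          ∑ k ∈ Finset.Ico 1 (n + 1),
            (map (algebraMap ℂ (evenForms n)) (expand 2 two_ne_zero (eisensteinG k) -
                C (constantCoeff (eisensteinG k))) * C (charTrace BT k) -
              map (algebraMap ℂ (evenForms n))
                (eisensteinG k - expand 2 two_ne_zero (eisensteinG k)) * C (charTrace BW k)) := by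
        rw [← Finset.sum_add_distrib]
        refine Finset.sum_congr rfl fun k _ => ?_
        rw [Algebra.smul_def, map_mul, map_sub, map_sub, map_sub, map_C]
        ring
      rw [this, map_sub, map_neg]
      ring
    · simp only [Prod.snd_add, Prod.snd_sub, Prod.snd_sum, pairForm, ha, hb,
        Finset.sum_add_distrib, hc2, smul_sub, neg_smul]
      abel
  have hk (k : ℕ) (hk1 : 1 ≤ k) (hk2 : k ≠ 2) :
      pairForm (a k) (charTrace BT k) + pairForm (b k) (charTrace BW k) ∈ formPairs n := by
    rcases Nat.even_or_odd k with he | ho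
    · obtain ⟨w, rfl⟩ := he.two_dvd
      have hw : 2 ≤ w := by omega
      have h1 : a (2 * w) ∈ cuspPairs w := by
        simp only [ha, constantCoeff_eisensteinG]
        exact expand_eisensteinG_mem_cuspPairs hw
      have h2 : b (2 * w) ∈ cuspPairs w := by
        have h3 := Submodule.sub_mem _ (expand_eisensteinG_mem_cuspPairs hw)
          (eisensteinG_mem_cuspPairs hw)
        rw [Prod.mk_sub_mk] at h3
        simp only [hb, constantCoeff_eisensteinG, sub_mul, one_mul]
        exact h3
      exact Submodule.add_mem _ (pairForm_mem_formPairs h1 (charTrace_mem_evenDegree hT _))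
        (pairForm_mem_formPairs h2 (charTrace_mem_evenDegree hW _))
    · rw [hTodd k ho, hWodd k ho, pairForm_zero_right, pairForm_zero_right, add_zero]
      exact Submodule.zero_mem _
  -- In degree four the two occurrences of `E_2` combine to the modular form `δ_2`.
  have hab : a 2 + b 2 ∈ cuspPairs 1 := by
    have : a 2 + b 2 = (1 / 24 : ℂ) • ((deltaC, 2) : PowerSeries ℂ × ℂ) := by
      ext1
      · simp only [ha, hb, Prod.fst_add, Prod.smul_fst, deltaC_eq]
        module
      · simp only [ha, hb, Prod.snd_add, Prod.smul_snd, hc2]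
        norm_num
    rw [this]
    exact Submodule.smul_mem _ _ deltaC_mem_cuspPairs
  rw [hdecomp]
  by_cases h2 : 2 ∈ Finset.Ico 1 (n + 1)
  · rw [← Finset.add_sum_erase _ _ h2]
    have : ∀ S : PowerSeries (evenForms n) × evenForms n,
        pairForm (a 2) (charTrace BT 2) + pairForm (b 2) (charTrace BW 2) + S -
          pairForm (a 2) (charTrace BT 2) + pairForm (a 2) (charTrace BW 2) =
        pairForm (a 2 + b 2) (charTrace BW 2) + S := by
      intro S
      rw [pairForm_add_left]
      abel
    rw [this]
    refine Submodule.add_mem _ (pairForm_mem_formPairs hab (charTrace_mem_evenDegree hW _))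
      (Submodule.sum_mem _ fun k hk' => ?_)
    rw [Finset.mem_erase, Finset.mem_Ico] at hk'
    exact hk k hk'.2.1 hk'.1
  · have hn : n < 2 := by
      rw [Finset.mem_Ico] at h2
      omega
    rw [charTrace_of_lt hTI hn, charTrace_of_lt hWI hn, pairForm_zero_right, sub_zero, add_zero]
    refine Submodule.sum_mem _ fun k hk' => hk k (Finset.mem_Ico.mp hk').1 ?_
    rintro rfl
    exact h2 hk'

end ModularPairs

/-! ### The cancellation formula -/

section CancellationFormula

open AnomalyCancellation PowerSeries

theorem exp_eq_one_add_sum {S : Type*} [CommRing S] [Algebra ℂ S] [Algebra ℚ S] {y : S} {m : ℕ}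
    (hy : y ^ (m + 1) = 0) :
    IsNilpotent.exp y =
      1 + ∑ k ∈ Finset.range (m + 1), ((k + 1).factorial : ℂ)⁻¹ • y ^ (k + 1) := by
  rw [IsNilpotent.exp_eq_sum (pow_eq_zero_of_le (Nat.le_succ (m + 1)) hy), Finset.sum_range_succ',
    add_comm, pow_zero, Nat.factorial_zero, Nat.cast_one, inv_one, one_smul]
  refine congrArg _ (Finset.sum_congr rfl fun k _ => ?_)
  rw [← Rat.cast_smul_eq_qsmul ℂ, Rat.cast_inv, Rat.cast_natCast]

theorem isExpansion_iff {R : Type*} [Ring R] {m w : ℕ} {F : PowerSeries R} {b : Fin (m + 1) → R} :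
    IsExpansion m w F b ↔ ∀ j ≤ m, coeff j F = ∑ r : Fin (m + 1),
      coeff j (eightDelta2 ^ (w - 2 * (r : ℕ)) * eps2 ^ (r : ℕ)) • b r := by
  simp only [IsExpansion, map_sum, coeff_C_mul, coeff_map, eq_intCast, zsmul_eq_mul, Int.cast_comm]

theorem neg_expand_eisensteinG_two {S : Type*} [CommRing S] [Algebra ℂ S] :
    map (algebraMap ℂ S) (-expand 2 two_ne_zero (eisensteinG 2)) =
      (1 / 24 : ℂ) • map (Int.castRingHom S) eisenstein2 := by
  ext1 j
  have h : coeff j (-expand 2 two_ne_zero (eisensteinG 2)) =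
      (1 / 24 : ℂ) * ((coeff j eisenstein2 : ℤ) : ℂ) := by
    rw [map_neg, coeff_expand, eisenstein2, coeff_mk]
    by_cases hj : j = 0
    · subst hj
      simp [eisensteinG, bernoulli_two]
      norm_num
    · by_cases h2 : 2 ∣ j
      · have h3 : j / 2 ≠ 0 := by omega
        simp [eisensteinG, hj, h2, h3, ArithmeticFunction.sigma_apply]
      · simp [hj, h2]
  rw [coeff_map, h, map_mul, coeff_smul, coeff_map, Algebra.smul_def, map_intCast, eq_intCast]

variable {n N M : ℕ} (D : BundleTriple n N M) (p : Coord n)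

/-- The form `p_1(TX) - p_1(W)`, as an even form. -/
noncomputable def evenP1Diff : evenForms n :=
  charTrace (chernMatrix D.T p) 2 - charTrace (chernMatrix D.W p) 2

theorem p1Diff_eq : D.p1Diff p = (evenP1Diff D p : evenForms n) := by
  rw [BundleTriple.p1Diff, BundleTriple.tangent, BundleTriple.aux, LocalBundle.p1_eq,
    LocalBundle.p1_eq]
  rfl

theorem evenP1Diff_mem_evenIdeal : evenP1Diff D p ∈ evenIdeal n :=
  Ideal.sub_mem _ (charTrace_mem_evenIdeal (chernMatrix_mem_evenIdeal D.T p) one_le_two)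
    (charTrace_mem_evenIdeal (chernMatrix_mem_evenIdeal D.W p) one_le_two)

theorem evenP1Diff_mem_evenDegree : evenP1Diff D p ∈ evenDegree n 2 :=
  Submodule.sub_mem _ (charTrace_mem_evenDegree (chernMatrix_mem_evenDegree D.T p) 2)
    (charTrace_mem_evenDegree (chernMatrix_mem_evenDegree D.W p) 2)

/-- The form `e^{x/24} - 1` is `x` times the quotient `(e^{x/24} - 1) / x`. -/
theorem exists_exp_evenP1Diff : ∃ q : evenForms n, D.expQuot p = (q : Form n) ∧
    IsNilpotent.exp ((1 / 24 : ℂ) • evenP1Diff D p) = 1 + evenP1Diff D p * q := by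
  refine ⟨psEval n (mk fun k => 1 / ((24 : ℂ) ^ (k + 1) * ((k + 1).factorial : ℂ)))
    (evenP1Diff D p), ?_, ?_⟩
  · rw [BundleTriple.expQuot, p1Diff_eq]
    exact (map_psEval (n := n) (evenForms n).val _ (evenP1Diff D p)).symm
  · have hx := pow_eq_zero_of_mem_evenIdeal (evenP1Diff_mem_evenIdeal D p)
    rw [exp_eq_one_add_sum (m := n) (by rw [smul_pow, hx, smul_zero]), psEval, Finset.mul_sum]
    refine congrArg _ (Finset.sum_congr rfl fun k _ => ?_)
    rw [coeff_mk, smul_pow, smul_smul, mul_smul_comm, ← pow_succ']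
    congr 1
    rw [one_div_pow, one_div, one_div, mul_inv, mul_comm]

/-- The series `e^{E_2 x/24} - 1` is `x` times the quotient `(e^{E_2 x/24} - 1) / x`; here
`E_2 / 24 = -G_2`. -/
theorem exists_exp_eisenstein2_evenP1Diff : ∃ q : PowerSeries (evenForms n),
    D.expQuotE2 p = map (evenForms n).val.toRingHom q ∧
    IsNilpotent.exp (map (algebraMap ℂ (evenForms n)) (-expand 2 two_ne_zero (eisensteinG 2)) *
      C (evenP1Diff D p)) = 1 + C (evenP1Diff D p) * q := by
  refine ⟨∑ k ∈ Finset.range (n + 1), map (Int.castRingHom (evenForms n)) (eisenstein2 ^ (k + 1)) *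
    C ((1 / ((24 : ℂ) ^ (k + 1) * ((k + 1).factorial : ℂ))) • evenP1Diff D p ^ k), ?_, ?_⟩
  · rw [BundleTriple.expQuotE2, p1Diff_eq, map_sum]
    refine Finset.sum_congr rfl fun k _ => ?_
    rw [map_mul, map_C]
    congr 1
  · have hx := pow_eq_zero_of_mem_evenIdeal (evenP1Diff_mem_evenIdeal D p)
    rw [exp_eq_one_add_sum (m := n) (by rw [mul_pow, ← map_pow C, hx, map_zero, mul_zero]),
      Finset.mul_sum]
    refine congrArg _ (Finset.sum_congr rfl fun k _ => ?_)
    rw [neg_expand_eisensteinG_two, smul_mul_assoc, smul_pow, smul_smul, mul_pow, ← map_pow,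
      mul_left_comm, ← map_mul C, mul_smul_comm, ← pow_succ', ← map_pow]
    ext1 j
    rw [coeff_smul, coeff_mul_C, coeff_mul_C, mul_smul_comm]
    congr 1
    rw [one_div_pow, one_div, one_div, mul_inv, mul_comm]

/-- The cancellation formula in degree `4 w`, for connections whose curvatures have vanishing odd power
traces and a flat `ξ`. -/
theorem anomaly_cancellation (hTd : ∀ a, MatrixDifferentiableAt (D.T a) p)
    (hWd : ∀ a, MatrixDifferentiableAt (D.W a) p) (hxid : ∀ a, MatrixDifferentiableAt (D.xi a) p)
    (hTodd : ∀ k, Odd k → Matrix.trace (chernMatrix D.T p ^ k) = 0)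
    (hWodd : ∀ k, Odd k → Matrix.trace (chernMatrix D.W p ^ k) = 0)
    (hxi : chernMatrix D.xi p = 0) (l : ℕ) {m w : ℕ} (hw : 2 * m ≤ w) (hw' : w ≤ 2 * m + 1) :
    degPart (4 * w) (D.tangent.aHat p * D.aux.detHalfTwoCosh l p) -
        ∑ r : Fin (m + 1), (2 : ℂ) ^ ((l : ℤ) + w - 6 * (r : ℕ)) • degPart (4 * w)
          (D.tangent.aHat p * D.ch p (expansion m w (theta2 n N M) r)) =
      D.p1Diff p * (∑ r : Fin (m + 1), (2 : ℂ) ^ ((l : ℤ) + w - 6 * (r : ℕ)) •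
          expansion m w (D.quotSeries (4 * w - 4) p) r -
        degPart (4 * w - 4)
          (D.expQuot p * (D.tangent.aHat p * D.aux.detHalfTwoCosh l p))) := by
  have hTI := chernMatrix_mem_evenIdeal D.T p
  have hWI := chernMatrix_mem_evenIdeal D.W p
  have hI := evenIdeal_pow_eq_bot n
  set x : evenForms n := evenP1Diff D p with hx
  set s : evenForms n := ∑ k ∈ Finset.Ico 1 (n + 1), constantCoeff (eisensteinG k) •
    charTrace (chernMatrix D.T p) k with hs
  set t : evenForms n := ∑ k ∈ Finset.Ico 1 (n + 1),
    ((1 - 2 ^ k) * constantCoeff (eisensteinG k)) • charTrace (chernMatrix D.W p) k with ht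
  set θ : PowerSeries (evenForms n) := thetaLog (chernMatrix D.T p) (chernMatrix D.W p) with hθ
  set u : PowerSeries (evenForms n) :=
    map (algebraMap ℂ (evenForms n)) (-expand 2 two_ne_zero (eisensteinG 2)) * C x with hu
  have haHat : D.tangent.aHat p = (IsNilpotent.exp s : evenForms n) :=
    LocalBundle.aHat_eq hTodd
  have hcosh : D.aux.detHalfTwoCosh l p = (2 : ℂ) ^ l • ((IsNilpotent.exp t : evenForms n) :
    Form n) := LocalBundle.detHalfTwoCosh_eq l hWodd
  obtain ⟨q, hq1, hq2⟩ := exists_exp_evenP1Diff D p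
  obtain ⟨Q, hQ1, hQ2⟩ := exists_exp_eisenstein2_evenP1Diff D p
  have hxI : x ∈ evenIdeal n := evenP1Diff_mem_evenIdeal D p
  have hsI : s ∈ evenIdeal n := sum_charTrace_mem hTI _
  have htI : t ∈ evenIdeal n := sum_charTrace_mem hWI _
  have hθI (i : ℕ) : coeff i θ ∈ evenIdeal n := by
    rw [hθ, ← coeff_sum_thetaFactorLog le_rfl, map_sum]
    exact Ideal.sum_mem _ fun v _ => coeff_thetaFactorLog_mem hTI hWI v i
  have huI (i : ℕ) : coeff i u ∈ evenIdeal n := by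
    rw [hu, coeff_mul_C]
    exact Ideal.mul_mem_left _ _ hxI
  have hCI (i : ℕ) : coeff i (C s) ∈ evenIdeal n := by
    rw [coeff_C]
    split_ifs
    · exact hsI
    · exact Ideal.zero_mem _
  have hnil {f : PowerSeries (evenForms n)} (hf : ∀ i, coeff i f ∈ evenIdeal n) :
      f ^ (n + 1) = 0 := pow_eq_zero_of_coeff_mem hI hf
  have hx24 : (1 / 24 : ℂ) • x ∈ evenIdeal n := Submodule.smul_of_tower_mem _ _ hxI
  have h1I : (1 / 24 : ℂ) • x + s + t ∈ evenIdeal n :=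
    Ideal.add_mem _ (Ideal.add_mem _ hx24 hsI) htI
  have h2I (i : ℕ) : coeff i (u + C s + θ) ∈ evenIdeal n := by
    rw [map_add, map_add]
    exact Ideal.add_mem _ (Ideal.add_mem _ (huI i) (hCI i)) (hθI i)
  -- The exponentials at the two cusps.
  have hE1 : IsNilpotent.exp ((1 / 24 : ℂ) • x + s + t) =
      IsNilpotent.exp s * IsNilpotent.exp t + x * (q * (IsNilpotent.exp s * IsNilpotent.exp t)) := by
    rw [IsNilpotent.exp_add_of_commute (Commute.all _ _)
        ⟨_, pow_eq_zero_of_mem_evenIdeal (Ideal.add_mem _ hx24 hsI)⟩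
        ⟨_, pow_eq_zero_of_mem_evenIdeal htI⟩,
      IsNilpotent.exp_add_of_commute (Commute.all _ _) ⟨_, pow_eq_zero_of_mem_evenIdeal hx24⟩
        ⟨_, pow_eq_zero_of_mem_evenIdeal hsI⟩, hq2]
    ring
  have hE2 : IsNilpotent.exp (u + C s + θ) =
      C (IsNilpotent.exp s) * IsNilpotent.exp θ +
        C x * (Q * C (IsNilpotent.exp s) * IsNilpotent.exp θ) := by
    rw [IsNilpotent.exp_add_of_commute (Commute.all _ _)
        ⟨n + 1, hnil fun i => by rw [map_add]; exact Ideal.add_mem _ (huI i) (hCI i)⟩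
        ⟨_, hnil hθI⟩,
      IsNilpotent.exp_add_of_commute (Commute.all _ _) ⟨_, hnil huI⟩ ⟨_, hnil hCI⟩, hQ2,
      IsNilpotent.map_exp ⟨_, pow_eq_zero_of_mem_evenIdeal hsI⟩ (C : evenForms n →+* _)]
    ring
  -- The two expansions of the modular form in degree `4 w`.
  obtain ⟨h, hh1, hh2⟩ := exists_degPart_of_mem_formPairs hw' (exp_mem_formPairs (hnil h2I)
    (pow_eq_zero_of_mem_evenIdeal h1I) (exponent_mem_formPairs (chernMatrix_mem_evenDegree D.T p)
      (chernMatrix_mem_evenDegree D.W p) hTI hWI (fun k => charTrace_of_odd hTodd)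
      (fun k => charTrace_of_odd hWodd)))
  have hdeg : ((2 * (2 * w) : ℕ) : ℤ) = 4 * w := by push_cast; ring
  rw [hdeg] at hh1 hh2
  have hdegx (y : Form n) : degPart (4 * w) ((x : Form n) * y) = x * degPart (4 * w - 4) y := by
    have := degPart_mul (4 * w - 4) (mem_evenDegree.mp (evenP1Diff_mem_evenDegree D p)) y
    rwa [show ((2 * 2 : ℕ) : ℤ) + (4 * w - 4) = 4 * w by push_cast; ring] at this
  have hch (F : VirtualBundle) : D.ch p F = (chernHom D p F : evenForms n) :=
    ch_eq_chernHom hTd hWd hxid F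
  have hθch (j : ℕ) : chernHom D p (coeff j (theta2 n N M)) = coeff j (IsNilpotent.exp θ) := by
    rw [hθ, ← map_chernHom_theta2 D p hxi, coeff_map]
  have hquot (j : ℕ) : coeff j (D.quotSeries (4 * w - 4) p) = degPart (4 * w - 4)
      ((coeff j (Q * C (IsNilpotent.exp s) * IsNilpotent.exp θ) : evenForms n) : Form n) := by
    have hΘ : D.chTheta2 p = map (evenForms n).val.toRingHom (IsNilpotent.exp θ) := by
      ext1 i
      rw [BundleTriple.chTheta2, coeff_mk, hch, hθch, coeff_map]
      rfl
    have hC : C (D.tangent.aHat p) =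
        map (evenForms n).val.toRingHom (C (IsNilpotent.exp s)) := by
      rw [map_C, haHat]
      rfl
    rw [BundleTriple.quotSeries, coeff_mk, hQ1, hC, hΘ, ← map_mul, ← map_mul, coeff_map]
    rfl
  -- Both sides have unique expansions, so the coefficients `h` split.
  set b := expansion m w (theta2 n N M) with hb
  set β := expansion m w (D.quotSeries (4 * w - 4) p) with hβ
  have hb' := isExpansion_iff.mp (isExpansion_expansion m w (theta2 n N M))
  have hβ' := isExpansion_iff.mp (isExpansion_expansion m w (D.quotSeries (4 * w - 4) p))
  set T : VirtualBundle →+ Form n :=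
    ((degPartLin (4 * w)).toAddMonoidHom.comp (AddMonoidHom.mulLeft (D.tangent.aHat p))).comp
      ((evenForms n).val.toRingHom.comp (chernHom D p)).toAddMonoidHom with hT
  have hTapply (F : VirtualBundle) : degPart (4 * w) (D.tangent.aHat p * D.ch p F) = T F := by
    rw [hch]
    rfl
  have hsum (j : ℕ) : degPart (4 * w)
      ((coeff j (IsNilpotent.exp (u + C s + θ)) : evenForms n) : Form n) =
      T (coeff j (theta2 n N M)) + x * coeff j (D.quotSeries (4 * w - 4) p) := by
    rw [hquot, ← hdegx, ← hTapply, hch, hθch, haHat, hE2, map_add, coeff_C_mul, coeff_C_mul]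
    exact map_add (degPartLin (4 * w)) _ _
  have hh : h = fun r => T (b r) + x * β r := by
    refine (existsUnique_expansion m w (mk fun j => degPart (4 * w)
      ((coeff j (IsNilpotent.exp (u + C s + θ)) : evenForms n) : Form n))).unique ?_ ?_
    · refine isExpansion_iff.mpr fun j _ => ?_
      rw [coeff_mk, hh1]
      exact Finset.sum_congr rfl fun r _ => Int.cast_smul_eq_zsmul ℂ _ _
    · refine isExpansion_iff.mpr fun j hj => ?_
      rw [coeff_mk, hsum, hb' j hj, hβ' j hj, map_sum, Finset.mul_sum, ← Finset.sum_add_distrib]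
      refine Finset.sum_congr rfl fun r _ => ?_
      rw [smul_add, ← mul_smul_comm]
      exact congrArg (· + _) (map_zsmul T _ _)
  have hpow (r : Fin (m + 1)) : (2 : ℂ) ^ ((l : ℤ) + w - 6 * (r : ℕ)) =
      2 ^ l * (2 ^ (w - 2 * (r : ℕ)) * (1 / 16) ^ (r : ℕ)) := by
    have h16 : (1 / 16 : ℂ) = 2 ^ (-4 : ℤ) := by norm_num
    rw [h16, ← zpow_natCast, ← zpow_natCast, ← zpow_natCast, ← zpow_mul, ← zpow_add₀ two_ne_zero,
      ← zpow_add₀ two_ne_zero]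
    congr 1
    have := r.2
    omega
  have hfinal : degPart (4 * w) ((IsNilpotent.exp s : evenForms n) *
        (IsNilpotent.exp t : evenForms n) : Form n) +
      x * degPart (4 * w - 4) (q * ((IsNilpotent.exp s : evenForms n) *
        (IsNilpotent.exp t : evenForms n)) : Form n) =
      ∑ r : Fin (m + 1), ((2 : ℂ) ^ (w - 2 * (r : ℕ)) * (1 / 16) ^ (r : ℕ)) •
        (T (b r) + x * β r) := by
    rw [← hdegx]
    refine (map_add (degPartLin (4 * w)) _ _).symm.trans ?_
    subst hh
    rw [← hh2, hE1]
    rfl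
  have hsmul (j : ℤ) (c : ℂ) (y : Form n) : degPart j (c • y) = c • degPart j y :=
    (degPartLin j).map_smul c y
  simp only [hTapply]
  simp only [hpow, p1Diff_eq, haHat, hcosh, hq1, mul_smul_comm, hsmul, mul_smul (_ : ℂ),
    ← Finset.smul_sum, ← smul_sub]
  congr 1
  simp only [← mul_smul]
  rw [mul_sub, Finset.mul_sum, sub_eq_sub_iff_add_eq_add]
  refine hfinal.trans ?_
  simp only [mul_smul_comm, smul_add, Finset.sum_add_distrib]
  exact add_comm _ _

theorem chernMatrix_zero (p : Coord n) :
    chernMatrix (fun _ _ => 0 : Fin n → Coord n → Matrix (Fin M) (Fin M) ℂ) p = 0 := by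
  ext1 i j
  rw [chernMatrix, Matrix.smul_apply, evenCurvature_apply]
  simp [curvatureCoeff, partialMatrix]

end CancellationFormula

open AnomalyCancellation in
theorem corollary1p3 {n l : ℕ} {X : Type*} [TopologicalSpace X] [T2Space X]
    [ChartedSpace (Coord n) X] [IsManifold (𝓡 n) ∞ X]
    [RiemannianBundle (fun x : X => TangentSpace (𝓡 n) x)]
    [IsContMDiffRiemannianBundle (𝓡 n) ∞ (Coord n) (fun x : X => TangentSpace (𝓡 n) x)]
    (covT : CovariantDerivative (𝓡 n) (Coord n) (TangentSpace (𝓡 n) : X → Type))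
    [CovariantDerivative.ContMDiffCovariantDerivative covT ∞]
    (hT : IsLeviCivita covT)
    {W : X → Type*} [TopologicalSpace (TotalSpace (Coord (2 * l)) W)]
    [∀ x, NormedAddCommGroup (W x)] [∀ x, InnerProductSpace ℝ (W x)]
    [FiberBundle (Coord (2 * l)) W] [VectorBundle ℝ (Coord (2 * l)) W]
    [ContMDiffVectorBundle ∞ (Coord (2 * l)) W (𝓡 n)]
    [IsContMDiffRiemannianBundle (𝓡 n) ∞ (Coord (2 * l)) W]
    (covW : CovariantDerivative (𝓡 n) (Coord (2 * l)) W) [CovariantDerivative.ContMDiffCovariantDerivative covW ∞]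
    (hW_metric : covW.IsMetricCompatible) (m : ℕ) (x : X) :
    let D := localTriple covT covW x
    let p := extChartAt (𝓡 n) x x
    (n = 8 * m + 4 →
      degPart (8 * m + 4) (D.tangent.aHat p * D.aux.detHalfTwoCosh l p)
        - ∑ r : Fin (m + 1), (2 : ℂ) ^ ((l : ℤ) + 2 * m + 1 - 6 * (r : ℕ)) •
            degPart (8 * m + 4) (D.tangent.aHat p * D.ch p (bundleB m n (2 * l) 2 r))
        = D.p1Diff p * D.formB m l p) ∧
    (n = 8 * m →
      degPart (8 * m) (D.tangent.aHat p * D.aux.detHalfTwoCosh l p)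
        - ∑ r : Fin (m + 1), (2 : ℂ) ^ ((l : ℤ) + 2 * m - 6 * (r : ℕ)) •
            degPart (8 * m) (D.tangent.aHat p * D.ch p (bundleZ m n (2 * l) 2 r))
        = D.p1Diff p * D.formZ m l p) := by
  intro D p
  have hTd (a : Fin n) : MatrixDifferentiableAt (D.T a) p := matrixDifferentiableAt_connForm covT x a
  have hWd (a : Fin n) : MatrixDifferentiableAt (D.W a) p :=
    matrixDifferentiableAt_connForm covW x a
  have hxid (a : Fin n) : MatrixDifferentiableAt (D.xi a) p := fun _ _ => differentiableAt_const _
  have hTodd (k : ℕ) (hk : Odd k) : Matrix.trace (chernMatrix D.T p ^ k) = 0 :=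
    trace_chernMatrix_pow_of_odd
      (isUnit_det_gramForm (V := fun x : X => TangentSpace (𝓡 n) x) x)
      (curvatureCoeff_connForm_skew (V := fun x : X => TangentSpace (𝓡 n) x) covT hT.1 x) hk
  have hWodd (k : ℕ) (hk : Odd k) : Matrix.trace (chernMatrix D.W p ^ k) = 0 :=
    trace_chernMatrix_pow_of_odd (isUnit_det_gramForm x)
      (curvatureCoeff_connForm_skew covW hW_metric x) hk
  have hxi : chernMatrix D.xi p = 0 := chernMatrix_zero p
  refine ⟨fun _ => ?_, fun _ => ?_⟩
  · have h := anomaly_cancellation D p hTd hWd hxid hTodd hWodd hxi l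
      (m := m) (w := 2 * m + 1) (by omega) le_rfl
    have h1 : (4 * ((2 * m + 1 : ℕ) : ℤ)) = 8 * m + 4 := by push_cast; ring
    have h2 : ((2 * m + 1 : ℕ) : ℤ) = 2 * m + 1 := by push_cast; ring
    rw [h1, add_sub_cancel_right, h2, ← add_assoc] at h
    exact h
  · have h := anomaly_cancellation D p hTd hWd hxid hTodd hWodd hxi l
      (m := m) (w := 2 * m) le_rfl (by omega)
    have h1 : (4 * ((2 * m : ℕ) : ℤ)) = 8 * m := by push_cast; ring
    have h2 : ((2 * m : ℕ) : ℤ) = 2 * m := by push_cast; ring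
    rw [h1, h2] at h
    exact h
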